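/- Let $\Bbbk$ be a field of characteristic $0$ and let $n,r\ge 0$ be integers. Let $V=\Bbbk^n$ with basis $v_1,\dots,v_n$ and matrix units $e_{i,j}$, $e_{i,j}v_k=\delta_{j,k}v_i$. For $\boldsymbol i:\{1,\dots,r\}\to\{1,\dots,n\}$ put $v_{\boldsymbol i}=v_{i_1}\otimes\cdots\otimes v_{i_r}$, and let $w\in S_r$ act on $V^{\otimes r}$ on the right by $v_{\boldsymbol i}\cdot w=v_{\boldsymbol i\circ w}$. **Degenerate affine Hecke algebra.** $\mathrm{AH}_r$ is the $\Bbbk$-algebra generated by $x_1,\dots,x_r$ and $s_1,\dots,s_{r-1}$, where the $x_i$ commute, the $s_i$ satisfy the Coxeter relations of the simple transpositions of $S_r$, and $s_ix_i=x_{i+1}s_i+1$, $x_is_i=s_ix_{i+1}+1$, $x_is_j=s_jx_i$ for $i\ne j,j+1$. Let $\mathrm P_r=\Bbbk[x_1,\dots,x_r]$, and let $F_d\mathrm{AH}_r$ be the span of all $wf$ with $w\in S_r$ and $f\in \mathrm P_r$ of degree $\le d$. **Degenerate affine Schur algebra.** Let $M=V^{\otimes r}\otimes_{\Bbbk S_r}\mathrm{AH}_r$,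 a right $\mathrm{AH}_r$-module, filtered by letting $F_dM$ be the image of $V^{\otimes r}\otimes F_d\mathrm{AH}_r$. Put $\mathrm{AS}(n,r)=\operatorname{End}_{\mathrm{AH}_r}(M)$, filtered by $F_d\mathrm{AS}(n,r)=\{f: f(F_eM)\subseteq F_{d+e}M\text{ for all }e\ge0\}$. All filtrations are zero in degree $-1$. **Current Schur algebra.** Let $\mathrm{AS}_0(n,r)$ be the algebra of endomorphisms of $V^{\otimes r}\otimes\mathrm P_r$ commuting with multiplication by $\mathrm P_r$ on the second factor and with the right action $(v\otimes f)w=vw\otimes w^{-1}(f)$ of $S_r$. There is a canonical identification $\operatorname{gr}\mathrm{AS}(n,r)=\mathrm{AS}_0(n,r)$: identifying $\operatorname{gr}M$ with $V^{\otimes r}\otimes\mathrm P_r$, where $v\otimes f$ with $f$ homogeneous of degree $e$ corresponds to the class of $v\otimes f$ in $F_eM/F_{e-1}M$, the class of $f\in F_d\mathrm{AS}(n,r)$ is the map of degree $d$ which $f$ induces on $\operatorname{gr}M$. **Yangian.** $\mathrm Y(\mathfrak{gl}_n)$ is the $\Bbbk$-algebra with generators $T_{i,j}^{(d)}$ $(1\le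 i,j\le n,\ d\ge1)$ and relations, where $T_{i,j}^{(0)}=\delta_{i,j}$, $$[T_{i,j}^{(a)},T_{k,l}^{(b)}]=\sum_{c=0}^{\min(a,b)-1}\left(T_{i,l}^{(a+b-1-c)}T_{k,j}^{(c)}-T_{i,l}^{(c)}T_{k,j}^{(a+b-1-c)}\right)\qquad(a,b\ge1).$$ It is filtered so that $F_d$ is the span of the products $T_{i_1,j_1}^{(d_1+1)}\cdots T_{i_k,j_k}^{(d_k+1)}$ with $d_1+\cdots+d_k\le d$. Let $\mathfrak{gl}_n[x]=\mathfrak{gl}_n\otimes\Bbbk[x]$ be the current Lie algebra and $e_{i,j;d}=e_{i,j}\otimes x^d$; $\operatorname{gr}\mathrm Y(\mathfrak{gl}_n)$ is identified with $\mathrm U(\mathfrak{gl}_n[x])$ by the canonical homomorphism $\mathrm U(\mathfrak{gl}_n[x])\to\operatorname{gr}\mathrm Y(\mathfrak{gl}_n)$, $e_{i,j;d}\mapsto\operatorname{gr}_dT_{i,j}^{(d+1)}$. **Drinfeld homomorphism.** Let $T_{i,j}(u)=\sum_{d\ge0}T_{i,j}^{(d)}u^{-d}$, and write $e_{i,j}^{[p]}$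 for $e_{i,j}$ acting in the $p$th tensor position. The algebra homomorphism $\widetilde{\mathtt D}_{n,r}:\mathrm Y(\mathfrak{gl}_n)\to\operatorname{End}_\Bbbk(V)^{\otimes r}\otimes\mathrm{AH}_r$ sends $T_{i,j}(u)$ to the $(i,j)$ entry of the product over $p=1,\dots,r$ (in this order) of the $n\times n$ matrices with entries $\delta_{i,j}+\dfrac{e_{i,j}^{[p]}}{u-x_p}$, expanded in powers of $u^{-1}$. The resulting action of $\mathrm Y(\mathfrak{gl}_n)$ on $V^{\otimes r}\otimes\mathrm{AH}_r$ descends to $M$ and defines the Drinfeld homomorphism $\mathtt D_{n,r}:\mathrm Y(\mathfrak{gl}_n)\to\mathrm{AS}(n,r)$. It is filtered, and so, by the identifications above, induces $\operatorname{gr}\mathtt D_{n,r}:\mathrm U(\mathfrak{gl}_n[x])\to\mathrm{AS}_0(n,r)$. **Claim.** Both $\operatorname{gr}\mathtt D_{n,r}:\mathrm U(\mathfrak{gl}_n[x])\to\mathrm{AS}_0(n,r)$ and $\mathtt D_{n,r}:\mathrm Y(\mathfrak{gl}_n)\to\mathrm{AS}(n,r)$ are surjective. -/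

import Mathlib

namespace DrinfeldSchur

/-! ### Filtered algebras and their associated graded algebras -/

/-- An ascending filtration `F 0 ⊆ F 1 ⊆ ⋯` of a `K`-algebra by subspaces, with `1 ∈ F 0` and
`F d * F e ⊆ F (d + e)`. By convention the filtration is zero in negative degrees. -/
structure AlgFiltration (K A : Type*) [CommRing K] [Ring A] [Algebra K A] where
  F : ℕ → Submodule K A
  mono : Monotone F
  one_mem : (1 : A) ∈ F 0
  mul_mem : ∀ {d e : ℕ} {a b : A}, a ∈ F d → b ∈ F e → a * b ∈ F (d + e)

/-- The previous step `F (d - 1)` of an increasing sequence of subspaces, which is `0` for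
`d = 0`. -/
def prevStep {K M : Type*} [CommRing K] [AddCommGroup M] [Module K M] (F : ℕ → Submodule K M) :
    ℕ → Submodule K M
  | 0 => ⊥
  | d + 1 => F d

namespace AlgFiltration

variable {K A B : Type*} [CommRing K] [Ring A] [Algebra K A] [Ring B] [Algebra K B]

lemma prev_le (𝓕 : AlgFiltration K A) (d : ℕ) : prevStep 𝓕.F d ≤ 𝓕.F d := by
  cases d with
  | zero => exact bot_le
  | succ d => exact 𝓕.mono (Nat.le_succ d)

lemma prev_mul (𝓕 : AlgFiltration K A) {d e : ℕ} {a b : A} (ha : a ∈ prevStep 𝓕.F d)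
    (hb : b ∈ 𝓕.F e) : a * b ∈ prevStep 𝓕.F (d + e) := by
  cases d with
  | zero =>
    have : a = 0 := by simpa [prevStep] using ha
    simp [this]
  | succ d =>
    rw [Nat.add_right_comm]
    exact 𝓕.mul_mem ha hb

lemma mul_prev (𝓕 : AlgFiltration K A) {d e : ℕ} {a b : A} (ha : a ∈ 𝓕.F d)
    (hb : b ∈ prevStep 𝓕.F e) : a * b ∈ prevStep 𝓕.F (d + e) := by
  cases e with
  | zero =>
    have : b = 0 := by simpa [prevStep] using hb
    simp [this]
  | succ e => exact 𝓕.mul_mem ha hb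

/-- The Rees algebra `⨁ d, F d t ^ d`, as a subalgebra of `A[t]`. -/
def rees (𝓕 : AlgFiltration K A) : Subalgebra K (Polynomial A) where
  carrier := {p | ∀ d, p.coeff d ∈ 𝓕.F d}
  mul_mem' := by
    intro p q hp hq d
    rw [Polynomial.coeff_mul]
    refine Submodule.sum_mem _ fun x hx => ?_
    rw [← Finset.HasAntidiagonal.mem_antidiagonal.1 hx]
    exact 𝓕.mul_mem (hp _) (hq _)
  add_mem' := by
    intro p q hp hq d
    rw [Polynomial.coeff_add]
    exact Submodule.add_mem _ (hp d) (hq d)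
  algebraMap_mem' := by
    intro k d
    rw [Polynomial.algebraMap_apply, Polynomial.coeff_C]
    split_ifs with h
    · subst h
      rw [Algebra.algebraMap_eq_smul_one]
      exact Submodule.smul_mem _ _ 𝓕.one_mem
    · exact Submodule.zero_mem _

/-- Two elements of the Rees algebra are identified when their coefficients in each degree `d`
agree modulo `F (d - 1)`. -/
def grCon (𝓕 : AlgFiltration K A) : RingCon 𝓕.rees where
  r p q := ∀ d, (p : Polynomial A).coeff d - (q : Polynomial A).coeff d ∈ prevStep 𝓕.F d
  iseqv :=
    { refl := fun p d => by simp
      symm := fun {p q} h d => by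
        rw [← neg_sub]
        exact Submodule.neg_mem _ (h d)
      trans := fun {p q s} h h' d => by
        rw [← sub_add_sub_cancel]
        exact Submodule.add_mem _ (h d) (h' d) }
  add' := by
    intro p q p' q' h h' d
    have := Submodule.add_mem _ (h d) (h' d)
    simpa [add_sub_add_comm] using this
  mul' := by
    intro p q p' q' h h' d
    simp only [MulMemClass.coe_mul, Polynomial.coeff_mul, ← Finset.sum_sub_distrib]
    refine Submodule.sum_mem _ fun x hx => ?_
    rw [← Finset.HasAntidiagonal.mem_antidiagonal.1 hx]
    have e : ∀ a b a' b' : A, a * a' - b * b' = (a - b) * a' + b * (a' - b') := by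
      intros; noncomm_ring
    rw [e]
    exact Submodule.add_mem _ (𝓕.prev_mul (h _) (p'.2 _)) (𝓕.mul_prev (q.2 _) (h' _))

/-- The associated graded algebra `⨁ d, F d / F (d - 1)`, as a quotient of the Rees algebra. -/
def Gr (𝓕 : AlgFiltration K A) : Type _ := 𝓕.grCon.Quotient

noncomputable instance (𝓕 : AlgFiltration K A) : Ring 𝓕.Gr :=
  inferInstanceAs (Ring 𝓕.grCon.Quotient)

noncomputable instance (𝓕 : AlgFiltration K A) : Algebra K 𝓕.Gr :=
  inferInstanceAs (Algebra K 𝓕.grCon.Quotient)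

/-- The quotient map from the Rees algebra to the associated graded algebra. -/
noncomputable def grMk (𝓕 : AlgFiltration K A) : 𝓕.rees →ₐ[K] 𝓕.Gr := 𝓕.grCon.mkₐ K

lemma grMk_eq_iff (𝓕 : AlgFiltration K A) (p q : 𝓕.rees) : 𝓕.grMk p = 𝓕.grMk q ↔
    ∀ d, (p : Polynomial A).coeff d - (q : Polynomial A).coeff d ∈ prevStep 𝓕.F d :=
  RingCon.eq _

lemma monomial_mem_rees (𝓕 : AlgFiltration K A) (d : ℕ) (a : A) (ha : a ∈ 𝓕.F d) :
    Polynomial.monomial d a ∈ 𝓕.rees := by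
  intro e
  rw [Polynomial.coeff_monomial]
  split_ifs with h
  · exact h ▸ ha
  · exact Submodule.zero_mem _

/-- The symbol map `gr_d : F d → F d / F (d - 1) ⊆ gr A`. -/
noncomputable def symb (𝓕 : AlgFiltration K A) (d : ℕ) (a : A) (ha : a ∈ 𝓕.F d) : 𝓕.Gr :=
  𝓕.grMk ⟨Polynomial.monomial d a, 𝓕.monomial_mem_rees d a ha⟩

/-- The homomorphism of Rees algebras induced by a filtered homomorphism `φ : A → B`. -/
noncomputable def reesMap (𝓕 : AlgFiltration K A) (𝓖 : AlgFiltration K B) (φ : A →ₐ[K] B)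
    (hφ : ∀ d, ∀ a ∈ 𝓕.F d, φ a ∈ 𝓖.F d) : 𝓕.rees →ₐ[K] 𝓖.rees :=
  ((Polynomial.mapAlgHom φ).comp 𝓕.rees.val).codRestrict 𝓖.rees (by
    intro p d
    simpa [Polynomial.coeff_map] using hφ d _ (p.2 d))

lemma coe_reesMap (𝓕 : AlgFiltration K A) (𝓖 : AlgFiltration K B) (φ : A →ₐ[K] B)
    (hφ : ∀ d, ∀ a ∈ 𝓕.F d, φ a ∈ 𝓖.F d) (p : 𝓕.rees) :
    (reesMap 𝓕 𝓖 φ hφ p : Polynomial B) = Polynomial.map (φ : A →+* B) (p : Polynomial A) := rfl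

/-- The homomorphism `gr φ : gr A → gr B`, `gr_d a ↦ gr_d (φ a)`, induced by a filtered
homomorphism `φ : A → B`. -/
noncomputable def grMap (𝓕 : AlgFiltration K A) (𝓖 : AlgFiltration K B) (φ : A →ₐ[K] B)
    (hφ : ∀ d, ∀ a ∈ 𝓕.F d, φ a ∈ 𝓖.F d) : 𝓕.Gr →ₐ[K] 𝓖.Gr :=
  RingCon.liftₐ 𝓕.grCon (𝓖.grMk.comp (reesMap 𝓕 𝓖 φ hφ)) (by
    intro p q h
    refine (𝓖.grMk_eq_iff _ _).2 ?_
    intro d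
    have key : ∀ a ∈ prevStep 𝓕.F d, φ a ∈ prevStep 𝓖.F d := by
      cases d with
      | zero =>
        intro a ha
        have : a = 0 := by simpa [prevStep] using ha
        simp [this]
      | succ d => exact hφ d
    simpa [Polynomial.coeff_map, coe_reesMap] using key _ (h d))

lemma grMap_symb (𝓕 : AlgFiltration K A) (𝓖 : AlgFiltration K B) (φ : A →ₐ[K] B)
    (hφ : ∀ d, ∀ a ∈ 𝓕.F d, φ a ∈ 𝓖.F d) (d : ℕ) (a : A) (ha : a ∈ 𝓕.F d) :
    grMap 𝓕 𝓖 φ hφ (𝓕.symb d a ha) = 𝓖.symb d (φ a) (hφ d a ha) := by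
  change 𝓖.grMk (reesMap 𝓕 𝓖 φ hφ _) = 𝓖.grMk _
  congr 1
  apply Subtype.ext
  simp [coe_reesMap]

lemma symb_eq_iff (𝓕 : AlgFiltration K A) (d : ℕ) (a b : A) (ha : a ∈ 𝓕.F d) (hb : b ∈ 𝓕.F d) :
    𝓕.symb d a ha = 𝓕.symb d b hb ↔ a - b ∈ prevStep 𝓕.F d := by
  unfold symb
  rw [grMk_eq_iff]
  constructor
  · intro h
    simpa using h d
  · intro h e
    simp only [Polynomial.coeff_monomial]
    split_ifs with he
    · exact he ▸ h
    · simp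

lemma symb_sub (𝓕 : AlgFiltration K A) (d : ℕ) (a b : A) (ha : a ∈ 𝓕.F d) (hb : b ∈ 𝓕.F d) :
    𝓕.symb d a ha - 𝓕.symb d b hb = 𝓕.symb d (a - b) (Submodule.sub_mem _ ha hb) := by
  unfold symb
  rw [← map_sub]
  congr 1
  apply Subtype.ext
  simp

lemma symb_zero (𝓕 : AlgFiltration K A) (d : ℕ) : 𝓕.symb d 0 (Submodule.zero_mem _) = 0 := by
  unfold symb
  rw [← map_zero 𝓕.grMk]
  congr 1
  apply Subtype.ext
  simp

lemma symb_mul (𝓕 : AlgFiltration K A) (d e : ℕ) (a b : A) (ha : a ∈ 𝓕.F d) (hb : b ∈ 𝓕.F e) :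
    𝓕.symb d a ha * 𝓕.symb e b hb = 𝓕.symb (d + e) (a * b) (𝓕.mul_mem ha hb) := by
  unfold symb
  rw [← map_mul]
  congr 1
  apply Subtype.ext
  simp [Polynomial.monomial_mul_monomial]

end AlgFiltration

/-! ### The degenerate affine Hecke algebra -/

/-- The position `i`, for `i` indexing a simple transposition `s_i = (i, i + 1)`. -/
def lo {r : ℕ} (i : Fin (r - 1)) : Fin r := ⟨i, by omega⟩

/-- The position `i + 1`, for `i` indexing a simple transposition `s_i = (i, i + 1)`. -/
def hi {r : ℕ} (i : Fin (r - 1)) : Fin r := ⟨i + 1, by omega⟩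

/-- The generators `x_1, …, x_r` and `s_1, …, s_{r-1}`. -/
inductive HeckeGen (r : ℕ) : Type
  | x (p : Fin r)
  | s (i : Fin (r - 1))

open HeckeGen in
/-- The defining relations of the degenerate affine Hecke algebra. -/
inductive HeckeRel (K : Type*) [CommRing K] (r : ℕ) :
    FreeAlgebra K (HeckeGen r) → FreeAlgebra K (HeckeGen r) → Prop
  | xx (p q : Fin r) : HeckeRel K r
      (FreeAlgebra.ι K (x p) * FreeAlgebra.ι K (x q))
      (FreeAlgebra.ι K (x q) * FreeAlgebra.ι K (x p))
  | sq (i : Fin (r - 1)) : HeckeRel K r (FreeAlgebra.ι K (s i) * FreeAlgebra.ι K (s i)) 1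
  | braid (i j : Fin (r - 1)) (h : (i : ℕ) + 1 = j) : HeckeRel K r
      (FreeAlgebra.ι K (s i) * FreeAlgebra.ι K (s j) * FreeAlgebra.ι K (s i))
      (FreeAlgebra.ι K (s j) * FreeAlgebra.ι K (s i) * FreeAlgebra.ι K (s j))
  | comm (i j : Fin (r - 1)) (h : (i : ℕ) + 1 < j) : HeckeRel K r
      (FreeAlgebra.ι K (s i) * FreeAlgebra.ι K (s j))
      (FreeAlgebra.ι K (s j) * FreeAlgebra.ι K (s i))
  | sx (i : Fin (r - 1)) : HeckeRel K r
      (FreeAlgebra.ι K (s i) * FreeAlgebra.ι K (x (lo i)))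
      (FreeAlgebra.ι K (x (hi i)) * FreeAlgebra.ι K (s i) + 1)
  | xs (i : Fin (r - 1)) : HeckeRel K r
      (FreeAlgebra.ι K (x (lo i)) * FreeAlgebra.ι K (s i))
      (FreeAlgebra.ι K (s i) * FreeAlgebra.ι K (x (hi i)) + 1)
  | xs_comm (p : Fin r) (i : Fin (r - 1)) (h₁ : p ≠ lo i) (h₂ : p ≠ hi i) : HeckeRel K r
      (FreeAlgebra.ι K (x p) * FreeAlgebra.ι K (s i))
      (FreeAlgebra.ι K (s i) * FreeAlgebra.ι K (x p))

/-- The degenerate affine Hecke algebra `AH_r`. -/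
def AH (K : Type*) [CommRing K] (r : ℕ) : Type _ := RingQuot (HeckeRel K r)

namespace AH

variable {K : Type*} [CommRing K] {r : ℕ}

noncomputable instance : Ring (AH K r) := inferInstanceAs (Ring (RingQuot (HeckeRel K r)))

noncomputable instance : Algebra K (AH K r) :=
  inferInstanceAs (Algebra K (RingQuot (HeckeRel K r)))

variable (K) in
/-- The generator `x_p` of `AH_r`. -/
noncomputable def x (p : Fin r) : AH K r :=
  RingQuot.mkAlgHom K (HeckeRel K r) (FreeAlgebra.ι K (HeckeGen.x p))

variable (K) in
/-- The generator `s_i` of `AH_r`. -/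
noncomputable def s (i : Fin (r - 1)) : AH K r :=
  RingQuot.mkAlgHom K (HeckeRel K r) (FreeAlgebra.ι K (HeckeGen.s i))

lemma x_mul_x (p q : Fin r) : x K p * x K q = x K q * x K p := by
  have h := RingQuot.mkAlgHom_rel K (HeckeRel.xx (K := K) p q)
  rw [map_mul, map_mul] at h
  exact h

lemma s_mul_x_lo (i : Fin (r - 1)) : s K i * x K (lo i) = x K (hi i) * s K i + 1 := by
  have h := RingQuot.mkAlgHom_rel K (HeckeRel.sx (K := K) i)
  rw [map_add, map_mul, map_mul, map_one] at h
  exact h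

lemma x_lo_mul_s (i : Fin (r - 1)) : x K (lo i) * s K i = s K i * x K (hi i) + 1 := by
  have h := RingQuot.mkAlgHom_rel K (HeckeRel.xs (K := K) i)
  rw [map_add, map_mul, map_mul, map_one] at h
  exact h

lemma x_mul_s (p : Fin r) (i : Fin (r - 1)) (h₁ : p ≠ lo i) (h₂ : p ≠ hi i) :
    x K p * s K i = s K i * x K p := by
  have h := RingQuot.mkAlgHom_rel K (HeckeRel.xs_comm (K := K) p i h₁ h₂)
  rw [map_mul, map_mul] at h
  exact h

lemma isMulCommutative_adjoin_x : IsMulCommutative (Algebra.adjoin K (Set.range (x K (r := r)))) :=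
  Algebra.isMulCommutative_adjoin K (by
    rintro _ ⟨p, rfl⟩ _ ⟨q, rfl⟩
    exact x_mul_x p q)

attribute [local instance] isMulCommutative_adjoin_x in
open scoped IsMulCommutative in
/-- The homomorphism `P_r = K[x_1, …, x_r] → AH_r`. -/
noncomputable def poly : MvPolynomial (Fin r) K →ₐ[K] AH K r :=
  (Algebra.adjoin K (Set.range (x K (r := r)))).val.comp
    (MvPolynomial.aeval fun p =>
      (⟨x K p, Algebra.subset_adjoin ⟨p, rfl⟩⟩ : Algebra.adjoin K (Set.range (x K (r := r)))))

lemma poly_X (p : Fin r) : poly (K := K) (MvPolynomial.X p) = x K p := by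
  simp [poly]

end AH

/-! ### The Yangian -/

/-- The element `T_{i,j}^{(d)}` of the free algebra on the generators `T_{i,j}^{(d)}`, `d ≥ 1`,
with `T_{i,j}^{(0)} = δ_{i,j}`; the free generator `T_{i,j}^{(d + 1)}` is indexed by
`(i, j, d)`. -/
noncomputable def freeT (K : Type*) [CommRing K] {n : ℕ} (i j : Fin n) :
    ℕ → FreeAlgebra K (Fin n × Fin n × ℕ)
  | 0 => if i = j then 1 else 0
  | d + 1 => FreeAlgebra.ι K (i, j, d)

/-- The defining (RTT) relations of the Yangian of `gl_n`. -/
inductive YangianRel (K : Type*) [CommRing K] (n : ℕ) :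
    FreeAlgebra K (Fin n × Fin n × ℕ) → FreeAlgebra K (Fin n × Fin n × ℕ) → Prop
  | rtt (i j k l : Fin n) (a b : ℕ) (ha : 1 ≤ a) (hb : 1 ≤ b) : YangianRel K n
      (freeT K i j a * freeT K k l b - freeT K k l b * freeT K i j a)
      (∑ c ∈ Finset.range (min a b),
        (freeT K i l (a + b - 1 - c) * freeT K k j c
          - freeT K i l c * freeT K k j (a + b - 1 - c)))

/-- The Yangian `Y(gl_n)`. -/
def Yangian (K : Type*) [CommRing K] (n : ℕ) : Type _ := RingQuot (YangianRel K n)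

namespace Yangian

variable {K : Type*} [CommRing K] {n : ℕ}

noncomputable instance : Ring (Yangian K n) := inferInstanceAs (Ring (RingQuot (YangianRel K n)))

noncomputable instance : Algebra K (Yangian K n) :=
  inferInstanceAs (Algebra K (RingQuot (YangianRel K n)))

variable (K n) in
/-- The quotient map from the free algebra. -/
noncomputable def mk : FreeAlgebra K (Fin n × Fin n × ℕ) →ₐ[K] Yangian K n :=
  RingQuot.mkAlgHom K (YangianRel K n)

variable (K) in
/-- The element `T_{i,j}^{(d)}` of the Yangian. -/
noncomputable def T (i j : Fin n) (d : ℕ) : Yangian K n := mk K n (freeT K i j d)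

lemma T_zero (i j : Fin n) : T K i j 0 = if i = j then 1 else 0 := by
  unfold T freeT
  split_ifs <;> simp

lemma T_comm (i j k l : Fin n) (a b : ℕ) (ha : 1 ≤ a) (hb : 1 ≤ b) :
    T K i j a * T K k l b - T K k l b * T K i j a =
      ∑ c ∈ Finset.range (min a b),
        (T K i l (a + b - 1 - c) * T K k j c - T K i l c * T K k j (a + b - 1 - c)) := by
  have h := RingQuot.mkAlgHom_rel K (YangianRel.rtt (K := K) i j k l a b ha hb)
  rw [map_sub, map_mul, map_mul, map_sum] at h
  simp only [map_sub, map_mul] at h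
  exact h

/-- The universal property of the Yangian. -/
noncomputable def lift {B : Type*} [Ring B] [Algebra K B] (t : Fin n → Fin n → ℕ → B)
    (h0 : ∀ i j, t i j 0 = if i = j then 1 else 0)
    (h : ∀ i j k l a b, 1 ≤ a → 1 ≤ b → t i j a * t k l b - t k l b * t i j a =
      ∑ c ∈ Finset.range (min a b),
        (t i l (a + b - 1 - c) * t k j c - t i l c * t k j (a + b - 1 - c))) :
    Yangian K n →ₐ[K] B :=
  RingQuot.liftAlgHom K ⟨FreeAlgebra.lift K fun g => t g.1 g.2.1 (g.2.2 + 1), by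
    have key : ∀ i j d, FreeAlgebra.lift K (fun g : Fin n × Fin n × ℕ => t g.1 g.2.1 (g.2.2 + 1))
        (freeT K i j d) = t i j d := by
      intro i j d
      cases d with
      | zero =>
        rw [h0]
        unfold freeT
        split_ifs <;> simp
      | succ d => simp [freeT]
    rintro _ _ ⟨i, j, k, l, a, b, ha, hb⟩
    simp only [map_sub, map_mul, map_sum, key]
    exact h i j k l a b ha hb⟩

lemma lift_T {B : Type*} [Ring B] [Algebra K B] (t : Fin n → Fin n → ℕ → B)
    (h0 : ∀ i j, t i j 0 = if i = j then 1 else 0)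
    (h : ∀ i j k l a b, 1 ≤ a → 1 ≤ b → t i j a * t k l b - t k l b * t i j a =
      ∑ c ∈ Finset.range (min a b),
        (t i l (a + b - 1 - c) * t k j c - t i l c * t k j (a + b - 1 - c)))
    (i j : Fin n) (d : ℕ) : lift t h0 h (T K i j d) = t i j d := by
  have e : ∀ y, lift t h0 h (mk K n y)
      = FreeAlgebra.lift K (fun g : Fin n × Fin n × ℕ => t g.1 g.2.1 (g.2.2 + 1)) y :=
    fun y => RingQuot.liftAlgHom_mkAlgHom_apply K _ _ y
  unfold T
  rw [e]
  cases d with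
  | zero =>
    rw [h0]
    unfold freeT
    split_ifs <;> simp
  | succ d => simp [freeT]

lemma mk_surjective : Function.Surjective (mk K n) := RingQuot.mkAlgHom_surjective K _

/-- The product of generators `T_{i_1,j_1}^{(d_1 + 1)} ⋯ T_{i_k,j_k}^{(d_k + 1)}`. -/
noncomputable def word (w : List (Fin n × Fin n × ℕ)) : Yangian K n :=
  (w.map fun g => T K g.1 g.2.1 (g.2.2 + 1)).prod

/-- The degree `d_1 + ⋯ + d_k` of a product of generators. -/
def wordDeg (w : List (Fin n × Fin n × ℕ)) : ℕ := (w.map fun g => g.2.2).sum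

variable (K n) in
/-- The filtration of the Yangian in which `T_{i,j}^{(d + 1)}` has degree `d`. -/
noncomputable def filtration : AlgFiltration K (Yangian K n) where
  F d := Submodule.span K {y | ∃ w : List (Fin n × Fin n × ℕ), wordDeg w ≤ d ∧ y = word w}
  mono d e hde := Submodule.span_mono (by
    rintro _ ⟨w, hw, rfl⟩
    exact ⟨w, hw.trans hde, rfl⟩)
  one_mem := Submodule.subset_span ⟨[], by simp [wordDeg], by simp [word]⟩
  mul_mem := by
    intro d e a b ha hb
    refine Submodule.span_induction₂ (p := fun a b _ _ => a * b ∈ Submodule.span K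
      {y | ∃ w : List (Fin n × Fin n × ℕ), wordDeg w ≤ d + e ∧ y = word w})
      ?_ ?_ ?_ ?_ ?_ ?_ ?_ ha hb
    · rintro _ _ ⟨v, hv, rfl⟩ ⟨w, hw, rfl⟩
      refine Submodule.subset_span ⟨v ++ w, ?_, ?_⟩
      · simp only [wordDeg, List.map_append, List.sum_append] at *
        omega
      · simp [word]
    · intro y _
      simp
    · intro x _
      simp
    · intro x y z _ _ _ h h'
      rw [add_mul]
      exact Submodule.add_mem _ h h'
    · intro x y z _ _ _ h h'
      rw [mul_add]
      exact Submodule.add_mem _ h h'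
    · intro c x y _ _ h
      rw [smul_mul_assoc]
      exact Submodule.smul_mem _ _ h
    · intro c x y _ _ h
      rw [mul_smul_comm]
      exact Submodule.smul_mem _ _ h

lemma T_mem (i j : Fin n) (d : ℕ) : T K i j (d + 1) ∈ (filtration K n).F d :=
  Submodule.subset_span ⟨[(i, j, d)], by simp [wordDeg], by simp [word]⟩

end Yangian

/-! ### The current Lie algebra and `gr Y(gl_n)` -/

/-- The current Lie algebra `gl_n[x] = gl_n ⊗ K[x]`, as the Lie algebra of `n × n` matrices over
`K[x]`. -/
abbrev Current (K : Type*) [CommRing K] (n : ℕ) : Type _ :=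
  Matrix (Fin n) (Fin n) (Polynomial K)

/-- The element `e_{i,j;d} = e_{i,j} ⊗ x ^ d` of the current Lie algebra. -/
noncomputable def currentE (K : Type*) [CommRing K] {n : ℕ} (i j : Fin n) (d : ℕ) : Current K n :=
  Matrix.single i j (Polynomial.X ^ d)

section CurrentToGr

attribute [local instance] LieRing.ofAssociativeRing

variable (K : Type*) [CommRing K] (n : ℕ)

/-- The top symbol `gr_d T_{i,j}^{(d + 1)}` in `gr Y(gl_n)`. -/
noncomputable def grT (i j : Fin n) (d : ℕ) : (Yangian.filtration K n).Gr :=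
  (Yangian.filtration K n).symb d (Yangian.T K i j (d + 1)) (Yangian.T_mem i j d)

/-- The linear map `gl_n[x] → gr Y(gl_n)`, `e_{i,j;d} ↦ gr_d T_{i,j}^{(d + 1)}`. -/
noncomputable def currentLin : Current K n →ₗ[K] (Yangian.filtration K n).Gr :=
  ∑ i, ∑ j, (Polynomial.lsum fun d => LinearMap.toSpanSingleton K _ (grT K n i j d)) ∘ₗ
    Matrix.entryLinearMap K (Polynomial K) i j

lemma currentLin_E (i j : Fin n) (d : ℕ) : currentLin K n (currentE K i j d) = grT K n i j d := by
  simp only [currentLin, currentE, LinearMap.sum_apply, LinearMap.comp_apply,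
    Matrix.entryLinearMap_apply]
  rw [Finset.sum_eq_single i, Finset.sum_eq_single j]
  · simp [Polynomial.lsum_apply, Polynomial.X_pow_eq_monomial, Polynomial.sum_monomial_index]
  · intro b _ hb
    simp [hb.symm]
  · simp
  · intro b _ hb
    simp [hb.symm]
  · simp

/-- `gr Y(gl_n)` satisfies the relations of the current Lie algebra. -/
lemma grT_comm (i j k l : Fin n) (a b : ℕ) :
    grT K n i j a * grT K n k l b - grT K n k l b * grT K n i j a =
      (if j = k then grT K n i l (a + b) else 0) - (if i = l then grT K n k j (a + b) else 0) := by
  have h1 : ∀ (P : Prop) [Decidable P] (i l : Fin n),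
      (if P then Yangian.T K i l (a + b + 1) else 0) ∈ (Yangian.filtration K n).F (a + b) := by
    intro P _ i l
    split_ifs
    · exact Yangian.T_mem i l (a + b)
    · exact Submodule.zero_mem _
  have h2 : ∀ (P : Prop) [Decidable P] (i l : Fin n), (if P then grT K n i l (a + b) else 0) =
      (Yangian.filtration K n).symb (a + b) (if P then Yangian.T K i l (a + b + 1) else 0)
        (h1 P i l) := by
    intro P _ i l
    split_ifs
    · rfl
    · rw [AlgFiltration.symb_zero]
  have h3 : ∀ (d e : ℕ) (y : Yangian K n) (h : y ∈ (Yangian.filtration K n).F d) (hde : d = e),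
      (Yangian.filtration K n).symb d y h = (Yangian.filtration K n).symb e y (hde ▸ h) := by
    rintro d _ y h rfl
    rfl
  rw [h2, h2]
  unfold grT
  rw [AlgFiltration.symb_mul, AlgFiltration.symb_mul, h3 (b + a) (a + b) _ _ (add_comm b a),
    AlgFiltration.symb_sub, AlgFiltration.symb_sub, AlgFiltration.symb_eq_iff,
    Yangian.T_comm _ _ _ _ _ _ (by omega) (by omega), ← Nat.succ_eq_add_one,
    ← Nat.succ_eq_add_one, Nat.succ_min_succ, Nat.succ_eq_add_one, Finset.sum_range_succ',
    Yangian.T_zero, Yangian.T_zero]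
  have e1 : a + 1 + (b + 1) - 1 - 0 = a + b + 1 := by omega
  simp only [Nat.succ_eq_add_one, e1, mul_ite, ite_mul, mul_one, one_mul, mul_zero, zero_mul]
  simp only [eq_comm (a := k) (b := j), add_sub_cancel_right]
  refine Submodule.sum_mem _ fun c hc => ?_
  have hc' := Finset.mem_range.1 hc
  obtain ⟨m, hm⟩ : ∃ m, a + b = m + 1 := ⟨a + b - 1, by omega⟩
  have e2 : a + 1 + (b + 1) - 1 - (c + 1) = (m - c) + 1 := by omega
  have e3 : m = (m - c) + c := by omega
  rw [e2, hm]
  change _ ∈ (Yangian.filtration K n).F m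
  refine Submodule.sub_mem _ ?_ ?_
  · rw [e3, Nat.add_sub_cancel]
    exact (Yangian.filtration K n).mul_mem (Yangian.T_mem _ _ _) (Yangian.T_mem _ _ _)
  · rw [e3, Nat.add_sub_cancel, add_comm (m - c) c]
    exact (Yangian.filtration K n).mul_mem (Yangian.T_mem _ _ _) (Yangian.T_mem _ _ _)

lemma current_span : Submodule.span K
    {A : Current K n | ∃ i j d, A = currentE K i j d} = ⊤ := by
  rw [eq_top_iff]
  rintro A -
  rw [Matrix.matrix_eq_sum_single A]
  refine Submodule.sum_mem _ fun i _ => Submodule.sum_mem _ fun j _ => ?_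
  induction A i j using Polynomial.induction_on' with
  | add p q hp hq =>
    rw [Matrix.single_add]
    exact Submodule.add_mem _ hp hq
  | monomial d c =>
    have : Matrix.single i j (Polynomial.monomial d c) = c • currentE K i j d := by
      rw [currentE, Matrix.smul_single, Polynomial.smul_X_eq_monomial]
    rw [this]
    exact Submodule.smul_mem _ _ (Submodule.subset_span ⟨i, j, d, rfl⟩)

lemma currentLin_comm (A B : Current K n) :
    currentLin K n (A * B - B * A) =
      currentLin K n A * currentLin K n B - currentLin K n B * currentLin K n A := by
  have hA : A ∈ Submodule.span K {A : Current K n | ∃ i j d, A = currentE K i j d} := by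
    rw [current_span]; trivial
  have hB : B ∈ Submodule.span K {A : Current K n | ∃ i j d, A = currentE K i j d} := by
    rw [current_span]; trivial
  refine Submodule.span_induction₂ (p := fun A B _ _ => currentLin K n (A * B - B * A) =
      currentLin K n A * currentLin K n B - currentLin K n B * currentLin K n A)
    ?_ ?_ ?_ ?_ ?_ ?_ ?_ hA hB
  · rintro _ _ ⟨i, j, a, rfl⟩ ⟨k, l, b, rfl⟩
    have e : currentE K i j a * currentE K k l b - currentE K k l b * currentE K i j a =
        (if j = k then currentE K i l (a + b) else 0)
          - (if i = l then currentE K k j (a + b) else 0) := by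
      unfold currentE
      congr 1
      · split_ifs with h
        · subst h
          rw [Matrix.single_mul_single_same, pow_add]
        · rw [Matrix.single_mul_single_of_ne _ _ _ _ h]
      · split_ifs with h
        · subst h
          rw [Matrix.single_mul_single_same, add_comm a b, pow_add]
        · rw [Matrix.single_mul_single_of_ne _ _ _ _ (Ne.symm h)]
    rw [e, map_sub, currentLin_E, currentLin_E, grT_comm]
    congr 1 <;> split_ifs <;> simp [currentLin_E]
  · intro y _
    simp
  · intro x _
    simp
  · intro x y z _ _ _ h h'
    have e : (x + y) * z - z * (x + y) = (x * z - z * x) + (y * z - z * y) := by noncomm_ring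
    rw [e, map_add, h, h', map_add, add_mul, mul_add]
    abel
  · intro x y z _ _ _ h h'
    have e : x * (y + z) - (y + z) * x = (x * y - y * x) + (x * z - z * x) := by noncomm_ring
    rw [e, map_add, h, h', map_add, add_mul, mul_add]
    abel
  · intro c x y _ _ h
    rw [smul_mul_assoc, mul_smul_comm, ← smul_sub, map_smul, h, map_smul, smul_mul_assoc,
      mul_smul_comm, smul_sub]
  · intro c x y _ _ h
    rw [smul_mul_assoc, mul_smul_comm, ← smul_sub, map_smul, h, map_smul, smul_mul_assoc,
      mul_smul_comm, smul_sub]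

/-- The universal enveloping algebra `U(gl_n[x])` of the current Lie algebra. -/
abbrev UCurrent : Type _ := UniversalEnvelopingAlgebra K (Current K n)

/-- The canonical homomorphism `U(gl_n[x]) → gr Y(gl_n)`, `e_{i,j;d} ↦ gr_d T_{i,j}^{(d + 1)}`,
through which `gr Y(gl_n)` is identified with `U(gl_n[x])`. -/
noncomputable def currentToGr :
    UCurrent K n →ₐ[K] (Yangian.filtration K n).Gr :=
  UniversalEnvelopingAlgebra.lift K
    { currentLin K n with
      map_lie' := fun {A B} => currentLin_comm K n A B }

lemma currentToGr_E (i j : Fin n) (d : ℕ) :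
    currentToGr K n (UniversalEnvelopingAlgebra.ι K (currentE K i j d)) =
      (Yangian.filtration K n).symb d (Yangian.T K i j (d + 1)) (Yangian.T_mem i j d) := by
  unfold currentToGr
  rw [UniversalEnvelopingAlgebra.lift_ι_apply]
  exact currentLin_E K n i j d

end CurrentToGr

/-! ### RTT calculus for matrices of formal power series in `u⁻¹`

For a ring `B`, a matrix `S` over `B⟦u⁻¹⟧` is viewed in `B⟦u⁻¹⟧⟦v⁻¹⟧` in two ways, as `S(u)` and
as `S(v)`. -/

section RTT

variable {B : Type*} [Ring B]

/-- `f ↦ f(u)`. -/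
noncomputable def inU : PowerSeries B →+* PowerSeries (PowerSeries B) := PowerSeries.C

/-- `f ↦ f(v)`. -/
noncomputable def inV : PowerSeries B →+* PowerSeries (PowerSeries B) :=
  PowerSeries.map PowerSeries.C

lemma coeff_inU_mul_inV (f g : PowerSeries B) (a b : ℕ) :
    PowerSeries.coeff a (PowerSeries.coeff b (inU f * inV g)) =
      PowerSeries.coeff a f * PowerSeries.coeff b g := by
  simp [inU, inV]

lemma coeff_inV_mul_inU (f g : PowerSeries B) (a b : ℕ) :
    PowerSeries.coeff a (PowerSeries.coeff b (inV g * inU f)) =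
      PowerSeries.coeff b g * PowerSeries.coeff a f := by
  simp [inU, inV]

lemma commute_inU_X (f : PowerSeries (PowerSeries B)) :
    Commute (inU (PowerSeries.X : PowerSeries B)) f := by
  ext b : 1
  simp only [inU, PowerSeries.coeff_C_mul, PowerSeries.coeff_mul_C]
  exact (PowerSeries.commute_X _).symm.eq

lemma commute_inV_X (f : PowerSeries (PowerSeries B)) :
    Commute (inV (PowerSeries.X : PowerSeries B)) f := by
  simp only [inV, PowerSeries.map_X]
  exact (PowerSeries.commute_X _).symm

/-- The RTT relation, multiplied by `u⁻¹ v⁻¹`: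
`(u - v) [S_{i,j}(u), S_{k,l}(v)] = S_{k,j}(u) S_{i,l}(v) - S_{k,j}(v) S_{i,l}(u)`. -/
def RTT {n : ℕ} (S : Matrix (Fin n) (Fin n) (PowerSeries B)) : Prop :=
  ∀ i j k l, (inV PowerSeries.X - inU PowerSeries.X) *
      (inU (S i j) * inV (S k l) - inV (S k l) * inU (S i j)) =
    (inU PowerSeries.X * inV PowerSeries.X) *
      (inU (S k j) * inV (S i l) - inV (S k j) * inU (S i l))

lemma rtt_mul_aux {R : Type*} [Ring R] {n : ℕ} (α β : R) (hα : ∀ c, Commute α c)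
    (hβ : ∀ c, Commute β c) (S S' T T' : Matrix (Fin n) (Fin n) R)
    (hS : ∀ i j k l, α * (S i j * S' k l - S' k l * S i j) =
      β * (S k j * S' i l - S' k j * S i l))
    (hT : ∀ i j k l, α * (T i j * T' k l - T' k l * T i j) =
      β * (T k j * T' i l - T' k j * T i l))
    (h1 : ∀ i j k l, Commute (T i j) (S' k l)) (h2 : ∀ i j k l, Commute (S i j) (T' k l))
    (i j k l : Fin n) :
    α * ((S * T) i j * (S' * T') k l - (S' * T') k l * (S * T) i j) =
      β * ((S * T) k j * (S' * T') i l - (S' * T') k j * (S * T) i l) := by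
  have e1 : ∀ i j k l, (S * T) i j * (S' * T') k l =
      ∑ a, ∑ c, S i a * S' k c * (T a j * T' c l) := by
    intro i j k l
    rw [Matrix.mul_apply, Matrix.mul_apply, Finset.sum_mul_sum]
    refine Finset.sum_congr rfl fun a _ => Finset.sum_congr rfl fun c _ => ?_
    rw [mul_assoc, mul_assoc, ← mul_assoc (T a j), (h1 a j k c).eq, mul_assoc]
  have e2 : ∀ i j k l, (S' * T') k l * (S * T) i j =
      ∑ a, ∑ c, S' k c * S i a * (T' c l * T a j) := by
    intro i j k l
    rw [Matrix.mul_apply, Matrix.mul_apply, Finset.sum_mul_sum, Finset.sum_comm]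
    refine Finset.sum_congr rfl fun a _ => Finset.sum_congr rfl fun c _ => ?_
    rw [mul_assoc, mul_assoc, ← mul_assoc (T' c l), ← (h2 i a c l).eq, mul_assoc]
  have e3 : ∀ a c, α * (S i a * S' k c * (T a j * T' c l) - S' k c * S i a * (T' c l * T a j)) =
      β * (S k a * S' i c * (T a j * T' c l)) - β * (S' k a * S i c * (T a j * T' c l)) +
        (β * (S' k c * S i a * (T c j * T' a l)) - β * (S' k c * S i a * (T' c j * T a l))) := by
    intro a c
    have : α * (S i a * S' k c * (T a j * T' c l) - S' k c * S i a * (T' c l * T a j)) =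
        (α * (S i a * S' k c - S' k c * S i a)) * (T a j * T' c l) +
          S' k c * S i a * (α * (T a j * T' c l - T' c l * T a j)) := by
      rw [← mul_assoc (S' k c * S i a) α, ← (hα _).eq]
      noncomm_ring
    rw [this, hS, hT, ← mul_assoc (S' k c * S i a) β, ← (hβ _).eq]
    noncomm_ring
  rw [e1, e2, e1, e2]
  simp only [← Finset.sum_sub_distrib, Finset.mul_sum]
  simp only [e3, Finset.sum_add_distrib, Finset.sum_sub_distrib, mul_sub]
  have e4 : ∑ a, ∑ c, β * (S' k c * S i a * (T c j * T' a l)) =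
      ∑ a, ∑ c, β * (S' k a * S i c * (T a j * T' c l)) := Finset.sum_comm
  rw [e4, sub_add_sub_cancel]

/-- Entrywise commutation of two matrices of power series. -/
def CommEntries {n : ℕ} (S T : Matrix (Fin n) (Fin n) (PowerSeries B)) : Prop :=
  ∀ i j k l a b, Commute (PowerSeries.coeff a (S i j)) (PowerSeries.coeff b (T k l))

lemma CommEntries.commute {n : ℕ} {S T : Matrix (Fin n) (Fin n) (PowerSeries B)}
    (h : CommEntries S T) (i j k l : Fin n) : Commute (inU (S i j)) (inV (T k l)) := by
  ext b a
  rw [coeff_inU_mul_inV, coeff_inV_mul_inU]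
  exact h i j k l a b

lemma CommEntries.symm {n : ℕ} {S T : Matrix (Fin n) (Fin n) (PowerSeries B)}
    (h : CommEntries S T) : CommEntries T S :=
  fun i j k l a b => (h k l i j b a).symm

lemma CommEntries.one {n : ℕ} (S : Matrix (Fin n) (Fin n) (PowerSeries B)) :
    CommEntries S 1 := by
  intro i j k l a b
  rw [Matrix.one_apply]
  split_ifs
  · rw [PowerSeries.coeff_one]
    split_ifs
    · exact Commute.one_right _
    · exact Commute.zero_right _
  · rw [map_zero]
    exact Commute.zero_right _

lemma CommEntries.mul {n : ℕ} {S T U : Matrix (Fin n) (Fin n) (PowerSeries B)}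
    (h : CommEntries S T) (h' : CommEntries S U) : CommEntries S (T * U) := by
  intro i j k l a b
  rw [Matrix.mul_apply, map_sum]
  refine Commute.sum_right _ _ _ fun c _ => ?_
  rw [PowerSeries.coeff_mul]
  exact Commute.sum_right _ _ _ fun p _ => (h i j k c a p.1).mul_right (h' i j c l a p.2)

lemma RTT.mul {n : ℕ} {S T : Matrix (Fin n) (Fin n) (PowerSeries B)} (hS : RTT S) (hT : RTT T)
    (h : CommEntries S T) : RTT (S * T) := by
  intro i j k l
  have key := rtt_mul_aux (inV PowerSeries.X - inU PowerSeries.X)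
    (inU PowerSeries.X * inV PowerSeries.X)
    (fun c => (commute_inV_X c).sub_left (commute_inU_X c))
    (fun c => (commute_inU_X c).mul_left (commute_inV_X c))
    (S.map inU) (S.map inV) (T.map inU) (T.map inV) hS hT
    (fun i j k l => h.symm.commute i j k l) (fun i j k l => h.commute i j k l) i j k l
  simpa only [← Matrix.map_mul, Matrix.map_apply] using key

lemma RTT.one {n : ℕ} : RTT (1 : Matrix (Fin n) (Fin n) (PowerSeries B)) := by
  intro i j k l
  simp only [Matrix.one_apply]
  split_ifs <;> simp

lemma RTT.list_prod {n : ℕ} (l : List (Matrix (Fin n) (Fin n) (PowerSeries B)))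
    (h : ∀ S ∈ l, RTT S) (hc : l.Pairwise CommEntries) : RTT l.prod := by
  induction l with
  | nil => exact RTT.one
  | cons S l ih =>
    rw [List.pairwise_cons] at hc
    rw [List.prod_cons]
    refine (h S (by simp)).mul (ih (fun T hT => h T (by simp [hT])) hc.2) ?_
    have hc1 := hc.1
    clear ih h hc
    induction l with
    | nil => exact CommEntries.one S
    | cons T l ih =>
      rw [List.prod_cons]
      exact (hc1 T (by simp)).mul (ih fun U hU => hc1 U (by simp [hU]))

/-- The RTT relation coefficient by coefficient. -/
lemma RTT.coeff {n : ℕ} {S : Matrix (Fin n) (Fin n) (PowerSeries B)} (hS : RTT S)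
    (i j k l : Fin n) (a b : ℕ) :
    (PowerSeries.coeff (a + 1) (S i j) * PowerSeries.coeff b (S k l)
      - PowerSeries.coeff b (S k l) * PowerSeries.coeff (a + 1) (S i j))
    - (PowerSeries.coeff a (S i j) * PowerSeries.coeff (b + 1) (S k l)
      - PowerSeries.coeff (b + 1) (S k l) * PowerSeries.coeff a (S i j)) =
    PowerSeries.coeff a (S k j) * PowerSeries.coeff b (S i l)
      - PowerSeries.coeff b (S k j) * PowerSeries.coeff a (S i l) := by
  have hV : ∀ (f : PowerSeries (PowerSeries B)) (a b : ℕ), PowerSeries.coeff a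
      (PowerSeries.coeff (b + 1) (inV PowerSeries.X * f)) =
        PowerSeries.coeff a (PowerSeries.coeff b f) := by
    intro f a b
    simp [inV, PowerSeries.coeff_succ_X_mul]
  have hU : ∀ (f : PowerSeries (PowerSeries B)) (a b : ℕ), PowerSeries.coeff (a + 1)
      (PowerSeries.coeff b (inU PowerSeries.X * f)) =
        PowerSeries.coeff a (PowerSeries.coeff b f) := by
    intro f a b
    simp [inU, PowerSeries.coeff_succ_X_mul]
  have h := congrArg (fun f => PowerSeries.coeff (a + 1) (PowerSeries.coeff (b + 1) f))
    (hS i j k l)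
  simp only [sub_mul, mul_assoc, map_sub, hV, hU] at h
  simp only [coeff_inU_mul_inV, coeff_inV_mul_inU] at h
  exact h

/-- The RTT relation in the form of the defining relations of the Yangian. -/
lemma RTT.comm {n : ℕ} {S : Matrix (Fin n) (Fin n) (PowerSeries B)} (hS : RTT S)
    (h0 : ∀ i j, PowerSeries.coeff 0 (S i j) = if i = j then 1 else 0)
    (i j k l : Fin n) (a b : ℕ) :
    PowerSeries.coeff a (S i j) * PowerSeries.coeff b (S k l)
      - PowerSeries.coeff b (S k l) * PowerSeries.coeff a (S i j) =
    ∑ c ∈ Finset.range (min a b),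
      (PowerSeries.coeff (a + b - 1 - c) (S i l) * PowerSeries.coeff c (S k j)
        - PowerSeries.coeff c (S i l) * PowerSeries.coeff (a + b - 1 - c) (S k j)) := by
  have step : ∀ a b, PowerSeries.coeff (a + 1) (S i j) * PowerSeries.coeff b (S k l)
      - PowerSeries.coeff b (S k l) * PowerSeries.coeff (a + 1) (S i j) =
    (PowerSeries.coeff a (S i j) * PowerSeries.coeff (b + 1) (S k l)
      - PowerSeries.coeff (b + 1) (S k l) * PowerSeries.coeff a (S i j))
    + (PowerSeries.coeff b (S i l) * PowerSeries.coeff a (S k j)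
      - PowerSeries.coeff a (S i l) * PowerSeries.coeff b (S k j)) := by
    intro a b
    rw [← hS.coeff k l i j b a]
    abel
  have left : ∀ a b, PowerSeries.coeff a (S i j) * PowerSeries.coeff b (S k l)
      - PowerSeries.coeff b (S k l) * PowerSeries.coeff a (S i j) =
    ∑ c ∈ Finset.range a,
      (PowerSeries.coeff (a + b - 1 - c) (S i l) * PowerSeries.coeff c (S k j)
        - PowerSeries.coeff c (S i l) * PowerSeries.coeff (a + b - 1 - c) (S k j)) := by
    intro a
    induction a with
    | zero =>
      intro b
      rw [h0]
      split_ifs <;> simp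
    | succ a ih =>
      intro b
      have e1 : a + (b + 1) = a + 1 + b := by omega
      have e2 : a + 1 + b - 1 - a = b := by omega
      rw [step, ih, Finset.sum_range_succ, e1, e2]
  have right : ∀ b a, PowerSeries.coeff a (S i j) * PowerSeries.coeff b (S k l)
      - PowerSeries.coeff b (S k l) * PowerSeries.coeff a (S i j) =
    ∑ c ∈ Finset.range b,
      (PowerSeries.coeff (a + b - 1 - c) (S i l) * PowerSeries.coeff c (S k j)
        - PowerSeries.coeff c (S i l) * PowerSeries.coeff (a + b - 1 - c) (S k j)) := by
    intro b
    induction b with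
    | zero =>
      intro a
      rw [h0]
      split_ifs <;> simp
    | succ b ih =>
      intro a
      have e1 : a + (b + 1) = a + 1 + b := by omega
      have e2 : a + 1 + b - 1 - b = a := by omega
      have h := step a b
      rw [ih (a + 1)] at h
      rw [Finset.sum_range_succ, e1, e2, h]
      abel
  rcases le_total a b with hab | hab
  · rw [min_eq_left hab]
    exact left a b
  · rw [min_eq_right hab]
    exact right b a

/-- The series `∑ d, x ^ d u⁻¹ ^ (d + 1) = 1 / (u - x)`. -/
noncomputable def resolvent (x : B) : PowerSeries B :=
  PowerSeries.mk fun d => if d = 0 then 0 else x ^ (d - 1)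

lemma resolvent_eq (x : B) :
    resolvent x = PowerSeries.X + PowerSeries.X * (PowerSeries.C x * resolvent x) := by
  ext d
  rcases d with _ | _ | d
  · simp [resolvent]
  · simp [resolvent, PowerSeries.coeff_succ_X_mul, PowerSeries.coeff_X]
  · simp [resolvent, PowerSeries.coeff_succ_X_mul, PowerSeries.coeff_X, pow_succ']

lemma resolvent_eq' (x : B) :
    resolvent x = PowerSeries.X + PowerSeries.X * (resolvent x * PowerSeries.C x) := by
  ext d
  rcases d with _ | _ | d
  · simp [resolvent]
  · simp [resolvent, PowerSeries.coeff_succ_X_mul, PowerSeries.coeff_X]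
  · simp [resolvent, PowerSeries.coeff_succ_X_mul, PowerSeries.coeff_X, pow_succ]

lemma commute_C_series {e : B} {f : PowerSeries B} (h : ∀ a, Commute e (PowerSeries.coeff a f)) :
    Commute (PowerSeries.C e) f := by
  ext a
  simpa using (h a).eq

lemma commute_resolvent {e x : B} (h : Commute e x) : Commute (PowerSeries.C e) (resolvent x) :=
  commute_C_series fun a => by
    simp only [resolvent, PowerSeries.coeff_mk]
    split_ifs
    · exact Commute.zero_right _
    · exact h.pow_right _

/-- The `n × n` matrix over `B⟦u⁻¹⟧` with entries `δ_{i,j} + e_{i,j} / (u - x)`. -/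
noncomputable def evalMatrix {n : ℕ} (e : Fin n → Fin n → B) (x : B) :
    Matrix (Fin n) (Fin n) (PowerSeries B) :=
  Matrix.of fun i j => (if i = j then 1 else 0) + PowerSeries.C (e i j) * resolvent x

lemma inU_C_eq_inV_C (b : B) : inU (PowerSeries.C b) = inV (PowerSeries.C b) := by
  simp [inU, inV]

lemma commute_inU_inV {f g : PowerSeries B}
    (h : ∀ a b, Commute (PowerSeries.coeff a f) (PowerSeries.coeff b g)) :
    Commute (inU f) (inV g) := by
  ext b a
  rw [coeff_inU_mul_inV, coeff_inV_mul_inU]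
  exact h a b

lemma commute_coeff_resolvent {x y : B} (h : Commute x y) (a b : ℕ) :
    Commute (PowerSeries.coeff a (resolvent x)) (PowerSeries.coeff b (resolvent y)) := by
  simp only [resolvent, PowerSeries.coeff_mk]
  split_ifs
  · exact Commute.zero_right _
  · exact Commute.zero_left _
  · exact Commute.zero_right _
  · exact h.pow_pow _ _

lemma resolvent_uv (x : B) : (inV PowerSeries.X - inU PowerSeries.X) *
    (inU (resolvent x) * inV (resolvent x)) =
      (inU PowerSeries.X * inV PowerSeries.X) * (inV (resolvent x) - inU (resolvent x)) := by
  have hy : inU (resolvent x) = inU PowerSeries.X +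
      inU PowerSeries.X * (inU (resolvent x) * inU (PowerSeries.C x)) := by
    rw [← map_mul, ← map_mul, ← map_add, ← resolvent_eq']
  have hy' : inV (resolvent x) = inV PowerSeries.X +
      inV PowerSeries.X * (inU (PowerSeries.C x) * inV (resolvent x)) := by
    rw [inU_C_eq_inV_C, ← map_mul, ← map_mul, ← map_add, ← resolvent_eq]
  have hz := commute_inU_X (B := B)
  have hw := commute_inV_X (B := B)
  generalize inU (resolvent x) = y at *
  generalize inV (resolvent x) = y' at *
  generalize inU (PowerSeries.C x) = c at *
  generalize inU (PowerSeries.X : PowerSeries B) = z at *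
  generalize inV (PowerSeries.X : PowerSeries B) = w at *
  have h1 : w * (y * y') = z * w * y' + z * w * (y * c * y') := by
    conv_lhs => rw [hy]
    rw [add_mul, mul_add, ← mul_assoc w z y', ← (hz w).eq, mul_assoc z (y * c), ← mul_assoc w z,
      ← (hz w).eq]
  have h2 : z * (y * y') = z * w * y + z * w * (y * c * y') := by
    conv_lhs => rw [hy']
    rw [mul_add, mul_add, ← (hw y).eq, ← mul_assoc z w y, ← mul_assoc y w, ← (hw y).eq,
      mul_assoc w y, ← mul_assoc z w, ← mul_assoc y c]
  rw [sub_mul, h1, h2, mul_sub]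
  abel

lemma evalMatrix_rtt {n : ℕ} (e : Fin n → Fin n → B) (x : B)
    (he : ∀ i j k l, e i j * e k l = if j = k then e i l else 0)
    (hx : ∀ i j, Commute (e i j) x) : RTT (evalMatrix e x) := by
  intro i j k l
  have key := resolvent_uv x
  have hz := commute_inU_X (B := B)
  have hw := commute_inV_X (B := B)
  have hyE : ∀ i j, Commute (inU (resolvent x)) (inU (PowerSeries.C (e i j))) :=
    fun i j => ((commute_resolvent (hx i j)).symm).map inU
  have hyE' : ∀ i j, Commute (inV (resolvent x)) (inU (PowerSeries.C (e i j))) := by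
    intro i j
    rw [inU_C_eq_inV_C]
    exact ((commute_resolvent (hx i j)).symm).map inV
  have hyy : Commute (inU (resolvent x)) (inV (resolvent x)) :=
    commute_inU_inV fun a b => commute_coeff_resolvent (Commute.refl x) a b
  have hE : ∀ i j k l, inU (PowerSeries.C (e i j)) * inU (PowerSeries.C (e k l)) =
      if j = k then inU (PowerSeries.C (e i l)) else 0 := by
    intro i j k l
    rw [← map_mul, ← map_mul, he]
    split_ifs <;> simp
  have hU : ∀ i j, inU (evalMatrix e x i j) = (if i = j then 1 else 0) +
      inU (PowerSeries.C (e i j)) * inU (resolvent x) := by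
    intro i j
    simp only [evalMatrix, Matrix.of_apply, map_add, map_mul]
    split_ifs <;> simp
  have hV : ∀ i j, inV (evalMatrix e x i j) = (if i = j then 1 else 0) +
      inU (PowerSeries.C (e i j)) * inV (resolvent x) := by
    intro i j
    rw [inU_C_eq_inV_C]
    simp only [evalMatrix, Matrix.of_apply, map_add, map_mul]
    split_ifs <;> simp
  rw [hU, hV, hU, hV, hU, hV]
  generalize inU (resolvent x) = y at *
  generalize inV (resolvent x) = y' at *
  generalize hEE : (fun i j => inU (PowerSeries.C (e i j))) = E at *
  have hEE' : ∀ i j, inU (PowerSeries.C (e i j)) = E i j := fun i j => by rw [← hEE]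
  simp only [hEE'] at *
  generalize inU (PowerSeries.X : PowerSeries B) = z at *
  generalize inV (PowerSeries.X : PowerSeries B) = w at *
  have hc : ∀ (P : Prop) [Decidable P] (t : PowerSeries (PowerSeries B)),
      (if P then 1 else 0) * t = t * (if P then 1 else 0) := by
    intro P _ t
    split_ifs <;> simp
  have m1 : ∀ i j k l, E i j * y * (E k l * y') = E i j * E k l * (y * y') := by
    intro i j k l
    rw [mul_assoc, ← mul_assoc y, (hyE k l).eq]
    noncomm_ring
  have m2 : ∀ i j k l, E i j * y' * (E k l * y) = E i j * E k l * (y * y') := by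
    intro i j k l
    rw [mul_assoc, ← mul_assoc y', (hyE' k l).eq, mul_assoc (E k l), ← hyy.eq]
    noncomm_ring
  have lhs : ((if i = j then 1 else 0) + E i j * y) * ((if k = l then 1 else 0) + E k l * y') -
      ((if k = l then 1 else 0) + E k l * y') * ((if i = j then 1 else 0) + E i j * y) =
      (E i j * E k l - E k l * E i j) * (y * y') := by
    rw [add_mul, mul_add, mul_add, add_mul, mul_add, mul_add, m1, m2, hc (i = j), hc (i = j),
      hc (k = l) (E i j * y), sub_mul]
    abel
  have rhs : ((if k = j then 1 else 0) + E k j * y) * ((if i = l then 1 else 0) + E i l * y') -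
      ((if k = j then 1 else 0) + E k j * y') * ((if i = l then 1 else 0) + E i l * y) =
      ((if k = j then 1 else 0) * E i l - (if i = l then 1 else 0) * E k j) * (y' - y) := by
    rw [add_mul, mul_add, mul_add, add_mul, mul_add, mul_add, m1, m2,
      ← hc (i = l) (E k j * y), ← hc (i = l) (E k j * y')]
    noncomm_ring
  rw [lhs, rhs, hE, hE]
  have t1 : (if j = k then E i l else 0) - (if l = i then E k j else 0) =
      (if k = j then 1 else 0) * E i l - (if i = l then 1 else 0) * E k j := by
    simp only [eq_comm (a := k) (b := j), eq_comm (a := i) (b := l), ite_mul, one_mul, zero_mul]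
  rw [t1]
  generalize (if k = j then 1 else 0) * E i l - (if i = l then 1 else 0) * E k j = G
  have t2 : (w - z) * (G * (y * y')) = G * ((w - z) * (y * y')) := by
    rw [← mul_assoc (w - z) G, ((hw G).sub_left (hz G)).eq, mul_assoc]
  have t3 : z * w * (G * (y' - y)) = G * (z * w * (y' - y)) := by
    rw [← mul_assoc (z * w) G, ((hz G).mul_left (hw G)).eq, mul_assoc]
  rw [t2, t3, key]

lemma resolvent_swap {x₁ x₂ s : B} (h1 : x₁ * s = s * x₂ + 1) :
    resolvent x₁ * PowerSeries.C s =
      PowerSeries.C s * resolvent x₂ + resolvent x₁ * resolvent x₂ := by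
  have hX : ∀ f : PowerSeries B, Commute f PowerSeries.X := PowerSeries.commute_X
  have k1 : resolvent x₁ * (PowerSeries.X * (PowerSeries.C x₁)) = resolvent x₁ - PowerSeries.X := by
    conv_rhs => rw [resolvent_eq' x₁]
    rw [← mul_assoc, (hX _).eq]
    noncomm_ring
  have k2 : (PowerSeries.X * PowerSeries.C x₂) * resolvent x₂ = resolvent x₂ - PowerSeries.X := by
    conv_rhs => rw [resolvent_eq x₂]
    noncomm_ring
  have k3 : PowerSeries.C x₁ * PowerSeries.C s = PowerSeries.C s * PowerSeries.C x₂ + 1 := by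
    rw [← map_mul, h1, map_add, map_mul, map_one]
  have k4 : resolvent x₁ * (PowerSeries.X * (PowerSeries.C x₁)) * PowerSeries.C s * resolvent x₂ =
      resolvent x₁ * PowerSeries.C s * ((PowerSeries.X * PowerSeries.C x₂) * resolvent x₂) +
        PowerSeries.X * (resolvent x₁ * resolvent x₂) := by
    have e1 : resolvent x₁ * (PowerSeries.X * (PowerSeries.C x₁)) * PowerSeries.C s * resolvent x₂
        = resolvent x₁ * PowerSeries.X * (PowerSeries.C x₁ * PowerSeries.C s) * resolvent x₂ := by
      noncomm_ring
    have e2 : resolvent x₁ * PowerSeries.C s * ((PowerSeries.X * PowerSeries.C x₂) * resolvent x₂)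
        = resolvent x₁ * (PowerSeries.C s * PowerSeries.X) * PowerSeries.C x₂ * resolvent x₂ := by
      noncomm_ring
    rw [e1, e2, k3, (hX (PowerSeries.C s)).eq, ← mul_assoc PowerSeries.X (resolvent x₁),
      ← (hX (resolvent x₁)).eq]
    noncomm_ring
  rw [k1, k2] at k4
  have k5 : PowerSeries.X * (resolvent x₁ * PowerSeries.C s) = PowerSeries.X *
      (PowerSeries.C s * resolvent x₂ + resolvent x₁ * resolvent x₂) := by
    rw [sub_mul, sub_mul, mul_sub, (hX (resolvent x₁ * PowerSeries.C s)).eq] at k4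
    rw [mul_add, ← mul_assoc PowerSeries.X (PowerSeries.C s)]
    have k6 := congrArg (fun t => resolvent x₁ * PowerSeries.C s * resolvent x₂ - t) k4
    simp only [sub_sub_cancel] at k6
    have k7 : resolvent x₁ * PowerSeries.C s * resolvent x₂ -
        (resolvent x₁ * PowerSeries.C s * resolvent x₂ -
          PowerSeries.X * (resolvent x₁ * PowerSeries.C s) +
          PowerSeries.X * (resolvent x₁ * resolvent x₂)) =
        PowerSeries.X * (resolvent x₁ * PowerSeries.C s) -
          PowerSeries.X * (resolvent x₁ * resolvent x₂) := by abel
    rw [k7] at k6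
    rw [k6]
    abel
  ext d
  have := congrArg (PowerSeries.coeff (d + 1)) k5
  rwa [PowerSeries.coeff_succ_X_mul, PowerSeries.coeff_succ_X_mul] at this

/-- The exchange relation between two adjacent factors and `P - s`. -/
lemma evalMatrix_exchange {n : ℕ} (e₁ e₂ : Fin n → Fin n → B) (x₁ x₂ P s : B)
    (hPP : P * P = 1) (hP : ∀ i j, e₁ i j * P = P * e₂ i j)
    (hW : ∀ i j, ∑ k, e₁ i k * e₂ k j = e₁ i j * P)
    (hx : Commute x₁ x₂) (h1 : x₁ * s = s * x₂ + 1) (h2 : s * x₁ = x₂ * s + 1)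
    (hPx₁ : Commute P x₁) (hPx₂ : Commute P x₂) (hPs : Commute P s)
    (he₁s : ∀ i j, Commute (e₁ i j) s) (he₂s : ∀ i j, Commute (e₂ i j) s)
    (he₂x₁ : ∀ i j, Commute (e₂ i j) x₁) :
    ∃ Z : Matrix (Fin n) (Fin n) (PowerSeries B),
      evalMatrix e₁ x₁ * evalMatrix e₂ x₂ * Matrix.scalar (Fin n) (PowerSeries.C (P - s)) =
        Matrix.scalar (Fin n) (PowerSeries.C (P - s)) * Z := by
  have q1 := resolvent_swap h1
  have q2 : resolvent x₂ * PowerSeries.C s =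
      PowerSeries.C s * resolvent x₁ - resolvent x₁ * resolvent x₂ := by
    have h3 : x₂ * (-s) = (-s) * x₁ + 1 := by
      rw [neg_mul, h2]
      noncomm_ring
    have hyy : resolvent x₁ * resolvent x₂ = resolvent x₂ * resolvent x₁ := by
      ext a
      rw [PowerSeries.coeff_mul, PowerSeries.coeff_mul, ← Finset.Nat.sum_antidiagonal_swap]
      exact Finset.sum_congr rfl fun p _ => (commute_coeff_resolvent hx p.2 p.1).eq
    have := resolvent_swap h3
    rw [map_neg, mul_neg, neg_mul] at this
    rw [hyy, ← neg_inj, this]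
    abel
  have hyy : resolvent x₁ * resolvent x₂ = resolvent x₂ * resolvent x₁ := by
    ext a
    rw [PowerSeries.coeff_mul, PowerSeries.coeff_mul, ← Finset.Nat.sum_antidiagonal_swap]
    exact Finset.sum_congr rfl fun p _ => (commute_coeff_resolvent hx p.2 p.1).eq
  have p1 := (commute_resolvent hPx₁).eq
  have p2 := (commute_resolvent hPx₂).eq
  have c21 : ∀ i j, PowerSeries.C (e₂ i j) * resolvent x₁ = resolvent x₁ * PowerSeries.C (e₂ i j) :=
    fun i j => (commute_resolvent (he₂x₁ i j)).eq
  have s1 : ∀ i j, PowerSeries.C s * PowerSeries.C (e₁ i j) =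
      PowerSeries.C (e₁ i j) * PowerSeries.C s := by
    intro i j
    rw [← map_mul, ← map_mul, (he₁s i j).eq]
  have s2 : ∀ i j, PowerSeries.C s * PowerSeries.C (e₂ i j) =
      PowerSeries.C (e₂ i j) * PowerSeries.C s := by
    intro i j
    rw [← map_mul, ← map_mul, (he₂s i j).eq]
  have sP : PowerSeries.C s * PowerSeries.C P = PowerSeries.C P * PowerSeries.C s := by
    rw [← map_mul, ← map_mul, hPs.eq]
  have PP : PowerSeries.C P * PowerSeries.C P = 1 := by rw [← map_mul, hPP, map_one]
  have hP1 : ∀ i j, PowerSeries.C (e₁ i j) * PowerSeries.C P =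
      PowerSeries.C P * PowerSeries.C (e₂ i j) := by
    intro i j
    rw [← map_mul, ← map_mul, hP]
  have prod : ∀ i j, (evalMatrix e₁ x₁ * evalMatrix e₂ x₂) i j = (if i = j then 1 else 0) +
      PowerSeries.C (e₁ i j) * resolvent x₁ + PowerSeries.C (e₂ i j) * resolvent x₂ +
        PowerSeries.C (e₁ i j) * PowerSeries.C P * (resolvent x₁ * resolvent x₂) := by
    intro i j
    have t1 : ∀ k, PowerSeries.C (e₁ i k) * resolvent x₁ * (PowerSeries.C (e₂ k j) * resolvent x₂)
        = PowerSeries.C (e₁ i k * e₂ k j) * (resolvent x₁ * resolvent x₂) := by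
      intro k
      rw [mul_assoc, ← mul_assoc (resolvent x₁), ← c21, map_mul]
      noncomm_ring
    have hW' : ∑ k, PowerSeries.C (e₁ i k * e₂ k j) =
        PowerSeries.C (e₁ i j) * PowerSeries.C P := by
      rw [← map_sum, hW, map_mul]
    simp only [Matrix.mul_apply, evalMatrix, Matrix.of_apply, mul_add, add_mul, t1,
      Finset.sum_add_distrib, ← Finset.sum_mul, hW']
    simp
    abel
  refine ⟨Matrix.of fun i j => (if i = j then 1 else 0) +
      PowerSeries.C (e₂ i j) * resolvent x₁ + PowerSeries.C (e₁ i j) * resolvent x₂ +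
        PowerSeries.C (e₁ i j) * PowerSeries.C P * (resolvent x₁ * resolvent x₂), ?_⟩
  ext1 i j
  rw [Matrix.scalar_apply, Matrix.mul_diagonal, Matrix.diagonal_mul, prod, Matrix.of_apply, map_sub]
  have hc : ∀ t : PowerSeries B, (if i = j then 1 else 0) * t = t * (if i = j then 1 else 0) := by
    intro t
    split_ifs <;> simp
  have hP1 := hP1 i j
  have s1 := s1 i j
  have s2 := s2 i j
  generalize PowerSeries.C (e₁ i j) = E₁ at *
  generalize PowerSeries.C (e₂ i j) = E₂ at *
  generalize PowerSeries.C P = Q at *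
  generalize PowerSeries.C s = t at *
  generalize resolvent x₁ = y₁ at *
  generalize resolvent x₂ = y₂ at *
  generalize (if i = j then (1 : PowerSeries B) else 0) = D at *
  have hP2 : E₂ * Q = Q * E₁ := by
    calc E₂ * Q = Q * Q * E₂ * Q := by rw [PP, one_mul]
      _ = Q * (Q * E₂) * Q := by noncomm_ring
      _ = Q * E₁ * (Q * Q) := by rw [← hP1]; noncomm_ring
      _ = Q * E₁ := by rw [PP, mul_one]
  have hyt : y₁ * y₂ * t = t * (y₁ * y₂) := by
    rw [mul_assoc, q2, mul_sub, ← mul_assoc, q1, add_mul, mul_assoc t y₂, ← hyy]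
    rw [mul_assoc y₁ y₂ y₁, ← hyy]
    abel
  have hyQ : y₁ * y₂ * Q = Q * (y₁ * y₂) := by
    rw [mul_assoc, ← p2, ← mul_assoc, ← p1, mul_assoc]
  have a1 : E₁ * y₁ * (Q - t) = (Q - t) * (E₂ * y₁) + t * E₂ * y₁ - t * E₁ * y₂ - E₁ * (y₁ * y₂) := by
    rw [mul_sub, mul_assoc E₁ y₁ Q, ← p1, mul_assoc E₁ y₁ t, q1, ← mul_assoc, hP1, mul_add,
      ← mul_assoc E₁ t, ← s1]
    noncomm_ring
  have a2 : E₂ * y₂ * (Q - t) = (Q - t) * (E₁ * y₂) + t * E₁ * y₂ - t * E₂ * y₁ + E₂ * (y₁ * y₂) := by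
    rw [mul_sub, mul_assoc E₂ y₂ Q, ← p2, mul_assoc E₂ y₂ t, q2, ← mul_assoc, hP2, mul_sub,
      ← mul_assoc E₂ t, ← s2]
    noncomm_ring
  have a3 : E₁ * Q * (y₁ * y₂) * (Q - t) = (Q - t) * (E₁ * Q * (y₁ * y₂)) +
      E₁ * (y₁ * y₂) - E₂ * (y₁ * y₂) := by
    have b1 : E₁ * Q * (y₁ * y₂) * Q = E₁ * (y₁ * y₂) := by
      rw [mul_assoc (E₁ * Q), hyQ, ← mul_assoc, mul_assoc E₁ Q Q, PP, mul_one]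
    have b2 : E₁ * Q * (y₁ * y₂) * t = t * (E₁ * Q * (y₁ * y₂)) := by
      calc E₁ * Q * (y₁ * y₂) * t = E₁ * (Q * t) * (y₁ * y₂) := by
            rw [mul_assoc (E₁ * Q), hyt]
            noncomm_ring
        _ = (E₁ * t) * Q * (y₁ * y₂) := by
            rw [← sP]
            noncomm_ring
        _ = t * (E₁ * Q * (y₁ * y₂)) := by
            rw [← s1]
            noncomm_ring
    have b3 : Q * (E₁ * Q * (y₁ * y₂)) = E₂ * (y₁ * y₂) := by
      calc Q * (E₁ * Q * (y₁ * y₂)) = (Q * E₁) * Q * (y₁ * y₂) := by noncomm_ring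
        _ = E₂ * (Q * Q) * (y₁ * y₂) := by
            rw [← hP2]
            noncomm_ring
        _ = E₂ * (y₁ * y₂) := by rw [PP, mul_one]
    rw [mul_sub, b1, b2, sub_mul, b3]
    abel
  rw [add_mul, add_mul, add_mul, a1, a2, a3, mul_add, mul_add, mul_add, hc]
  abel

end RTT

/-! ### Tensor space, affine Schur algebras and the Drinfeld homomorphism -/

/-- The index set of the basis `v_{a_1} ⊗ ⋯ ⊗ v_{a_r}` of `V^{⊗ r}`, where `V = K^n`. -/
abbrev Idx (n r : ℕ) : Type := Fin r → Fin n

/-- The right `AH_r`-module `V^{⊗ r} ⊗ AH_r`, written in coordinates: `m` stands for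
`∑ a, v_a ⊗ m a`. -/
abbrev FreeTensor (K : Type*) [CommRing K] (n r : ℕ) : Type _ := Idx n r → AH K r

/-- The algebra `End(V)^{⊗ r} ⊗ AH_r = End_{AH_r}(V^{⊗ r} ⊗ AH_r)`. -/
abbrev FreeEnd (K : Type*) [CommRing K] (n r : ℕ) : Type _ :=
  Module.End (AH K r)ᵐᵒᵖ (FreeTensor K n r)

section Operators

variable (K : Type*) [CommRing K] (n r : ℕ)

/-- The operator `e_{i,j}^{[p]}`, acting as the matrix unit `e_{i,j}` in the `p`th tensor
position. -/
noncomputable def eOp (p : Fin r) (i j : Fin n) : FreeEnd K n r where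
  toFun m a := if a p = i then m (Function.update a p j) else 0
  map_add' m m' := by
    ext a
    simp only [Pi.add_apply]
    split_ifs <;> simp
  map_smul' h m := by
    ext a
    simp only [Pi.smul_apply, RingHom.id_apply]
    split_ifs <;> simp

/-- Left multiplication by an element of `AH_r` on the last tensor factor. -/
noncomputable def mulOp : AH K r →ₐ[K] FreeEnd K n r where
  toFun h :=
    { toFun m a := h * m a
      map_add' m m' := by
        ext a
        simp [mul_add]
      map_smul' g m := by
        ext a
        simp [MulOpposite.smul_eq_mul_unop, mul_assoc] }
  map_one' := by
    ext m a
    simp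
  map_mul' g h := by
    ext m a
    simp [mul_assoc]
  map_zero' := by
    ext m a
    simp
  map_add' g h := by
    ext m a
    simp [add_mul]
  commutes' c := by
    ext m a
    simp [Module.algebraMap_end_apply, Algebra.smul_def]

/-- The right action of the simple transposition `s_i` on `V^{⊗ r}`, permuting the tensor positions
`i` and `i + 1`. -/
noncomputable def swapOp (i : Fin (r - 1)) : FreeEnd K n r where
  toFun m a := m (a ∘ Equiv.swap (lo i) (hi i))
  map_add' m m' := by
    ext a
    simp
  map_smul' h m := by
    ext a
    simp

variable {K n r}

lemma eOp_apply (p : Fin r) (i j : Fin n) (m : FreeTensor K n r) (a : Idx n r) :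
    eOp K n r p i j m a = if a p = i then m (Function.update a p j) else 0 := rfl

lemma mulOp_apply (h : AH K r) (m : FreeTensor K n r) (a : Idx n r) :
    mulOp K n r h m a = h * m a := rfl

lemma swapOp_apply (i : Fin (r - 1)) (m : FreeTensor K n r) (a : Idx n r) :
    swapOp K n r i m a = m (a ∘ Equiv.swap (lo i) (hi i)) := rfl

lemma eOp_mul (p : Fin r) (i j k l : Fin n) :
    eOp K n r p i j * eOp K n r p k l = if j = k then eOp K n r p i l else 0 := by
  refine LinearMap.ext fun m => funext fun a => ?_
  rw [Module.End.mul_apply, eOp_apply, eOp_apply, Function.update_self, Function.update_idem]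
  by_cases h : a p = i <;> by_cases h' : j = k <;> simp [h, h', eOp_apply]

lemma eOp_comm {p q : Fin r} (hpq : p ≠ q) (i j k l : Fin n) :
    Commute (eOp K n r p i j) (eOp K n r q k l) := by
  change _ * _ = _ * _
  refine LinearMap.ext fun m => funext fun a => ?_
  rw [Module.End.mul_apply, Module.End.mul_apply, eOp_apply, eOp_apply, eOp_apply, eOp_apply,
    Function.update_of_ne hpq.symm, Function.update_of_ne hpq, Function.update_comm hpq]
  split_ifs <;> rfl

lemma eOp_mulOp (p : Fin r) (i j : Fin n) (h : AH K r) :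
    Commute (eOp K n r p i j) (mulOp K n r h) := by
  change _ * _ = _ * _
  refine LinearMap.ext fun m => funext fun a => ?_
  rw [Module.End.mul_apply, Module.End.mul_apply, eOp_apply, mulOp_apply, mulOp_apply, eOp_apply]
  split_ifs <;> simp

lemma swapOp_mulOp (i : Fin (r - 1)) (h : AH K r) :
    Commute (swapOp K n r i) (mulOp K n r h) := by
  change _ * _ = _ * _
  refine LinearMap.ext fun m => funext fun a => ?_
  rfl

lemma swapOp_mul_self (i : Fin (r - 1)) : swapOp K n r i * swapOp K n r i = 1 := by
  refine LinearMap.ext fun m => funext fun a => ?_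
  rw [Module.End.mul_apply, swapOp_apply, swapOp_apply, Module.End.one_apply]
  congr 1
  ext t
  simp

lemma lo_ne_hi (i : Fin (r - 1)) : lo i ≠ hi i := by
  simp [lo, hi, Fin.ext_iff]

lemma update_comp_swap (i : Fin (r - 1)) (p : Fin r) (a : Idx n r) (j : Fin n) :
    Function.update a p j ∘ Equiv.swap (lo i) (hi i) =
      Function.update (a ∘ Equiv.swap (lo i) (hi i)) (Equiv.swap (lo i) (hi i) p) j := by
  ext t
  have e : (Equiv.swap (lo i) (hi i) t = p) = (t = Equiv.swap (lo i) (hi i) p) :=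
    propext Equiv.swap_apply_eq_iff
  simp only [Function.comp_apply, Function.update_apply, e]

lemma eOp_swapOp (i : Fin (r - 1)) (p : Fin r) (k l : Fin n) :
    eOp K n r p k l * swapOp K n r i =
      swapOp K n r i * eOp K n r (Equiv.swap (lo i) (hi i) p) k l := by
  refine LinearMap.ext fun m => funext fun a => ?_
  rw [Module.End.mul_apply, Module.End.mul_apply, eOp_apply, swapOp_apply, swapOp_apply, eOp_apply,
    update_comp_swap]
  simp

lemma sum_eOp_mul_eOp (i : Fin (r - 1)) (k l : Fin n) :
    ∑ t, eOp K n r (lo i) k t * eOp K n r (hi i) t l = eOp K n r (lo i) k l * swapOp K n r i := by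
  refine LinearMap.ext fun m => funext fun a => ?_
  rw [Module.End.mul_apply, LinearMap.sum_apply, Finset.sum_apply, eOp_apply, swapOp_apply]
  have h : ∀ t, (eOp K n r (lo i) k t * eOp K n r (hi i) t l) m a =
      if a (hi i) = t then (if a (lo i) = k then
        m (Function.update (Function.update a (lo i) t) (hi i) l) else 0) else 0 := by
    intro t
    rw [Module.End.mul_apply, eOp_apply, eOp_apply, Function.update_of_ne (lo_ne_hi i).symm]
    split_ifs <;> rfl
  simp only [h, Finset.sum_ite_eq, Finset.mem_univ, if_true]
  split_ifs
  · congr 1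
    rw [update_comp_swap, Equiv.swap_apply_left]
    ext t
    by_cases h2 : t = hi i
    · simp [h2]
    · by_cases h1 : t = lo i
      · simp [h1, lo_ne_hi]
      · simp [h1, h2, Equiv.swap_apply_of_ne_of_ne]
  · rfl

end Operators

section Homomorphism

variable (K : Type*) [CommRing K] (n r : ℕ)

/-- The matrix `(1 + e^{[1]} / (u - x_1)) ⋯ (1 + e^{[r]} / (u - x_r))` over
`(End(V)^{⊗ r} ⊗ AH_r)⟦u⁻¹⟧`. The `p`th factor has entries
`δ_{i,j} + e_{i,j}^{[p]} / (u - x_p)`. -/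
noncomputable def tMatrix : Matrix (Fin n) (Fin n) (PowerSeries (FreeEnd K n r)) :=
  (List.ofFn fun p => evalMatrix (eOp K n r p) (mulOp K n r (AH.x K p))).prod

variable {K n r}

lemma coeff_evalMatrix {B : Type*} [Ring B] (e : Fin n → Fin n → B) (x : B) (i j : Fin n) (a : ℕ) :
    PowerSeries.coeff a (evalMatrix e x i j) =
      (if i = j ∧ a = 0 then 1 else 0) + e i j * (if a = 0 then 0 else x ^ (a - 1)) := by
  simp only [evalMatrix, Matrix.of_apply, map_add, PowerSeries.coeff_C_mul, resolvent,
    PowerSeries.coeff_mk]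
  congr 1
  by_cases h : i = j
  · simp [h, PowerSeries.coeff_one]
  · simp [h]

lemma commute_coeff_evalMatrix {B : Type*} [Ring B] (b : B) (e : Fin n → Fin n → B) (x : B)
    (he : ∀ i j, Commute b (e i j)) (hx : Commute b x) (i j : Fin n) (a : ℕ) :
    Commute b (PowerSeries.coeff a (evalMatrix e x i j)) := by
  rw [coeff_evalMatrix]
  refine Commute.add_right ?_ ((he i j).mul_right ?_)
  · split_ifs
    · exact Commute.one_right _
    · exact Commute.zero_right _
  · split_ifs
    · exact Commute.zero_right _
    · exact hx.pow_right _

lemma commute_mulOp {g h : AH K r} (hgh : g * h = h * g) :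
    Commute (mulOp K n r g) (mulOp K n r h) := by
  change _ * _ = _ * _
  rw [← map_mul, hgh, map_mul]

lemma tMatrix_rtt : RTT (tMatrix K n r) := by
  refine RTT.list_prod _ ?_ ?_
  · intro S hS
    rw [List.mem_ofFn] at hS
    obtain ⟨p, rfl⟩ := hS
    exact evalMatrix_rtt _ _ (fun i j k l => eOp_mul p i j k l)
      (fun i j => eOp_mulOp p i j _)
  · rw [List.pairwise_ofFn]
    intro p q hpq i j k l a b
    refine commute_coeff_evalMatrix _ _ _ (fun k l => ?_) ?_ k l b
    · exact (commute_coeff_evalMatrix _ _ _ (fun i j => (eOp_comm hpq.ne i j k l).symm)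
        (eOp_mulOp q k l _) i j a).symm
    · exact (commute_coeff_evalMatrix _ _ _ (fun i j => (eOp_mulOp p i j _).symm)
        (commute_mulOp (AH.x_mul_x q p)) i j a).symm

lemma coeff_zero_prod {B : Type*} [Ring B] (l : List (Matrix (Fin n) (Fin n) (PowerSeries B)))
    (h : ∀ S ∈ l, ∀ i j, PowerSeries.coeff 0 (S i j) = if i = j then 1 else 0) (i j : Fin n) :
    PowerSeries.coeff 0 (l.prod i j) = if i = j then 1 else 0 := by
  induction l generalizing i j with
  | nil =>
    rw [List.prod_nil, Matrix.one_apply]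
    split_ifs <;> simp
  | cons S l ih =>
    rw [List.prod_cons, Matrix.mul_apply, map_sum]
    have hz : ∀ f g : PowerSeries B, PowerSeries.coeff 0 (f * g) =
        PowerSeries.coeff 0 f * PowerSeries.coeff 0 g := by
      intro f g
      simp
    simp only [hz, h S List.mem_cons_self, ih (fun S hS => h S (List.mem_cons_of_mem _ hS))]
    simp

lemma coeff_zero_tMatrix (i j : Fin n) :
    PowerSeries.coeff 0 (tMatrix K n r i j) = if i = j then 1 else 0 := by
  refine coeff_zero_prod _ ?_ i j
  intro S hS i j
  rw [List.mem_ofFn] at hS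
  obtain ⟨p, rfl⟩ := hS
  rw [coeff_evalMatrix]
  simp

variable (K n r) in
/-- The homomorphism `Y(gl_n) → End(V)^{⊗ r} ⊗ AH_r` sending `T_{i,j}(u)` to the `(i,j)` entry of
`(1 + e^{[1]} / (u - x_1)) ⋯ (1 + e^{[r]} / (u - x_r))`. -/
noncomputable def drinfeldTilde : Yangian K n →ₐ[K] FreeEnd K n r :=
  Yangian.lift (fun i j d => PowerSeries.coeff d (tMatrix K n r i j))
    coeff_zero_tMatrix
    (fun i j k l a b _ _ => tMatrix_rtt.comm coeff_zero_tMatrix i j k l a b)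

lemma drinfeldTilde_T (i j : Fin n) (d : ℕ) :
    drinfeldTilde K n r (Yangian.T K i j d) = PowerSeries.coeff d (tMatrix K n r i j) :=
  Yangian.lift_T _ _ _ i j d

variable (K n r) in
/-- The `AH_r`-submodule of `V^{⊗ r} ⊗ AH_r` spanned by the elements
`v_a s_i ⊗ h - v_a ⊗ s_i h`. -/
noncomputable def relSub : Submodule (AH K r)ᵐᵒᵖ (FreeTensor K n r) :=
  Submodule.span _ {m | ∃ (a : Idx n r) (i : Fin (r - 1)) (h : AH K r),
    m = Pi.single (a ∘ Equiv.swap (lo i) (hi i)) h - Pi.single a (AH.s K i * h)}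

variable (K n r) in
/-- The induced tensor space `V^{⊗ r} ⊗_{K S_r} AH_r`, a right `AH_r`-module. -/
abbrev IndTensor : Type _ := FreeTensor K n r ⧸ relSub K n r

variable (K n r) in
/-- The degenerate affine Schur algebra `AS(n,r) = End_{AH_r}(V^{⊗ r} ⊗_{K S_r} AH_r)`. -/
abbrev AS : Type _ := Module.End (AH K r)ᵐᵒᵖ (IndTensor K n r)

variable (K n r) in
/-- The operator `P^{[i, i + 1]} - s_i`. -/
noncomputable def diffOp (i : Fin (r - 1)) : FreeEnd K n r :=
  swapOp K n r i - mulOp K n r (AH.s K i)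

lemma diffOp_single (i : Fin (r - 1)) (a : Idx n r) (h : AH K r) :
    diffOp K n r i (Pi.single a h) =
      Pi.single (a ∘ Equiv.swap (lo i) (hi i)) h - Pi.single a (AH.s K i * h) := by
  have hs : ∀ b : Idx n r, (b ∘ Equiv.swap (lo i) (hi i) = a) =
      (b = a ∘ Equiv.swap (lo i) (hi i)) := by
    intro b
    apply propext
    constructor
    · rintro rfl
      ext t
      simp
    · rintro rfl
      ext t
      simp
  ext b
  rw [diffOp, LinearMap.sub_apply, Pi.sub_apply, Pi.sub_apply, swapOp_apply, mulOp_apply]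
  simp only [Pi.single_apply, hs, mul_ite, mul_zero]

lemma diffOp_mem (i : Fin (r - 1)) (m : FreeTensor K n r) : diffOp K n r i m ∈ relSub K n r := by
  rw [← Finset.univ_sum_single m, map_sum]
  refine Submodule.sum_mem _ fun a _ => Submodule.subset_span ?_
  exact ⟨a, i, m a, diffOp_single i a (m a)⟩

lemma mem_relSub_of_exchange (f : FreeEnd K n r)
    (hf : ∀ i, ∃ z : FreeEnd K n r, f * diffOp K n r i = diffOp K n r i * z) :
    relSub K n r ≤ (relSub K n r).comap f := by
  refine Submodule.span_le.2 ?_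
  rintro _ ⟨a, i, h, rfl⟩
  obtain ⟨z, hz⟩ := hf i
  rw [← diffOp_single]
  have := congrArg (fun g : FreeEnd K n r => g (Pi.single a h)) hz
  simp only [Module.End.mul_apply] at this
  change f _ ∈ relSub K n r
  rw [this]
  exact diffOp_mem i _

/-- `S Δ` factors as `Δ Z`. -/
def Exchange {B : Type*} [Ring B] (Δ : B) (S : Matrix (Fin n) (Fin n) (PowerSeries B)) : Prop :=
  ∃ Z, S * Matrix.scalar (Fin n) (PowerSeries.C Δ) = Matrix.scalar (Fin n) (PowerSeries.C Δ) * Z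

lemma Exchange.one {B : Type*} [Ring B] (Δ : B) :
    Exchange Δ (1 : Matrix (Fin n) (Fin n) (PowerSeries B)) :=
  ⟨1, by rw [one_mul, mul_one]⟩

lemma Exchange.mul {B : Type*} [Ring B] {Δ : B} {S T : Matrix (Fin n) (Fin n) (PowerSeries B)}
    (hS : Exchange Δ S) (hT : Exchange Δ T) : Exchange Δ (S * T) := by
  obtain ⟨Y, hY⟩ := hS
  obtain ⟨Z, hZ⟩ := hT
  exact ⟨Y * Z, by rw [mul_assoc, hZ, ← mul_assoc, hY, mul_assoc]⟩

lemma Exchange.list_prod {B : Type*} [Ring B] {Δ : B}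
    (l : List (Matrix (Fin n) (Fin n) (PowerSeries B))) (h : ∀ S ∈ l, Exchange Δ S) :
    Exchange Δ l.prod := by
  induction l with
  | nil => exact Exchange.one Δ
  | cons S l ih =>
    rw [List.prod_cons]
    exact (h S List.mem_cons_self).mul (ih fun S hS => h S (List.mem_cons_of_mem _ hS))

lemma Exchange.of_commute {B : Type*} [Ring B] {Δ : B}
    {S : Matrix (Fin n) (Fin n) (PowerSeries B)}
    (h : ∀ i j a, Commute Δ (PowerSeries.coeff a (S i j))) : Exchange Δ S := by
  refine ⟨S, ?_⟩
  ext1 i j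
  rw [Matrix.scalar_apply, Matrix.mul_diagonal, Matrix.diagonal_mul]
  exact (commute_C_series (h i j)).symm.eq

lemma tMatrix_exchange (i : Fin (r - 1)) : Exchange (diffOp K n r i) (tMatrix K n r) := by
  set f := fun p => evalMatrix (eOp K n r p) (mulOp K n r (AH.x K p)) with hf
  have hother : ∀ p, p ≠ lo i → p ≠ hi i → Exchange (diffOp K n r i) (f p) := by
    intro p h₁ h₂
    refine Exchange.of_commute (commute_coeff_evalMatrix _ _ _ ?_ ?_)
    · intro k l
      refine Commute.sub_left ?_ (eOp_mulOp p k l _).symm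
      have := eOp_swapOp (K := K) (n := n) i p k l
      rw [Equiv.swap_apply_of_ne_of_ne h₁ h₂] at this
      exact this.symm
    · exact (swapOp_mulOp i _).sub_left (commute_mulOp (AH.x_mul_s p i h₁ h₂).symm)
  have hadj : Exchange (diffOp K n r i) (f (lo i) * f (hi i)) := by
    refine evalMatrix_exchange _ _ _ _ (swapOp K n r i) (mulOp K n r (AH.s K i))
      (swapOp_mul_self i) ?_ (sum_eOp_mul_eOp i) (commute_mulOp (AH.x_mul_x _ _)) ?_ ?_
      (swapOp_mulOp i _) (swapOp_mulOp i _) (swapOp_mulOp i _) (fun k l => eOp_mulOp _ k l _)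
      (fun k l => eOp_mulOp _ k l _) (fun k l => eOp_mulOp _ k l _)
    · intro k l
      rw [eOp_swapOp, Equiv.swap_apply_left]
    · rw [← map_mul, AH.x_lo_mul_s, map_add, map_mul, map_one]
    · rw [← map_mul, AH.s_mul_x_lo, map_add, map_mul, map_one]
  have hlen : (List.ofFn f).length = r := List.length_ofFn
  have h1 : (i : ℕ) < (List.ofFn f).length := by omega
  have h2 : (i : ℕ) + 1 < (List.ofFn f).length := by omega
  have hsplit : List.ofFn f = (List.ofFn f).take i ++
      (f (lo i) :: f (hi i) :: (List.ofFn f).drop (i + 1 + 1)) := by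
    conv_lhs => rw [← List.take_append_drop (i : ℕ) (List.ofFn f), List.drop_eq_getElem_cons h1,
      List.drop_eq_getElem_cons h2]
    simp [lo, hi]
  have hT : tMatrix K n r = ((List.ofFn f).take i).prod *
      (f (lo i) * f (hi i) * ((List.ofFn f).drop (i + 1 + 1)).prod) := by
    change (List.ofFn f).prod = _
    conv_lhs => rw [hsplit]
    rw [List.prod_append, List.prod_cons, List.prod_cons, mul_assoc (f (lo i))]
  rw [hT]
  refine Exchange.mul (Exchange.list_prod _ ?_) (hadj.mul (Exchange.list_prod _ ?_))
  · intro S hS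
    obtain ⟨t, ht, rfl⟩ := List.mem_take_iff_getElem.1 hS
    rw [List.getElem_ofFn]
    refine hother _ ?_ ?_ <;> simp only [lo, hi, ne_eq, Fin.ext_iff] <;> omega
  · intro S hS
    obtain ⟨t, ht, rfl⟩ := List.mem_drop_iff_getElem.1 hS
    rw [List.getElem_ofFn]
    refine hother _ ?_ ?_ <;> simp only [lo, hi, ne_eq, Fin.ext_iff] <;> omega

lemma coeff_tMatrix_stable (k l : Fin n) (d : ℕ) :
    relSub K n r ≤ (relSub K n r).comap (PowerSeries.coeff d (tMatrix K n r k l)) := by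
  refine mem_relSub_of_exchange _ fun i => ?_
  obtain ⟨Z, hZ⟩ := tMatrix_exchange (K := K) (n := n) i
  refine ⟨PowerSeries.coeff d (Z k l), ?_⟩
  have := congrArg (fun M => PowerSeries.coeff d (M k l)) hZ
  simpa [Matrix.scalar_apply, Matrix.mul_diagonal, Matrix.diagonal_mul] using this

/-- The action of the Yangian on `V^{⊗ r} ⊗ AH_r` descends to `V^{⊗ r} ⊗_{K S_r} AH_r`. -/
lemma drinfeldTilde_stable (y : Yangian K n) :
    relSub K n r ≤ (relSub K n r).comap (drinfeldTilde K n r y) := by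
  obtain ⟨y, rfl⟩ := Yangian.mk_surjective y
  induction y using FreeAlgebra.induction with
  | grade0 c =>
    intro m hm
    rw [AlgHom.commutes, AlgHom.commutes, Submodule.mem_comap, Module.algebraMap_end_apply]
    exact (relSub K n r).smul_of_tower_mem c hm
  | grade1 g =>
    have := coeff_tMatrix_stable (K := K) (n := n) (r := r) g.1 g.2.1 (g.2.2 + 1)
    rw [← drinfeldTilde_T] at this
    exact this
  | mul a b ha hb =>
    intro m hm
    rw [map_mul, map_mul, Submodule.mem_comap, Module.End.mul_apply]
    exact ha (hb hm)
  | add a b ha hb =>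
    intro m hm
    rw [map_add, map_add, Submodule.mem_comap, LinearMap.add_apply]
    exact Submodule.add_mem _ (ha hm) (hb hm)

variable (K n r) in
/-- The Drinfeld homomorphism `D_{n,r} : Y(gl_n) → AS(n,r)`. -/
noncomputable def drinfeld : Yangian K n →ₐ[K] AS K n r where
  toFun y := (relSub K n r).mapQ (relSub K n r) (drinfeldTilde K n r y) (drinfeldTilde_stable y)
  map_one' := by
    apply Submodule.linearMap_qext
    refine LinearMap.ext fun m => ?_
    simp
  map_mul' y z := by
    apply Submodule.linearMap_qext
    refine LinearMap.ext fun m => ?_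
    simp
  map_zero' := by
    apply Submodule.linearMap_qext
    refine LinearMap.ext fun m => ?_
    simp
  map_add' y z := by
    apply Submodule.linearMap_qext
    refine LinearMap.ext fun m => ?_
    simp
  commutes' c := by
    apply Submodule.linearMap_qext
    refine LinearMap.ext fun m => ?_
    simp

lemma drinfeld_mk (y : Yangian K n) (m : FreeTensor K n r) :
    drinfeld K n r y ((relSub K n r).mkQ m) = (relSub K n r).mkQ (drinfeldTilde K n r y m) := rfl

end Homomorphism

/-! ### Filtrations, and the associated graded of the Drinfeld homomorphism -/

namespace AH

variable {K : Type*} [CommRing K] {r : ℕ}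

variable (K) in
/-- The product `s_{i_1} ⋯ s_{i_k}` in `AH_r`. -/
noncomputable def perm (w : List (Fin (r - 1))) : AH K r := (w.map (s K)).prod

variable (K r) in
/-- The subspace `F_d AH_r` spanned by all `w f` with `w ∈ S_r` and `f ∈ P_r` of degree `≤ d`. -/
noncomputable def filt (d : ℕ) : Submodule K (AH K r) :=
  Submodule.span K {h | ∃ (w : List (Fin (r - 1))) (f : MvPolynomial (Fin r) K),
    f.totalDegree ≤ d ∧ h = perm K w * poly f}

lemma filt_mono : Monotone (filt K r) := fun d e hde => Submodule.span_mono (by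
  rintro _ ⟨w, f, hf, rfl⟩
  exact ⟨w, f, hf.trans hde, rfl⟩)

lemma s_mul_mem (i : Fin (r - 1)) {d : ℕ} {h : AH K r} (hh : h ∈ filt K r d) :
    s K i * h ∈ filt K r d := by
  induction hh using Submodule.span_induction with
  | mem h hh =>
    obtain ⟨w, f, hf, rfl⟩ := hh
    refine Submodule.subset_span ⟨i :: w, f, hf, ?_⟩
    simp [perm, mul_assoc]
  | zero => simp
  | add a b _ _ ha hb =>
    rw [mul_add]
    exact Submodule.add_mem _ ha hb
  | smul c a _ ha =>
    rw [mul_smul_comm]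
    exact Submodule.smul_mem _ c ha

lemma x_hi_mul_s (i : Fin (r - 1)) : x K (hi i) * s K i = s K i * x K (lo i) - 1 := by
  rw [s_mul_x_lo, add_sub_cancel_right]

lemma x_mul_mem (p : Fin r) {d : ℕ} {h : AH K r} (hh : h ∈ filt K r d) :
    x K p * h ∈ filt K r (d + 1) := by
  induction hh using Submodule.span_induction with
  | mem h hh =>
    obtain ⟨w, f, hf, rfl⟩ := hh
    have hw : ∀ w : List (Fin (r - 1)), perm K w * poly f ∈ filt K r (d + 1) := fun w =>
      Submodule.subset_span ⟨w, f, hf.trans (Nat.le_succ d), rfl⟩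
    induction w generalizing p with
    | nil =>
      refine Submodule.subset_span ⟨[], MvPolynomial.X p * f, ?_, ?_⟩
      · refine (MvPolynomial.totalDegree_mul _ _).trans ?_
        have := MvPolynomial.totalDegree_monomial_le (Finsupp.single p 1) (1 : K)
        have h2 : (MvPolynomial.X p : MvPolynomial (Fin r) K).totalDegree ≤ 1 := by
          refine this.trans ?_
          simp
        omega
      · simp [perm, poly_X]
    | cons i w ih =>
      have e : x K p * (perm K (i :: w) * poly f) = (x K p * s K i) * (perm K w * poly f) := by
        simp [perm, mul_assoc]
      rw [e]
      by_cases h₁ : p = lo i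
      · rw [h₁, x_lo_mul_s, add_mul, one_mul, mul_assoc]
        exact Submodule.add_mem _ (s_mul_mem i (ih (hi i))) (hw w)
      · by_cases h₂ : p = hi i
        · rw [h₂, x_hi_mul_s, sub_mul, one_mul, mul_assoc]
          exact Submodule.sub_mem _ (s_mul_mem i (ih (lo i))) (hw w)
        · rw [x_mul_s p i h₁ h₂, mul_assoc]
          exact s_mul_mem i (ih p)
  | zero => simp
  | add a b _ _ ha hb =>
    rw [mul_add]
    exact Submodule.add_mem _ ha hb
  | smul c a _ ha =>
    rw [mul_smul_comm]
    exact Submodule.smul_mem _ c ha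

lemma x_pow_mul_mem (p : Fin r) (k : ℕ) {d : ℕ} {h : AH K r} (hh : h ∈ filt K r d) :
    x K p ^ k * h ∈ filt K r (k + d) := by
  induction k with
  | zero => simpa using hh
  | succ k ih =>
    rw [pow_succ', mul_assoc, Nat.add_right_comm]
    exact x_mul_mem p ih

end AH

section Filtrations

variable (K : Type*) [CommRing K] (n r : ℕ)

/-- The filtration of `V^{⊗ r} ⊗ AH_r` induced by that of `AH_r`. -/
noncomputable def freeFilt (d : ℕ) : Submodule K (FreeTensor K n r) :=
  Submodule.pi Set.univ fun _ => AH.filt K r d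

/-- The filtration of the induced tensor space; `F_d` is the image of `V^{⊗ r} ⊗ F_d AH_r`. -/
noncomputable def indFilt (d : ℕ) : Submodule K (IndTensor K n r) :=
  (freeFilt K n r d).map ((relSub K n r).mkQ.restrictScalars K)

variable {K n r}

lemma mem_freeFilt (d : ℕ) (m : FreeTensor K n r) :
    m ∈ freeFilt K n r d ↔ ∀ a, m a ∈ AH.filt K r d := by
  simp [freeFilt, Submodule.mem_pi]

lemma freeFilt_mono : Monotone (freeFilt K n r) := fun d e hde m hm => by
  rw [mem_freeFilt] at hm ⊢
  exact fun a => AH.filt_mono hde (hm a)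

lemma indFilt_mono : Monotone (indFilt K n r) := fun _ _ hde =>
  Submodule.map_mono (freeFilt_mono hde)

variable (K n r) in
/-- The filtration of `AS(n,r)`; `F_d` consists of the endomorphisms mapping the `e`th step of the
filtration of the induced tensor space into the `(d + e)`th step, for all `e`. -/
noncomputable def filtAS : AlgFiltration K (AS K n r) where
  F d :=
    { carrier := {f | ∀ e, ∀ m ∈ indFilt K n r e, f m ∈ indFilt K n r (d + e)}
      add_mem' := fun hf hg e m hm => Submodule.add_mem _ (hf e m hm) (hg e m hm)
      zero_mem' := fun _ _ _ => Submodule.zero_mem _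
      smul_mem' := fun c _ hf e m hm => Submodule.smul_mem _ c (hf e m hm) }
  mono d d' hd f hf e m hm := indFilt_mono (by omega) (hf e m hm)
  one_mem := fun e m hm => by
    rw [zero_add]
    exact hm
  mul_mem := by
    intro d d' f g hf hg e m hm
    rw [add_assoc]
    exact hf _ _ (hg e m hm)

lemma mem_filtAS (d : ℕ) (f : AS K n r) : f ∈ (filtAS K n r).F d ↔
    ∀ e, ∀ m ∈ indFilt K n r e, f m ∈ indFilt K n r (d + e) := Iff.rfl

lemma evalMatrix_raises (p : Fin r) (k l : Fin n) (d e : ℕ) (m : FreeTensor K n r)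
    (hm : m ∈ freeFilt K n r e) :
    PowerSeries.coeff d (evalMatrix (eOp K n r p) (mulOp K n r (AH.x K p)) k l) m ∈
      freeFilt K n r (d - 1 + e) := by
  rw [coeff_evalMatrix, LinearMap.add_apply]
  refine Submodule.add_mem _ ?_ ?_
  · split_ifs
    · exact freeFilt_mono (by omega) hm
    · exact Submodule.zero_mem _
  · split_ifs
    · rw [mul_zero]
      exact Submodule.zero_mem _
    · rw [← map_pow, Module.End.mul_apply, mem_freeFilt]
      intro a
      rw [eOp_apply]
      split_ifs
      · exact AH.x_pow_mul_mem p _ ((mem_freeFilt _ _).1 hm _)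
      · exact Submodule.zero_mem _

lemma list_prod_raises (L : List (Matrix (Fin n) (Fin n) (PowerSeries (FreeEnd K n r))))
    (h : ∀ S ∈ L, ∀ k l d e, ∀ m ∈ freeFilt K n r e,
      PowerSeries.coeff d (S k l) m ∈ freeFilt K n r (d - 1 + e))
    (k l : Fin n) (d e : ℕ) (m : FreeTensor K n r) (hm : m ∈ freeFilt K n r e) :
    PowerSeries.coeff d (L.prod k l) m ∈ freeFilt K n r (d - 1 + e) := by
  induction L generalizing k l d e m with
  | nil =>
    rw [List.prod_nil, Matrix.one_apply]
    split_ifs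
    · rw [PowerSeries.coeff_one]
      split_ifs
      · exact freeFilt_mono (by omega) hm
      · exact Submodule.zero_mem _
    · exact Submodule.zero_mem _
  | cons S L ih =>
    rw [List.prod_cons, Matrix.mul_apply, map_sum, LinearMap.sum_apply]
    refine Submodule.sum_mem _ fun t _ => ?_
    rw [PowerSeries.coeff_mul, LinearMap.sum_apply]
    refine Submodule.sum_mem _ fun c hc => ?_
    have hc' := Finset.HasAntidiagonal.mem_antidiagonal.1 hc
    rw [Module.End.mul_apply]
    refine freeFilt_mono ?_ (h S List.mem_cons_self k t c.1 _ _
      (ih (fun S hS => h S (List.mem_cons_of_mem _ hS)) t l c.2 e m hm))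
    omega

lemma drinfeld_T_mem (i j : Fin n) (d : ℕ) :
    drinfeld K n r (Yangian.T K i j (d + 1)) ∈ (filtAS K n r).F d := by
  rw [mem_filtAS]
  rintro e _ ⟨m, hm, rfl⟩
  refine ⟨drinfeldTilde K n r (Yangian.T K i j (d + 1)) m, ?_, rfl⟩
  rw [drinfeldTilde_T]
  refine list_prod_raises _ ?_ i j (d + 1) e m hm
  intro S hS k l d e m hm
  rw [List.mem_ofFn] at hS
  obtain ⟨p, rfl⟩ := hS
  exact evalMatrix_raises p k l d e m hm

/-- The Drinfeld homomorphism is filtered. -/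
lemma drinfeld_filtered (d : ℕ) (y : Yangian K n) (hy : y ∈ (Yangian.filtration K n).F d) :
    drinfeld K n r y ∈ (filtAS K n r).F d := by
  refine (Submodule.span_le (p := ((filtAS K n r).F d).comap
    (drinfeld K n r).toLinearMap)).2 ?_ hy
  rintro _ ⟨w, hw, rfl⟩
  refine (filtAS K n r).mono hw ?_
  clear hw
  induction w with
  | nil =>
    simp only [Yangian.word, Yangian.wordDeg, List.map_nil, List.prod_nil, List.sum_nil,
      AlgHom.toLinearMap_apply, map_one]
    exact (filtAS K n r).one_mem
  | cons g w ih =>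
    have e1 : Yangian.word (K := K) (g :: w) =
        Yangian.T K g.1 g.2.1 (g.2.2 + 1) * Yangian.word w := by
      simp [Yangian.word]
    have e2 : Yangian.wordDeg (g :: w) = g.2.2 + Yangian.wordDeg w := by
      simp [Yangian.wordDeg]
    rw [e1, e2, AlgHom.toLinearMap_apply, map_mul]
    exact (filtAS K n r).mul_mem (drinfeld_T_mem g.1 g.2.1 g.2.2) ih

variable (K n r) in
/-- The homomorphism `gr D_{n,r} : U(gl_n[x]) → gr Y(gl_n) → gr AS(n,r)`. -/
noncomputable def grDrinfeld : UCurrent K n →ₐ[K] (filtAS K n r).Gr :=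
  (AlgFiltration.grMap (Yangian.filtration K n) (filtAS K n r) (drinfeld K n r)
    drinfeld_filtered).comp (currentToGr K n)

end Filtrations

/-! ### The current Schur algebra -/

section CurrentSchur

variable (K : Type*) [CommRing K] (n r : ℕ)

/-- The space `V^{⊗ r} ⊗ P_r`, written in coordinates: `m` stands for `∑ a, v_a ⊗ m a`. The
polynomial algebra `P_r` acts by multiplication on the second tensor factor. -/
abbrev PolyTensor : Type _ := Idx n r → MvPolynomial (Fin r) K

variable {K n r} in
/-- The right action of `w ∈ S_r` on `V^{⊗ r} ⊗ P_r`, given by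
`(v_a ⊗ f) w = v_{a ∘ w} ⊗ w⁻¹(f)`. -/
noncomputable def permAct (w : Equiv.Perm (Fin r)) (m : PolyTensor K n r) : PolyTensor K n r :=
  fun b => MvPolynomial.rename w.symm (m (b ∘ w.symm))

lemma permAct_single (w : Equiv.Perm (Fin r)) (a : Idx n r) (f : MvPolynomial (Fin r) K) :
    permAct w (Pi.single a f) = Pi.single (a ∘ w) (MvPolynomial.rename w.symm f) := by
  have h : ∀ b : Idx n r, (b ∘ w.symm = a) = (b = a ∘ w) := by
    intro b
    apply propext
    constructor
    · rintro rfl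
      ext t
      simp
    · rintro rfl
      ext t
      simp
  ext1 b
  simp only [permAct, Pi.single_apply, h]
  split_ifs <;> simp

/-- The current Schur algebra `AS_0(n,r)`, the algebra of endomorphisms of `V^{⊗ r} ⊗ P_r`
commuting with the actions of `P_r` and `S_r`. -/
noncomputable def AS0 :
    Subalgebra K (Module.End (MvPolynomial (Fin r) K) (PolyTensor K n r)) where
  carrier := {f | ∀ w m, f (permAct w m) = permAct w (f m)}
  mul_mem' := by
    intro f g hf hg w m
    rw [Module.End.mul_apply, hg w m, hf w]
    rfl
  add_mem' := by
    intro f g hf hg w m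
    rw [LinearMap.add_apply, hf w m, hg w m]
    ext1 b
    simp [permAct]
  algebraMap_mem' := by
    intro c w m
    rw [Module.algebraMap_end_apply, Module.algebraMap_end_apply]
    ext1 b
    simp [permAct]

variable {K n r} in
/-- The image in the induced tensor space of an element of `V^{⊗ r} ⊗ P_r`. -/
noncomputable def polyToInd (m : PolyTensor K n r) : IndTensor K n r :=
  (relSub K n r).mkQ fun a => AH.poly (m a)

variable {K n r} in
/-- The condition that an isomorphism `β : gr AS(n,r) ≃ AS_0(n,r)` is the canonical
identification. The associated graded of the induced tensor space is `V^{⊗ r} ⊗ P_r`, where a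
homogeneous element of degree `e` is identified with the class of its image in the `e`th step of
the filtration; for `f` in the `d`th step of the filtration of `AS(n,r)`, the map `β (gr_d f)` must
be homogeneous of degree `d` and be the leading term of `f`. -/
def IsSymbolIso (β : (filtAS K n r).Gr ≃ₐ[K] AS0 K n r) : Prop :=
  ∀ (d : ℕ) (f : AS K n r) (hf : f ∈ (filtAS K n r).F d) (e : ℕ) (m : PolyTensor K n r),
    (∀ a, (m a).IsHomogeneous e) →
      (∀ a, ((β ((filtAS K n r).symb d f hf)).1 m a).IsHomogeneous (d + e)) ∧
      f (polyToInd m) - polyToInd ((β ((filtAS K n r).symb d f hf)).1 m) ∈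
        prevStep (indFilt K n r) (d + e)

end CurrentSchur

end DrinfeldSchur

/-!
The idea is to identify everything with matrices over `P_r` and to prove the surjectivity on the
associated graded level, where it is a statement about invariants of the symmetric group.

Right multiplication by `s_i` on the induced tensor space `M` has to be
`v ⊗ f ↦ v s_i ⊗ s_i(f) + v ⊗ ∂_i f`, with `∂_i` the divided difference. These operators satisfy the
relations of `AH_r`: an operator which permutes the variables and kills `V^{⊗ r} ⊗ 1` vanishes
(`end_eq_zero_of_intertwines`), so the Coxeter relations reduce to those between permutations. Hence
`AH_r` acts on `V^{⊗ r} ⊗ P_r`, and `M` is isomorphic to `V^{⊗ r} ⊗ P_r`, with its filtration given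
by the degree (`indToPoly_polyToInd`, `polyToInd_surjective`, `indFilt_eq_map`). This is the basis
theorem for `AH_r` in the form needed here.

An element of `AS(n,r)` is therefore a matrix over `P_r`; it lies in `F_d` exactly when its entries
have degree at most `d` (`mem_filtAS_iff`), and its symbol is the matrix of homogeneous parts of
degree `d`. Since `∂_i` lowers the degree, symbols are invariant under the symmetric group. This
gives an injective homomorphism `symbolHom` from `gr AS(n,r)` to `AS_0(n,r)`.

The symbol of the image of `T_{i,j}^{(d+1)}` is `∑ p, e_{i,j}^{[p]} x_p ^ d` (`topMat_drinfeld_T`):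
the terms of the product involving several factors have lower degree. In characteristic `0` the
elements `∑ p, y^{[p]}` with `y` in `gl_n[x]` generate `AS_0(n,r)`, the invariants in the `r`th
tensor power of the algebra of matrices over `K[x]` (`mem_of_invariant`). So the composite of
`gr D_{n,r}` and `symbolHom` is surjective; in particular `symbolHom` is an isomorphism. Finally
`D_{n,r}` is surjective because the filtration of `AS(n,r)` is exhaustive and starts at `0`
(`AlgFiltration.surjective_of_grMap`).
-/

namespace DrinfeldSchur

/-! ### Top-degree components of polynomials -/

section Degree

variable {K σ τ : Type*} [CommRing K]

variable (K σ) in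
/-- The polynomials all of whose monomials have degree `< d`. The strict bound makes `degLT K σ 0`
the zero subspace, so `degLT K σ (d + 1)` is the `d`th step of the degree filtration and
`degLT K σ d` the step before it. -/
def degLT (d : ℕ) : Submodule K (MvPolynomial σ K) where
  carrier := {f | ∀ m : σ →₀ ℕ, d ≤ m.degree → MvPolynomial.coeff m f = 0}
  add_mem' := fun hf hg m hm => by rw [MvPolynomial.coeff_add, hf m hm, hg m hm, add_zero]
  zero_mem' := fun m _ => MvPolynomial.coeff_zero m
  smul_mem' := fun c f hf m hm => by rw [MvPolynomial.coeff_smul, hf m hm, smul_zero]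

lemma mem_degLT {d : ℕ} {f : MvPolynomial σ K} :
    f ∈ degLT K σ d ↔ ∀ m : σ →₀ ℕ, d ≤ m.degree → MvPolynomial.coeff m f = 0 := Iff.rfl

lemma degLT_mono : Monotone (degLT K σ) := fun _ _ hde _ hf m hm => hf m (hde.trans hm)

lemma mem_degLT_succ {d : ℕ} {f : MvPolynomial σ K} :
    f ∈ degLT K σ (d + 1) ↔ f.totalDegree ≤ d := by
  have hdeg : ∀ m : σ →₀ ℕ, (m.sum fun _ e => e) = m.degree := fun _ => rfl
  rw [mem_degLT, MvPolynomial.totalDegree, Finset.sup_le_iff]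
  constructor
  · intro h m hm
    by_contra hlt
    rw [hdeg] at hlt
    exact MvPolynomial.mem_support_iff.1 hm (h m (by omega))
  · intro h m hm
    by_contra hne
    have := h m (MvPolynomial.mem_support_iff.2 hne)
    rw [hdeg] at this
    omega

lemma degLT_zero : degLT K σ 0 = ⊥ := by
  rw [eq_bot_iff]
  intro f hf
  exact (Submodule.mem_bot K).2 (MvPolynomial.ext _ _ fun m => by
    rw [hf m (Nat.zero_le _), MvPolynomial.coeff_zero])

lemma mul_mem_degLT {d e : ℕ} {f g : MvPolynomial σ K} (hf : f ∈ degLT K σ d)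
    (hg : g ∈ degLT K σ (e + 1)) : f * g ∈ degLT K σ (d + e) := by
  classical
  intro m hm
  rw [MvPolynomial.coeff_mul]
  refine Finset.sum_eq_zero fun p hp => ?_
  rw [Finset.HasAntidiagonal.mem_antidiagonal] at hp
  have hdeg : p.1.degree + p.2.degree = m.degree := by rw [← hp, map_add]
  rcases le_or_gt d p.1.degree with h | h
  · rw [hf _ h, zero_mul]
  · rw [hg _ (by omega), mul_zero]

lemma homogeneousComponent_mul {d e : ℕ} {f g : MvPolynomial σ K} (hf : f ∈ degLT K σ (d + 1))
    (hg : g ∈ degLT K σ (e + 1)) : MvPolynomial.homogeneousComponent (d + e) (f * g) =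
      MvPolynomial.homogeneousComponent d f * MvPolynomial.homogeneousComponent e g := by
  classical
  ext m
  rw [MvPolynomial.coeff_homogeneousComponent, MvPolynomial.coeff_mul, MvPolynomial.coeff_mul]
  simp only [MvPolynomial.coeff_homogeneousComponent]
  split_ifs with hm
  · refine Finset.sum_congr rfl fun p hp => ?_
    rw [Finset.HasAntidiagonal.mem_antidiagonal] at hp
    have hdeg : p.1.degree + p.2.degree = m.degree := by rw [← hp, map_add]
    by_cases h1 : p.1.degree = d
    · rw [if_pos h1, if_pos (by omega)]
    · rw [if_neg h1, zero_mul]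
      rcases lt_or_gt_of_ne h1 with h | h
      · rw [hg _ (by omega), mul_zero]
      · rw [hf _ h, zero_mul]
  · refine (Finset.sum_eq_zero fun p hp => ?_).symm
    rw [Finset.HasAntidiagonal.mem_antidiagonal] at hp
    have hdeg : p.1.degree + p.2.degree = m.degree := by rw [← hp, map_add]
    by_cases h1 : p.1.degree = d
    · rw [if_neg (by omega : ¬ p.2.degree = e), mul_zero]
    · rw [if_neg h1, zero_mul]

lemma homogeneousComponent_of_mem_degLT {d : ℕ} {f : MvPolynomial σ K} (hf : f ∈ degLT K σ d) :
    MvPolynomial.homogeneousComponent d f = 0 := by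
  ext m
  rw [MvPolynomial.coeff_homogeneousComponent, MvPolynomial.coeff_zero]
  split_ifs with h
  · exact hf m h.ge
  · rfl

lemma mem_degLT_of_homogeneousComponent {d : ℕ} {f : MvPolynomial σ K}
    (hf : f ∈ degLT K σ (d + 1)) (h0 : MvPolynomial.homogeneousComponent d f = 0) :
    f ∈ degLT K σ d := by
  intro m hm
  rcases hm.eq_or_lt with h | h
  · have := congrArg (MvPolynomial.coeff m) h0
    rwa [MvPolynomial.coeff_homogeneousComponent, if_pos h.symm] at this
  · exact hf m h

lemma mem_degLT_of_isHomogeneous {d : ℕ} {f : MvPolynomial σ K} (hf : f.IsHomogeneous d) :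
    f ∈ degLT K σ (d + 1) := fun _ hm => hf.coeff_eq_zero (by omega)

lemma sub_homogeneousComponent_mem_degLT {d : ℕ} {f : MvPolynomial σ K}
    (hf : f ∈ degLT K σ (d + 1)) : f - MvPolynomial.homogeneousComponent d f ∈ degLT K σ d := by
  refine mem_degLT_of_homogeneousComponent (Submodule.sub_mem _ hf ?_) ?_
  · exact mem_degLT_of_isHomogeneous (MvPolynomial.homogeneousComponent_isHomogeneous d f)
  · rw [map_sub, MvPolynomial.homogeneousComponent_eq_self
      (MvPolynomial.homogeneousComponent_isHomogeneous d f), sub_self]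

lemma exists_mem_degLT (f : MvPolynomial σ K) : ∃ d, f ∈ degLT K σ (d + 1) :=
  ⟨f.totalDegree, mem_degLT_succ.2 le_rfl⟩

lemma rename_mem_degLT (w : Equiv.Perm σ) {d : ℕ} {f : MvPolynomial σ K} (hf : f ∈ degLT K σ d) :
    MvPolynomial.rename w f ∈ degLT K σ d := by
  cases d with
  | zero =>
    rw [degLT_zero, Submodule.mem_bot] at hf ⊢
    rw [hf, map_zero]
  | succ d =>
    rw [mem_degLT_succ] at hf ⊢
    exact (MvPolynomial.totalDegree_rename_le _ _).trans hf

end Degree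

/-! ### Homomorphisms out of an associated graded algebra -/

namespace AlgFiltration

variable {K A B C : Type*} [CommRing K] [Ring A] [Algebra K A] [Ring B] [Algebra K B] [Ring C]
  [Algebra K C]

lemma grMk_surjective (𝓕 : AlgFiltration K A) : Function.Surjective 𝓕.grMk :=
  RingCon.mk'_surjective _

/-- A family of linear maps `t d` which is multiplicative along the filtration and such that `t d`
kills `F (d - 1)` induces a homomorphism `gr_d a ↦ t d a` out of the associated graded algebra. -/
noncomputable def grLift (𝓕 : AlgFiltration K A) (t : ℕ → A →ₗ[K] C) (h1 : t 0 1 = 1)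
    (hmul : ∀ d e a b, a ∈ 𝓕.F d → b ∈ 𝓕.F e → t (d + e) (a * b) = t d a * t e b)
    (hprev : ∀ d, ∀ a ∈ prevStep 𝓕.F d, t d a = 0) : 𝓕.Gr →ₐ[K] C :=
  RingCon.liftₐ 𝓕.grCon
    (AlgHom.ofLinearMap (Polynomial.lsum t ∘ₗ 𝓕.rees.val.toLinearMap)
      (by
        change Polynomial.lsum t (1 : Polynomial A) = 1
        rw [Polynomial.lsum_apply, ← Polynomial.monomial_zero_one,
          Polynomial.sum_monomial_index _ _ (map_zero (t 0)), h1])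
      (by
        intro p q
        change Polynomial.lsum t ((p : Polynomial A) * (q : Polynomial A)) =
          Polynomial.lsum t (p : Polynomial A) * Polynomial.lsum t (q : Polynomial A)
        rw [Polynomial.mul_eq_sum_sum, map_sum]
        simp only [Polynomial.sum_def, map_sum, Polynomial.lsum_apply]
        rw [Finset.sum_mul_sum]
        refine Finset.sum_congr rfl fun i _ => Finset.sum_congr rfl fun j _ => ?_
        rw [← Polynomial.sum_def, Polynomial.sum_monomial_index _ _ (map_zero (t _))]
        exact hmul _ _ _ _ (p.2 i) (q.2 j)))
    (by
      intro p q h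
      change Polynomial.lsum t (p : Polynomial A) = Polynomial.lsum t (q : Polynomial A)
      rw [← sub_eq_zero, ← map_sub, Polynomial.lsum_apply, Polynomial.sum_def]
      refine Finset.sum_eq_zero fun d _ => hprev d _ ?_
      rw [Polynomial.coeff_sub]
      exact h d)

variable (𝓕 : AlgFiltration K A) (t : ℕ → A →ₗ[K] C) (h1 : t 0 1 = 1)
    (hmul : ∀ d e a b, a ∈ 𝓕.F d → b ∈ 𝓕.F e → t (d + e) (a * b) = t d a * t e b)
    (hprev : ∀ d, ∀ a ∈ prevStep 𝓕.F d, t d a = 0)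

lemma grLift_grMk (p : 𝓕.rees) : 𝓕.grLift t h1 hmul hprev (𝓕.grMk p) =
    (p : Polynomial A).sum fun d a => t d a := rfl

lemma grLift_symb (d : ℕ) (a : A) (ha : a ∈ 𝓕.F d) :
    𝓕.grLift t h1 hmul hprev (𝓕.symb d a ha) = t d a := by
  rw [symb, grLift_grMk, Polynomial.sum_monomial_index _ _ (map_zero (t d))]

lemma grLift_injective (hind : ∀ (s : Finset ℕ) (a : ℕ → A), ∑ d ∈ s, t d (a d) = 0 →
      ∀ d ∈ s, t d (a d) = 0)
    (hker : ∀ d, ∀ a ∈ 𝓕.F d, t d a = 0 → a ∈ prevStep 𝓕.F d) :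
    Function.Injective (𝓕.grLift t h1 hmul hprev) := by
  rw [injective_iff_map_eq_zero]
  intro y hy
  obtain ⟨p, rfl⟩ := 𝓕.grMk_surjective y
  rw [← map_zero 𝓕.grMk, grMk_eq_iff]
  intro d
  rw [ZeroMemClass.coe_zero, Polynomial.coeff_zero, sub_zero]
  by_cases hd : d ∈ (p : Polynomial A).support
  · exact hker d _ (p.2 d) (hind _ _ hy d hd)
  · rw [Polynomial.notMem_support_iff.1 hd]
    exact Submodule.zero_mem _

/-- A filtered homomorphism into an exhaustively filtered algebra is surjective if the induced
homomorphism of associated graded algebras is. -/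
lemma surjective_of_grMap (𝓖 : AlgFiltration K B) (φ : A →ₐ[K] B)
    (hφ : ∀ d, ∀ a ∈ 𝓕.F d, φ a ∈ 𝓖.F d) (hex : ∀ b, ∃ d, b ∈ 𝓖.F d)
    (hgr : Function.Surjective (grMap 𝓕 𝓖 φ hφ)) : Function.Surjective φ := by
  have step : ∀ d, ∀ b ∈ 𝓖.F d, ∃ a, b - φ a ∈ prevStep 𝓖.F d := by
    intro d b hb
    obtain ⟨y, hy⟩ := hgr (𝓖.symb d b hb)
    obtain ⟨p, rfl⟩ := 𝓕.grMk_surjective y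
    have h := (𝓖.grMk_eq_iff _ _).1 (hy.symm : _ = 𝓖.grMk (reesMap 𝓕 𝓖 φ hφ p)) d
    refine ⟨(p : Polynomial A).coeff d, ?_⟩
    simpa [coe_reesMap, Polynomial.coeff_map] using h
  have key : ∀ d, ∀ b ∈ 𝓖.F d, ∃ a, φ a = b := by
    intro d
    induction d with
    | zero =>
      intro b hb
      obtain ⟨a, ha⟩ := step 0 b hb
      exact ⟨a, (sub_eq_zero.1 ((Submodule.mem_bot K).1 ha)).symm⟩
    | succ d ih =>
      intro b hb
      obtain ⟨a, ha⟩ := step (d + 1) b hb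
      obtain ⟨a', ha'⟩ := ih _ ha
      exact ⟨a' + a, by rw [map_add, ha', sub_add_cancel]⟩
  intro b
  obtain ⟨d, hd⟩ := hex b
  exact key d b hd

end AlgFiltration

/-! ### Divided differences -/

section DividedDifference

variable {K : Type*} [Field K] {r : ℕ}

lemma X_lo_sub_X_hi_dvd (i : Fin (r - 1)) (f : MvPolynomial (Fin r) K) :
    (MvPolynomial.X (lo i) - MvPolynomial.X (hi i)) ∣
      f - MvPolynomial.rename (Equiv.swap (lo i) (hi i)) f := by
  induction f using MvPolynomial.induction_on with
  | C c => simp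
  | add f g hf hg =>
    rw [map_add, add_sub_add_comm]
    exact dvd_add hf hg
  | mul_X f p hf =>
    have hX : (MvPolynomial.X (lo i) - MvPolynomial.X (hi i) : MvPolynomial (Fin r) K) ∣
        MvPolynomial.X p - MvPolynomial.X (Equiv.swap (lo i) (hi i) p) := by
      rcases eq_or_ne p (lo i) with rfl | h1
      · rw [Equiv.swap_apply_left]
      · rcases eq_or_ne p (hi i) with rfl | h2
        · rw [Equiv.swap_apply_right, ← neg_sub]
          exact neg_dvd.2 (dvd_refl _)
        · rw [Equiv.swap_apply_of_ne_of_ne h1 h2, sub_self]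
          exact dvd_zero _
    have e : f * MvPolynomial.X p - MvPolynomial.rename (Equiv.swap (lo i) (hi i))
        (f * MvPolynomial.X p) =
        (f - MvPolynomial.rename (Equiv.swap (lo i) (hi i)) f) * MvPolynomial.X p +
          MvPolynomial.rename (Equiv.swap (lo i) (hi i)) f *
            (MvPolynomial.X p - MvPolynomial.X (Equiv.swap (lo i) (hi i) p)) := by
      rw [map_mul, MvPolynomial.rename_X]
      ring
    rw [e]
    exact dvd_add (hf.mul_right _) (hX.mul_left _)

variable (K) in
lemma X_lo_sub_X_hi_ne_zero (i : Fin (r - 1)) :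
    (MvPolynomial.X (lo i) - MvPolynomial.X (hi i) : MvPolynomial (Fin r) K) ≠ 0 := by
  rw [sub_ne_zero]
  exact fun h => lo_ne_hi i (MvPolynomial.X_injective h)

/-- The divided difference `∂_i f = (f - s_i(f)) / (x_i - x_{i+1})`. -/
noncomputable def divDiff (i : Fin (r - 1)) :
    MvPolynomial (Fin r) K →ₗ[K] MvPolynomial (Fin r) K where
  toFun f := (X_lo_sub_X_hi_dvd i f).choose
  map_add' f g := by
    refine mul_left_cancel₀ (X_lo_sub_X_hi_ne_zero K i) ?_
    rw [mul_add, ← (X_lo_sub_X_hi_dvd i (f + g)).choose_spec,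
      ← (X_lo_sub_X_hi_dvd i f).choose_spec, ← (X_lo_sub_X_hi_dvd i g).choose_spec, map_add,
      add_sub_add_comm]
  map_smul' c f := by
    refine mul_left_cancel₀ (X_lo_sub_X_hi_ne_zero K i) ?_
    rw [RingHom.id_apply, mul_smul_comm, ← (X_lo_sub_X_hi_dvd i (c • f)).choose_spec,
      ← (X_lo_sub_X_hi_dvd i f).choose_spec, map_smul, smul_sub]

lemma mul_divDiff (i : Fin (r - 1)) (f : MvPolynomial (Fin r) K) :
    (MvPolynomial.X (lo i) - MvPolynomial.X (hi i)) * divDiff i f =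
      f - MvPolynomial.rename (Equiv.swap (lo i) (hi i)) f :=
  (X_lo_sub_X_hi_dvd i f).choose_spec.symm

lemma divDiff_eq {i : Fin (r - 1)} {f g : MvPolynomial (Fin r) K}
    (h : (MvPolynomial.X (lo i) - MvPolynomial.X (hi i)) * g =
      f - MvPolynomial.rename (Equiv.swap (lo i) (hi i)) f) : divDiff i f = g :=
  mul_left_cancel₀ (X_lo_sub_X_hi_ne_zero K i) ((mul_divDiff i f).trans h.symm)

lemma divDiff_one (i : Fin (r - 1)) : divDiff (K := K) i 1 = 0 := divDiff_eq (by simp)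

lemma divDiff_X_lo (i : Fin (r - 1)) :
    divDiff (K := K) i (MvPolynomial.X (lo i)) = 1 := divDiff_eq (by simp)

lemma divDiff_X_hi (i : Fin (r - 1)) :
    divDiff (K := K) i (MvPolynomial.X (hi i)) = -1 := divDiff_eq (by simp)

lemma divDiff_X_of_ne (i : Fin (r - 1)) (p : Fin r) (h₁ : p ≠ lo i) (h₂ : p ≠ hi i) :
    divDiff (K := K) i (MvPolynomial.X p) = 0 :=
  divDiff_eq (by simp [Equiv.swap_apply_of_ne_of_ne h₁ h₂])

lemma divDiff_mul (i : Fin (r - 1)) (f g : MvPolynomial (Fin r) K) :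
    divDiff i (f * g) =
      divDiff i f * g + MvPolynomial.rename (Equiv.swap (lo i) (hi i)) f * divDiff i g := by
  refine divDiff_eq ?_
  rw [mul_add, ← mul_assoc, mul_divDiff, mul_left_comm, mul_divDiff, map_mul]
  ring

/-- The divided difference lowers the degree. -/
lemma homogeneousComponent_divDiff (i : Fin (r - 1)) {d : ℕ} {f : MvPolynomial (Fin r) K}
    (hf : f ∈ degLT K (Fin r) (d + 1)) :
    MvPolynomial.homogeneousComponent d (divDiff i f) = 0 := by
  set l : MvPolynomial (Fin r) K := MvPolynomial.X (lo i) - MvPolynomial.X (hi i) with hl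
  have hl1 : l.IsHomogeneous 1 :=
    (MvPolynomial.isHomogeneous_X _ _).sub (MvPolynomial.isHomogeneous_X _ _)
  have hrhs : l * divDiff i f ∈ degLT K (Fin r) (d + 1) := by
    rw [hl, mul_divDiff]
    exact Submodule.sub_mem _ hf (rename_mem_degLT _ hf)
  -- Descending induction from the total degree of `divDiff i f`: for `k ≥ d`, the component of
  -- degree `k + 1` of `l * divDiff i f` vanishes, hence so does the component of degree `k` of
  -- `divDiff i f`.
  have hstep : ∀ j, divDiff i f ∈ degLT K (Fin r) (d + j + 1) →
      divDiff i f ∈ degLT K (Fin r) (d + j) := by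
    intro j hj
    refine mem_degLT_of_homogeneousComponent hj ?_
    have h := homogeneousComponent_mul (mem_degLT_of_isHomogeneous hl1) hj
    rw [MvPolynomial.homogeneousComponent_eq_self hl1,
      homogeneousComponent_of_mem_degLT (degLT_mono (by omega) hrhs)] at h
    exact (mul_eq_zero.1 h.symm).resolve_left (X_lo_sub_X_hi_ne_zero K i)
  have hall : ∀ j, divDiff i f ∈ degLT K (Fin r) (d + j) → divDiff i f ∈ degLT K (Fin r) d := by
    intro j
    induction j with
    | zero => exact id
    | succ j ih => exact fun h => ih (hstep j h)
  obtain ⟨e, he⟩ := exists_mem_degLT (divDiff i f)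
  exact homogeneousComponent_of_mem_degLT (hall (e + 1) (degLT_mono (by omega) he))

end DividedDifference

/-! ### The right action of the degenerate affine Hecke algebra on `V^{⊗ r} ⊗ P_r` -/

section RightAction

variable (K : Type*) [Field K] (n r : ℕ)

/-- Multiplication by `x_p` on `V^{⊗ r} ⊗ P_r`. -/
noncomputable def xAct (p : Fin r) : Module.End K (PolyTensor K n r) where
  toFun m a := MvPolynomial.X p * m a
  map_add' m m' := by
    ext1 a
    exact mul_add _ _ _
  map_smul' c m := by
    ext1 a
    simp only [Pi.smul_apply, RingHom.id_apply, mul_smul_comm]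

/-- The operator `v ⊗ f ↦ v s_i ⊗ s_i(f) + v ⊗ ∂_i f` on `V^{⊗ r} ⊗ P_r`. Under
`v ⊗ f ↦ v ⊗ f` it is right multiplication by `s_i` on the induced tensor space. -/
noncomputable def sAct (i : Fin (r - 1)) : Module.End K (PolyTensor K n r) where
  toFun m b := MvPolynomial.rename (Equiv.swap (lo i) (hi i))
    (m (b ∘ Equiv.swap (lo i) (hi i))) + divDiff i (m b)
  map_add' m m' := by
    ext1 b
    simp only [Pi.add_apply, map_add]
    abel
  map_smul' c m := by
    ext1 b
    simp only [Pi.smul_apply, map_smul, RingHom.id_apply, smul_add]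

variable {K n r}

lemma xAct_apply (p : Fin r) (m : PolyTensor K n r) (a : Idx n r) :
    xAct K n r p m a = MvPolynomial.X p * m a := rfl

lemma sAct_apply (i : Fin (r - 1)) (m : PolyTensor K n r) (b : Idx n r) :
    sAct K n r i m b = MvPolynomial.rename (Equiv.swap (lo i) (hi i))
      (m (b ∘ Equiv.swap (lo i) (hi i))) + divDiff i (m b) := rfl

lemma comp_swap_eq_iff (i : Fin (r - 1)) (a b : Idx n r) :
    b ∘ Equiv.swap (lo i) (hi i) = a ↔ b = a ∘ Equiv.swap (lo i) (hi i) := by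
  constructor
  · rintro rfl
    ext t
    simp
  · rintro rfl
    ext t
    simp

lemma sAct_single_one (i : Fin (r - 1)) (a : Idx n r) :
    sAct K n r i (Pi.single a 1) = Pi.single (a ∘ Equiv.swap (lo i) (hi i)) 1 := by
  ext1 b
  rw [sAct_apply]
  simp only [Pi.single_apply, comp_swap_eq_iff]
  have h : divDiff (K := K) i (if b = a then 1 else 0) = 0 := by
    split_ifs
    · exact divDiff_one i
    · exact map_zero _
  rw [h, add_zero]
  split_ifs <;> simp

lemma xAct_comm (p q : Fin r) : xAct K n r p * xAct K n r q = xAct K n r q * xAct K n r p := by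
  refine LinearMap.ext fun m => funext fun a => ?_
  simp only [Module.End.mul_apply, xAct_apply]
  ring

lemma sAct_xAct_lo (i : Fin (r - 1)) : sAct K n r i * xAct K n r (lo i) =
    xAct K n r (hi i) * sAct K n r i + 1 := by
  refine LinearMap.ext fun m => funext fun a => ?_
  simp only [Module.End.mul_apply, xAct_apply, sAct_apply, divDiff_mul, divDiff_X_lo, map_mul,
    MvPolynomial.rename_X, Equiv.swap_apply_left, LinearMap.add_apply, Pi.add_apply,
    Module.End.one_apply]
  ring

lemma sAct_xAct_hi (i : Fin (r - 1)) : sAct K n r i * xAct K n r (hi i) =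
    xAct K n r (lo i) * sAct K n r i - 1 := by
  refine LinearMap.ext fun m => funext fun a => ?_
  simp only [Module.End.mul_apply, xAct_apply, sAct_apply, divDiff_mul, divDiff_X_hi, map_mul,
    MvPolynomial.rename_X, Equiv.swap_apply_right, LinearMap.sub_apply, Pi.sub_apply,
    Module.End.one_apply]
  ring

lemma sAct_xAct_of_ne (i : Fin (r - 1)) (p : Fin r) (h₁ : p ≠ lo i) (h₂ : p ≠ hi i) :
    sAct K n r i * xAct K n r p = xAct K n r p * sAct K n r i := by
  refine LinearMap.ext fun m => funext fun a => ?_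
  simp only [Module.End.mul_apply, xAct_apply, sAct_apply, divDiff_mul,
    divDiff_X_of_ne i p h₁ h₂, map_mul,
    MvPolynomial.rename_X, Equiv.swap_apply_of_ne_of_ne h₁ h₂]
  ring

/-- An operator intertwining the variables up to a relabelling is determined by its values on
`V^{⊗ r} ⊗ 1`. This reduces the Coxeter relations for the operators `sAct` to those of
permutations. -/
lemma end_eq_zero_of_intertwines (D : Module.End K (PolyTensor K n r)) (g : Fin r → Fin r)
    (hX : ∀ p, D * xAct K n r p = xAct K n r (g p) * D) (h1 : ∀ a, D (Pi.single a 1) = 0) :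
    D = 0 := by
  have key : ∀ (a : Idx n r) (f : MvPolynomial (Fin r) K), D (Pi.single a f) = 0 := by
    intro a f
    induction f using MvPolynomial.induction_on with
    | C c =>
      have : (Pi.single a (MvPolynomial.C c) : PolyTensor K n r) = c • Pi.single a 1 := by
        rw [← Pi.single_smul, MvPolynomial.smul_eq_C_mul, mul_one]
      rw [this, map_smul, h1, smul_zero]
    | add f g hf hg => rw [Pi.single_add, map_add, hf, hg, add_zero]
    | mul_X f p hf =>
      have : (Pi.single a (f * MvPolynomial.X p) : PolyTensor K n r) =
          xAct K n r p (Pi.single a f) := by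
        ext1 b
        rw [xAct_apply, Pi.single_apply, Pi.single_apply, mul_ite, mul_zero, mul_comm]
      rw [this, ← Module.End.mul_apply, hX, Module.End.mul_apply, hf, map_zero]
  refine LinearMap.ext fun m => ?_
  rw [← Finset.univ_sum_single m, map_sum, LinearMap.zero_apply]
  exact Finset.sum_eq_zero fun a _ => key a (m a)

set_option linter.unusedSimpArgs false in
lemma sAct_sq (i : Fin (r - 1)) : sAct K n r i * sAct K n r i = 1 := by
  rw [← sub_eq_zero]
  refine end_eq_zero_of_intertwines _ id ?_ ?_
  · intro p
    rw [sub_mul, mul_sub, one_mul, mul_one, mul_assoc, id]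
    by_cases h₁ : p = lo i
    · rw [h₁, sAct_xAct_lo, mul_add, ← mul_assoc, sAct_xAct_hi]
      simp only [sub_mul, add_mul, mul_sub, mul_add, one_mul, mul_one, mul_assoc]
      abel
    · by_cases h₂ : p = hi i
      · rw [h₂, sAct_xAct_hi, mul_sub, ← mul_assoc, sAct_xAct_lo]
        simp only [sub_mul, add_mul, mul_sub, mul_add, one_mul, mul_one, mul_assoc]
        abel
      · rw [sAct_xAct_of_ne i p h₁ h₂, ← mul_assoc, sAct_xAct_of_ne i p h₁ h₂, mul_assoc]
  · intro a
    rw [LinearMap.sub_apply, Module.End.mul_apply, sAct_single_one, sAct_single_one, sub_eq_zero,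
      (comp_swap_eq_iff i _ _).2 rfl, Module.End.one_apply]

set_option linter.unusedSimpArgs false in
lemma sAct_comm (i j : Fin (r - 1)) (hij : (i : ℕ) + 1 < j) :
    sAct K n r i * sAct K n r j = sAct K n r j * sAct K n r i := by
  have n1 : lo i ≠ lo j := by simp only [lo, ne_eq, Fin.ext_iff]; omega
  have n2 : lo i ≠ hi j := by simp only [lo, hi, ne_eq, Fin.ext_iff]; omega
  have n3 : hi i ≠ lo j := by simp only [lo, hi, ne_eq, Fin.ext_iff]; omega
  have n4 : hi i ≠ hi j := by simp only [hi, ne_eq, Fin.ext_iff]; omega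
  rw [← sub_eq_zero]
  refine end_eq_zero_of_intertwines _
    (Equiv.swap (lo i) (hi i) ∘ Equiv.swap (lo j) (hi j)) ?_ ?_
  · intro p
    rw [sub_mul, mul_sub, Function.comp_apply, mul_assoc, mul_assoc, ← mul_assoc, ← mul_assoc]
    by_cases h₁ : p = lo i
    · rw [h₁, Equiv.swap_apply_of_ne_of_ne n1 n2, Equiv.swap_apply_left, mul_assoc, mul_assoc,
        sAct_xAct_of_ne j _ n1 n2, sAct_xAct_lo i, ← mul_assoc, sAct_xAct_lo i, mul_add,
        ← mul_assoc, sAct_xAct_of_ne j _ n3 n4]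
      simp only [sub_mul, add_mul, mul_sub, mul_add, one_mul, mul_one, mul_assoc]
      abel
    by_cases h₂ : p = hi i
    · rw [h₂, Equiv.swap_apply_of_ne_of_ne n3 n4, Equiv.swap_apply_right, mul_assoc, mul_assoc,
        sAct_xAct_of_ne j _ n3 n4, sAct_xAct_hi i, ← mul_assoc, sAct_xAct_hi i, mul_sub,
        ← mul_assoc, sAct_xAct_of_ne j _ n1 n2]
      simp only [sub_mul, add_mul, mul_sub, mul_add, one_mul, mul_one, mul_assoc]
      abel
    by_cases h₃ : p = lo j
    · rw [h₃, Equiv.swap_apply_left, Equiv.swap_apply_of_ne_of_ne n2.symm n4.symm,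
        mul_assoc, mul_assoc,
        sAct_xAct_of_ne i _ n1.symm n3.symm, sAct_xAct_lo j, mul_add, ← mul_assoc, ← mul_assoc,
        sAct_xAct_of_ne i _ n2.symm n4.symm, sAct_xAct_lo j]
      simp only [sub_mul, add_mul, mul_sub, mul_add, one_mul, mul_one, mul_assoc]
      abel
    by_cases h₄ : p = hi j
    · rw [h₄, Equiv.swap_apply_right, Equiv.swap_apply_of_ne_of_ne n1.symm n3.symm,
        mul_assoc, mul_assoc,
        sAct_xAct_of_ne i _ n2.symm n4.symm, sAct_xAct_hi j, mul_sub, ← mul_assoc, ← mul_assoc,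
        sAct_xAct_of_ne i _ n1.symm n3.symm, sAct_xAct_hi j]
      simp only [sub_mul, add_mul, mul_sub, mul_add, one_mul, mul_one, mul_assoc]
      abel
    rw [Equiv.swap_apply_of_ne_of_ne h₃ h₄, Equiv.swap_apply_of_ne_of_ne h₁ h₂, mul_assoc,
      mul_assoc, sAct_xAct_of_ne i _ h₁ h₂, sAct_xAct_of_ne j _ h₃ h₄, ← mul_assoc, ← mul_assoc,
      sAct_xAct_of_ne i _ h₁ h₂, sAct_xAct_of_ne j _ h₃ h₄]
    simp only [sub_mul, add_mul, mul_sub, mul_add, one_mul, mul_one, mul_assoc]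
  · intro a
    rw [LinearMap.sub_apply, Module.End.mul_apply, Module.End.mul_apply, sAct_single_one,
      sAct_single_one, sAct_single_one, sAct_single_one, sub_eq_zero]
    congr 1
    have hd : Equiv.swap (lo i) (hi i) * Equiv.swap (lo j) (hi j) =
        Equiv.swap (lo j) (hi j) * Equiv.swap (lo i) (hi i) := by
      refine Equiv.Perm.Disjoint.commute fun t => ?_
      by_cases h₁ : t = lo i
      · exact Or.inr (by rw [h₁, Equiv.swap_apply_of_ne_of_ne n1 n2])
      by_cases h₂ : t = hi i
      · exact Or.inr (by rw [h₂, Equiv.swap_apply_of_ne_of_ne n3 n4])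
      exact Or.inl (Equiv.swap_apply_of_ne_of_ne h₁ h₂)
    ext1 t
    exact congrArg a (DFunLike.congr_fun hd t).symm

set_option linter.unusedSimpArgs false in
lemma sAct_braid (i j : Fin (r - 1)) (hij : (i : ℕ) + 1 = j) :
    sAct K n r i * sAct K n r j * sAct K n r i = sAct K n r j * sAct K n r i * sAct K n r j := by
  have e : lo j = hi i := by simp only [lo, hi, Fin.ext_iff]; omega
  have n1 : lo i ≠ hi i := lo_ne_hi i
  have n2 : lo i ≠ hi j := by simp only [lo, hi, ne_eq, Fin.ext_iff]; omega
  have n3 : hi i ≠ hi j := by simp only [hi, ne_eq, Fin.ext_iff]; omega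
  have sqi := sAct_sq (K := K) (n := n) i
  have sqj := sAct_sq (K := K) (n := n) j
  have i1 := sAct_xAct_lo (K := K) (n := n) i
  have i2 := sAct_xAct_hi (K := K) (n := n) i
  have i3 := sAct_xAct_of_ne (K := K) (n := n) i (hi j) n2.symm n3.symm
  have j1 := sAct_xAct_of_ne (K := K) (n := n) j (lo i) (e ▸ n1) n2
  have j2 := sAct_xAct_lo (K := K) (n := n) j
  have j3 := sAct_xAct_hi (K := K) (n := n) j
  rw [e] at j2 j3
  rw [← sub_eq_zero]
  refine end_eq_zero_of_intertwines _ (Equiv.swap (lo i) (hi j)) ?_ ?_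
  · intro p
    have other : ∀ p, p ≠ lo i → p ≠ hi i → p ≠ hi j →
        (sAct K n r i * sAct K n r j * sAct K n r i -
          sAct K n r j * sAct K n r i * sAct K n r j) * xAct K n r p =
        xAct K n r p * (sAct K n r i * sAct K n r j * sAct K n r i -
          sAct K n r j * sAct K n r i * sAct K n r j) := by
      intro p h₁ h₂ h₃
      have a1 : Commute (xAct K n r p) (sAct K n r i) := (sAct_xAct_of_ne i p h₁ h₂).symm
      have a2 : Commute (xAct K n r p) (sAct K n r j) := (sAct_xAct_of_ne j p (e ▸ h₂) h₃).symm
      exact (((a1.mul_right a2).mul_right a1).sub_right ((a2.mul_right a1).mul_right a2)).symm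
    by_cases h₁ : p = lo i
    · rw [h₁, Equiv.swap_apply_left]
      generalize sAct K n r i = s at *
      generalize sAct K n r j = t at *
      have l1 : s * t * s * xAct K n r (lo i) = xAct K n r (hi j) * (s * t * s) + 1 + s * t := by
        rw [mul_assoc, i1, mul_add, mul_one, mul_assoc s t, ← mul_assoc t, j2, add_mul, mul_add,
          one_mul, sqi, mul_assoc, ← mul_assoc s, i3]
        simp only [sub_mul, add_mul, mul_sub, mul_add, one_mul, mul_one, mul_assoc]
      have l2 : t * s * t * xAct K n r (lo i) = xAct K n r (hi j) * (t * s * t) + 1 + s * t := by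
        rw [mul_assoc, j1, ← mul_assoc, mul_assoc t s, i1, mul_add, mul_one, ← mul_assoc, j2,
          add_mul, add_mul, add_mul, sqj]
        simp only [sub_mul, add_mul, mul_sub, mul_add, one_mul, mul_one, mul_assoc]
        abel
      rw [sub_mul, l1, l2]
      simp only [sub_mul, add_mul, mul_sub, mul_add, one_mul, mul_one, mul_assoc]
      abel
    by_cases h₃ : p = hi j
    · rw [h₃, Equiv.swap_apply_right]
      generalize sAct K n r i = s at *
      generalize sAct K n r j = t at *
      have l1 : s * t * s * xAct K n r (hi j) = xAct K n r (lo i) * (s * t * s) - 1 - t * s := by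
        rw [mul_assoc, i3, ← mul_assoc, mul_assoc s t, j3, mul_sub, mul_one, ← mul_assoc, i2,
          sub_mul, sub_mul, sub_mul, sqi]
        simp only [sub_mul, add_mul, mul_sub, mul_add, one_mul, mul_one, mul_assoc]
        abel
      have l2 : t * s * t * xAct K n r (hi j) = xAct K n r (lo i) * (t * s * t) - 1 - t * s := by
        rw [mul_assoc, j3, mul_sub, mul_one, mul_assoc t s, ← mul_assoc s, i2, sub_mul, mul_sub,
          one_mul, sqj, mul_assoc, ← mul_assoc t, j1]
        simp only [sub_mul, add_mul, mul_sub, mul_add, one_mul, mul_one, mul_assoc]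
      rw [sub_mul, l1, l2]
      simp only [sub_mul, add_mul, mul_sub, mul_add, one_mul, mul_one, mul_assoc]
      abel
    by_cases h₂ : p = hi i
    · rw [h₂, Equiv.swap_apply_of_ne_of_ne n1.symm n3]
      generalize sAct K n r i = s at *
      generalize sAct K n r j = t at *
      have l1 : s * t * s * xAct K n r (hi i) =
          xAct K n r (hi i) * (s * t * s) + t * s - s * t := by
        rw [mul_assoc, i2, mul_sub, mul_one, mul_assoc s t, ← mul_assoc t, j1, mul_assoc,
          ← mul_assoc s, i1]
        simp only [sub_mul, add_mul, mul_sub, mul_add, one_mul, mul_one, mul_assoc]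
      have l2 : t * s * t * xAct K n r (hi i) =
          xAct K n r (hi i) * (t * s * t) + t * s - s * t := by
        rw [mul_assoc, j2, mul_add, mul_one, mul_assoc t s, ← mul_assoc s, i3, mul_assoc,
          ← mul_assoc t, j3]
        simp only [sub_mul, add_mul, mul_sub, mul_add, one_mul, mul_one, mul_assoc]
        abel
      rw [sub_mul, l1, l2]
      simp only [sub_mul, add_mul, mul_sub, mul_add, one_mul, mul_one, mul_assoc]
      abel
    rw [Equiv.swap_apply_of_ne_of_ne h₁ h₃]
    exact other p h₁ h₂ h₃
  · intro a
    simp only [LinearMap.sub_apply, Module.End.mul_apply, sAct_single_one, sub_eq_zero]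
    congr 1
    have hb : Equiv.swap (lo i) (hi i) * Equiv.swap (lo j) (hi j) * Equiv.swap (lo i) (hi i) =
        Equiv.swap (lo j) (hi j) * Equiv.swap (lo i) (hi i) * Equiv.swap (lo j) (hi j) := by
      have h₁ := Equiv.swap_mul_swap_mul_swap n3.symm n2.symm
      have h₂ := Equiv.swap_mul_swap_mul_swap n1 n2
      rw [Equiv.swap_comm (hi i) (lo i), Equiv.swap_comm (hi j) (hi i)] at h₁
      rw [e, h₁, h₂, Equiv.swap_comm]
    ext1 t
    exact congrArg a (DFunLike.congr_fun hb t)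

variable (K n r) in
/-- The operators by which the generators of `AH_r` act on the right of `V^{⊗ r} ⊗ P_r`. -/
noncomputable def genAct : HeckeGen r → (Module.End K (PolyTensor K n r))ᵐᵒᵖ
  | .x p => MulOpposite.op (xAct K n r p)
  | .s i => MulOpposite.op (sAct K n r i)

lemma lift_genAct_rel {y z : FreeAlgebra K (HeckeGen r)} (h : HeckeRel K r y z) :
    FreeAlgebra.lift K (genAct K n r) y = FreeAlgebra.lift K (genAct K n r) z := by
  induction h with
  | xx p q =>
    simp only [map_mul, FreeAlgebra.lift_ι_apply, genAct, ← MulOpposite.op_mul]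
    exact congrArg MulOpposite.op (xAct_comm q p)
  | sq i =>
    simp only [map_mul, map_one, FreeAlgebra.lift_ι_apply, genAct, ← MulOpposite.op_mul]
    exact congrArg MulOpposite.op (sAct_sq i)
  | braid i j h =>
    simp only [map_mul, FreeAlgebra.lift_ι_apply, genAct, ← MulOpposite.op_mul, ← mul_assoc]
    exact congrArg MulOpposite.op (sAct_braid i j h)
  | comm i j h =>
    simp only [map_mul, FreeAlgebra.lift_ι_apply, genAct, ← MulOpposite.op_mul]
    exact congrArg MulOpposite.op (sAct_comm i j h).symm
  | sx i =>
    simp only [map_mul, map_add, map_one, FreeAlgebra.lift_ι_apply, genAct, ← MulOpposite.op_mul,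
      sAct_xAct_hi, MulOpposite.op_sub, MulOpposite.op_one, sub_add_cancel]
  | xs i =>
    simp only [map_mul, map_add, map_one, FreeAlgebra.lift_ι_apply, genAct, ← MulOpposite.op_mul,
      sAct_xAct_lo, MulOpposite.op_add, MulOpposite.op_one]
  | xs_comm p i h₁ h₂ =>
    simp only [map_mul, FreeAlgebra.lift_ι_apply, genAct, ← MulOpposite.op_mul]
    exact congrArg MulOpposite.op (sAct_xAct_of_ne i p h₁ h₂)

variable (K n r) in
/-- The right action of `AH_r` on `V^{⊗ r} ⊗ P_r`, as a homomorphism to the opposite of the algebra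
of operators. -/
noncomputable def rightAct : AH K r →ₐ[K] (Module.End K (PolyTensor K n r))ᵐᵒᵖ :=
  RingQuot.liftAlgHom K ⟨FreeAlgebra.lift K (genAct K n r), fun _ _ h => lift_genAct_rel h⟩

lemma rightAct_mk (y : FreeAlgebra K (HeckeGen r)) :
    rightAct K n r (RingQuot.mkAlgHom K (HeckeRel K r) y) =
      FreeAlgebra.lift K (genAct K n r) y :=
  RingQuot.liftAlgHom_mkAlgHom_apply K _ _ y

lemma rightAct_x (p : Fin r) :
    rightAct K n r (AH.x K p) = MulOpposite.op (xAct K n r p) :=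
  (rightAct_mk _).trans (FreeAlgebra.lift_ι_apply _ _)

lemma rightAct_s (i : Fin (r - 1)) :
    rightAct K n r (AH.s K i) = MulOpposite.op (sAct K n r i) :=
  (rightAct_mk _).trans (FreeAlgebra.lift_ι_apply _ _)

lemma rightAct_poly (f : MvPolynomial (Fin r) K) (m : PolyTensor K n r) :
    (rightAct K n r (AH.poly f)).unop m = f • m := by
  induction f using MvPolynomial.induction_on generalizing m with
  | C c =>
    have h : AH.poly (MvPolynomial.C c) = algebraMap K (AH K r) c := AH.poly.commutes c
    rw [h, AlgHom.commutes]
    ext1 a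
    simp [MvPolynomial.smul_eq_C_mul]
  | add f g hf hg =>
    rw [map_add, map_add, MulOpposite.unop_add, LinearMap.add_apply, hf, hg, add_smul]
  | mul_X f p hf =>
    rw [map_mul, map_mul, MulOpposite.unop_mul, Module.End.mul_apply, hf, AH.poly_X, rightAct_x,
      mul_comm, mul_smul]
    rfl

end RightAction

/-! ### The induced tensor space as `V^{⊗ r} ⊗ P_r` -/

section Basis

variable {K : Type*} [Field K] {n r : ℕ}

variable (K n r) in
/-- The map `V^{⊗ r} ⊗ AH_r → V^{⊗ r} ⊗ P_r`, `v ⊗ h ↦ (v ⊗ 1) h`. -/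
noncomputable def freeToPoly : FreeTensor K n r →ₗ[K] PolyTensor K n r where
  toFun m := ∑ a, (rightAct K n r (m a)).unop (Pi.single a 1)
  map_add' m m' := by
    simp only [Pi.add_apply, map_add, MulOpposite.unop_add, LinearMap.add_apply,
      Finset.sum_add_distrib]
  map_smul' c m := by
    simp only [Pi.smul_apply, map_smul, MulOpposite.unop_smul, LinearMap.smul_apply,
      Finset.smul_sum, RingHom.id_apply]

lemma freeToPoly_apply (m : FreeTensor K n r) : freeToPoly K n r m =
    ∑ a, (rightAct K n r (m a)).unop (Pi.single a 1) := rfl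

lemma freeToPoly_single (a : Idx n r) (h : AH K r) :
    freeToPoly K n r (Pi.single a h) = (rightAct K n r h).unop (Pi.single a 1) := by
  rw [freeToPoly_apply, Finset.sum_eq_single a]
  · rw [Pi.single_eq_same]
  · intro b _ hb
    rw [Pi.single_eq_of_ne hb, map_zero, MulOpposite.unop_zero, LinearMap.zero_apply]
  · exact fun h => absurd (Finset.mem_univ a) h

lemma freeToPoly_smul (h : (AH K r)ᵐᵒᵖ) (m : FreeTensor K n r) :
    freeToPoly K n r (h • m) = (rightAct K n r h.unop).unop (freeToPoly K n r m) := by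
  rw [freeToPoly_apply, freeToPoly_apply, map_sum]
  refine Finset.sum_congr rfl fun a _ => ?_
  rw [Pi.smul_apply, MulOpposite.smul_eq_mul_unop, map_mul, MulOpposite.unop_mul,
    Module.End.mul_apply]

lemma freeToPoly_poly (m : PolyTensor K n r) : freeToPoly K n r (fun a => AH.poly (m a)) = m := by
  rw [freeToPoly_apply]
  simp only [rightAct_poly]
  conv_rhs => rw [← Finset.univ_sum_single m]
  refine Finset.sum_congr rfl fun a _ => ?_
  rw [← Pi.single_smul, smul_eq_mul, mul_one]

lemma freeToPoly_relSub {m : FreeTensor K n r} (hm : m ∈ relSub K n r) :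
    freeToPoly K n r m = 0 := by
  unfold relSub at hm
  induction hm using Submodule.span_induction with
  | mem m hm =>
    obtain ⟨a, i, h, rfl⟩ := hm
    rw [map_sub, freeToPoly_single, freeToPoly_single, map_mul, MulOpposite.unop_mul,
      Module.End.mul_apply, rightAct_s, MulOpposite.unop_op, sAct_single_one, sub_self]
  | zero => exact map_zero _
  | add a b _ _ ha hb => rw [map_add, ha, hb, add_zero]
  | smul c a _ ha => rw [freeToPoly_smul, ha, map_zero]

variable (K n r) in
/-- The map from the induced tensor space to `V^{⊗ r} ⊗ P_r`, `v ⊗ h ↦ (v ⊗ 1) h`. -/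
noncomputable def indToPoly : IndTensor K n r →ₗ[K] PolyTensor K n r :=
  ((relSub K n r).restrictScalars K).liftQ (freeToPoly K n r)
      (fun _ hm => LinearMap.mem_ker.2 (freeToPoly_relSub hm)) ∘ₗ
    (Submodule.Quotient.restrictScalarsEquiv K (relSub K n r)).symm.toLinearMap

lemma indToPoly_mkQ (m : FreeTensor K n r) :
    indToPoly K n r ((relSub K n r).mkQ m) = freeToPoly K n r m := rfl

lemma indToPoly_smul (h : (AH K r)ᵐᵒᵖ) (m : IndTensor K n r) :
    indToPoly K n r (h • m) = (rightAct K n r h.unop).unop (indToPoly K n r m) := by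
  obtain ⟨m, rfl⟩ := (relSub K n r).mkQ_surjective m
  rw [← map_smul, indToPoly_mkQ, indToPoly_mkQ, freeToPoly_smul]

lemma indToPoly_polyToInd (m : PolyTensor K n r) : indToPoly K n r (polyToInd m) = m := by
  rw [polyToInd, indToPoly_mkQ, freeToPoly_poly]

lemma polyToInd_add (m m' : PolyTensor K n r) :
    polyToInd (m + m') = polyToInd m + polyToInd m' := by
  simp only [polyToInd, ← map_add]
  congr 1
  ext1 a
  simp

lemma polyToInd_smul (f : MvPolynomial (Fin r) K) (m : PolyTensor K n r) :
    polyToInd (f • m) = MulOpposite.op (AH.poly f) • polyToInd m := by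
  simp only [polyToInd, ← map_smul]
  congr 1
  ext1 a
  rw [Pi.smul_apply, Pi.smul_apply, smul_eq_mul, MulOpposite.smul_eq_mul_unop,
    MulOpposite.unop_op, mul_comm, map_mul]

lemma polyToInd_C_smul (c : K) (m : PolyTensor K n r) :
    polyToInd (c • m) = c • polyToInd m := by
  simp only [polyToInd, ← LinearMap.map_smul_of_tower]
  congr 1
  ext1 a
  simp

lemma mkQ_single_s_mul (a : Idx n r) (i : Fin (r - 1)) (h : AH K r) :
    (relSub K n r).mkQ (Pi.single a (AH.s K i * h)) =
      (relSub K n r).mkQ (Pi.single (a ∘ Equiv.swap (lo i) (hi i)) h) := by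
  symm
  rw [← sub_eq_zero, ← map_sub, Submodule.mkQ_apply, Submodule.Quotient.mk_eq_zero]
  exact Submodule.subset_span ⟨a, i, h, rfl⟩

lemma mkQ_single_perm_mul (a : Idx n r) (w : List (Fin (r - 1))) (f : MvPolynomial (Fin r) K) :
    ∃ b, (relSub K n r).mkQ (Pi.single a (AH.perm K w * AH.poly f)) =
      polyToInd (Pi.single b f) := by
  induction w generalizing a with
  | nil =>
    refine ⟨a, ?_⟩
    rw [polyToInd]
    congr 1
    ext1 b
    simp only [AH.perm, List.map_nil, List.prod_nil, one_mul, Pi.single_apply]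
    split_ifs <;> simp
  | cons i w ih =>
    obtain ⟨b, hb⟩ := ih (a ∘ Equiv.swap (lo i) (hi i))
    refine ⟨b, ?_⟩
    rw [← hb, ← mkQ_single_s_mul]
    simp [AH.perm, mul_assoc]

lemma AH.filt_exhaustive (h : AH K r) : ∃ d, h ∈ AH.filt K r d := by
  have key : ∀ (y : FreeAlgebra K (HeckeGen r)) (h : AH K r), (∃ d, h ∈ AH.filt K r d) →
      ∃ d, (show AH K r from RingQuot.mkAlgHom K (HeckeRel K r) y) * h ∈ AH.filt K r d := by
    intro y
    induction y using FreeAlgebra.induction with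
    | grade0 c =>
      rintro h ⟨d, hd⟩
      refine ⟨d, ?_⟩
      rw [AlgHom.commutes]
      change algebraMap K (AH K r) c * h ∈ _
      rw [← Algebra.smul_def]
      exact Submodule.smul_mem _ c hd
    | grade1 g =>
      rintro h ⟨d, hd⟩
      cases g with
      | x p => exact ⟨d + 1, AH.x_mul_mem p hd⟩
      | s i => exact ⟨d, AH.s_mul_mem i hd⟩
    | mul y z hy hz =>
      intro h hh
      rw [map_mul]
      obtain ⟨d, hd⟩ := hy _ (hz h hh)
      exact ⟨d, by rw [← mul_assoc] at hd; exact hd⟩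
    | add y z hy hz =>
      intro h hh
      obtain ⟨d, hd⟩ := hy h hh
      obtain ⟨e, he⟩ := hz h hh
      refine ⟨max d e, ?_⟩
      rw [map_add]
      have := Submodule.add_mem _ (AH.filt_mono (le_max_left d e) hd)
        (AH.filt_mono (le_max_right d e) he)
      rw [← add_mul] at this
      exact this
  obtain ⟨y, hy⟩ := RingQuot.mkAlgHom_surjective K (HeckeRel K r) h
  obtain ⟨d, hd⟩ := key y 1 ⟨0, Submodule.subset_span ⟨[], 1, by simp, by simp [AH.perm]⟩⟩
  refine ⟨d, ?_⟩
  rw [hy, mul_one] at hd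
  exact hd

variable (K n r) in
/-- The elements of `V^{⊗ r} ⊗ P_r` of degree `< d`. -/
noncomputable def polyLT (d : ℕ) : Submodule K (PolyTensor K n r) :=
  Submodule.pi Set.univ fun _ => degLT K (Fin r) d

lemma mem_polyLT {d : ℕ} {m : PolyTensor K n r} :
    m ∈ polyLT K n r d ↔ ∀ a, m a ∈ degLT K (Fin r) d := by
  simp [polyLT, Submodule.mem_pi]

variable (K n r) in
/-- The map `V^{⊗ r} ⊗ P_r → V^{⊗ r} ⊗_{K S_r} AH_r` as a linear map. -/
noncomputable def polyToIndLin : PolyTensor K n r →ₗ[K] IndTensor K n r where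
  toFun := polyToInd
  map_add' := polyToInd_add
  map_smul' := polyToInd_C_smul

lemma polyToIndLin_apply (m : PolyTensor K n r) : polyToIndLin K n r m = polyToInd m := rfl

/-- The filtration of the induced tensor space is the degree filtration of `V^{⊗ r} ⊗ P_r`. -/
lemma indFilt_eq_map (d : ℕ) :
    indFilt K n r d = (polyLT K n r (d + 1)).map (polyToIndLin K n r) := by
  refine le_antisymm ?_ ?_
  · rintro _ ⟨m, hm, rfl⟩
    have hm := (mem_freeFilt d m).1 hm
    rw [← Finset.univ_sum_single m, map_sum]
    refine Submodule.sum_mem _ fun a _ => ?_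
    suffices h : ∀ h ∈ AH.filt K r d, (relSub K n r).mkQ (Pi.single a h) ∈
      (polyLT K n r (d + 1)).map (polyToIndLin K n r) from h _ (hm a)
    intro h hh
    unfold AH.filt at hh
    induction hh using Submodule.span_induction with
    | mem h hh =>
      obtain ⟨w, f, hf, rfl⟩ := hh
      obtain ⟨b, hb⟩ := mkQ_single_perm_mul (n := n) a w f
      refine ⟨Pi.single b f, mem_polyLT.2 fun c => ?_, hb.symm⟩
      rw [Pi.single_apply]
      split_ifs
      · exact mem_degLT_succ.2 hf
      · exact Submodule.zero_mem _
    | zero =>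
      rw [Pi.single_zero, map_zero]
      exact Submodule.zero_mem _
    | add h h' _ _ ih ih' =>
      rw [Pi.single_add, map_add]
      exact Submodule.add_mem _ ih ih'
    | smul c h _ ih =>
      rw [Pi.single_smul, LinearMap.map_smul_of_tower]
      exact Submodule.smul_mem _ c ih
  · rintro _ ⟨m, hm, rfl⟩
    refine ⟨fun a => AH.poly (m a), (mem_freeFilt d _).2 fun a => ?_, rfl⟩
    exact Submodule.subset_span ⟨[], m a, mem_degLT_succ.1 (mem_polyLT.1 hm a), by simp [AH.perm]⟩

lemma polyToInd_surjective : Function.Surjective (polyToInd (K := K) (n := n) (r := r)) := by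
  intro m
  obtain ⟨m, rfl⟩ := (relSub K n r).mkQ_surjective m
  choose d hd using fun a => AH.filt_exhaustive (m a)
  have hm : (relSub K n r).mkQ m ∈ indFilt K n r (Finset.univ.sup d) :=
    ⟨m, (mem_freeFilt _ _).2 fun a => AH.filt_mono (Finset.le_sup (Finset.mem_univ a)) (hd a), rfl⟩
  rw [indFilt_eq_map] at hm
  obtain ⟨m', _, h⟩ := hm
  exact ⟨m', h⟩

lemma polyToInd_indToPoly (m : IndTensor K n r) : polyToInd (indToPoly K n r m) = m := by
  obtain ⟨m, rfl⟩ := polyToInd_surjective m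
  rw [indToPoly_polyToInd]

lemma polyToInd_mem_indFilt {d : ℕ} {m : PolyTensor K n r} :
    polyToInd m ∈ indFilt K n r d ↔ m ∈ polyLT K n r (d + 1) := by
  rw [indFilt_eq_map]
  constructor
  · rintro ⟨m', hm', h⟩
    have := congrArg (indToPoly K n r) h
    rw [polyToIndLin_apply, indToPoly_polyToInd, indToPoly_polyToInd] at this
    exact this ▸ hm'
  · exact fun h => ⟨m, h, rfl⟩

lemma polyToInd_mem_prevStep {d : ℕ} {m : PolyTensor K n r} :
    polyToInd m ∈ prevStep (indFilt K n r) d ↔ m ∈ polyLT K n r d := by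
  cases d with
  | zero =>
    rw [mem_polyLT, degLT_zero]
    change polyToInd m ∈ (⊥ : Submodule K (IndTensor K n r)) ↔ _
    rw [Submodule.mem_bot]
    constructor
    · intro h a
      have := congrArg (indToPoly K n r) h
      rw [indToPoly_polyToInd, map_zero] at this
      rw [this]
      exact Submodule.zero_mem _
    · intro h
      have : m = 0 := funext fun a => (Submodule.mem_bot K).1 (h a)
      rw [this]
      exact map_zero (polyToIndLin K n r)
  | succ d => exact polyToInd_mem_indFilt

end Basis

/-! ### Endomorphisms of the induced tensor space as matrices of polynomials -/

section Symbols

variable {K : Type*} [Field K] {n r : ℕ}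

variable (K n r) in
/-- Matrices over `P_r` indexed by the basis of `V^{⊗ r}`: the endomorphisms of the `P_r`-module
`V^{⊗ r} ⊗ P_r`, in coordinates. -/
abbrev PolyMat : Type _ := Matrix (Idx n r) (Idx n r) (MvPolynomial (Fin r) K)

variable (K n r) in
/-- An endomorphism of the induced tensor space, as a `P_r`-linear endomorphism of
`V^{⊗ r} ⊗ P_r`. -/
noncomputable def asEnd :
    AS K n r →ₐ[K] Module.End (MvPolynomial (Fin r) K) (PolyTensor K n r) where
  toFun f :=
    { toFun m := indToPoly K n r (f (polyToInd m))
      map_add' m m' := by rw [polyToInd_add, map_add, map_add]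
      map_smul' g m := by
        rw [polyToInd_smul, map_smul, indToPoly_smul, MulOpposite.unop_op, rightAct_poly,
          RingHom.id_apply] }
  map_one' := LinearMap.ext fun m => indToPoly_polyToInd m
  map_mul' f g := LinearMap.ext fun m => by
    change indToPoly K n r (f (g (polyToInd m))) =
      indToPoly K n r (f (polyToInd (indToPoly K n r (g (polyToInd m)))))
    rw [polyToInd_indToPoly]
  map_zero' := LinearMap.ext fun m => map_zero (indToPoly K n r)
  map_add' f g := LinearMap.ext fun m => map_add (indToPoly K n r) _ _
  commutes' c := LinearMap.ext fun m => by
    change indToPoly K n r (c • polyToInd m) = _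
    rw [map_smul, indToPoly_polyToInd]
    rfl

lemma asEnd_apply (f : AS K n r) (m : PolyTensor K n r) :
    asEnd K n r f m = indToPoly K n r (f (polyToInd m)) := rfl

lemma polyToInd_asEnd (f : AS K n r) (m : PolyTensor K n r) :
    polyToInd (asEnd K n r f m) = f (polyToInd m) := by
  rw [asEnd_apply, polyToInd_indToPoly]

variable (K n r) in
/-- The matrix over `P_r` of an endomorphism of the induced tensor space. -/
noncomputable def asMat : AS K n r →ₐ[K] PolyMat K n r :=
  (LinearMap.toMatrixAlgEquiv'.restrictScalars K).toAlgHom.comp (asEnd K n r)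

lemma asMat_apply (f : AS K n r) (b a : Idx n r) :
    asMat K n r f b a = asEnd K n r f (Pi.single a 1) b := by
  change LinearMap.toMatrixAlgEquiv' (asEnd K n r f) b a = _
  rw [LinearMap.toMatrixAlgEquiv'_apply]

lemma end_apply_eq_sum (φ : Module.End (MvPolynomial (Fin r) K) (PolyTensor K n r))
    (m : PolyTensor K n r) (b : Idx n r) : φ m b = ∑ a, φ (Pi.single a 1) b * m a := by
  conv_lhs => rw [← Finset.univ_sum_single m, map_sum, Finset.sum_apply]
  refine Finset.sum_congr rfl fun a _ => ?_
  have : (Pi.single a (m a) : PolyTensor K n r) = m a • Pi.single a 1 := by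
    rw [← Pi.single_smul, smul_eq_mul, mul_one]
  rw [this, map_smul, Pi.smul_apply, smul_eq_mul, mul_comm]

lemma asMat_injective : Function.Injective (asMat K n r) := by
  rw [injective_iff_map_eq_zero]
  intro f hf
  refine LinearMap.ext fun m => ?_
  obtain ⟨m, rfl⟩ := polyToInd_surjective m
  rw [← polyToInd_asEnd]
  have : asEnd K n r f m = 0 := by
    ext1 b
    rw [end_apply_eq_sum]
    refine Finset.sum_eq_zero fun a _ => ?_
    rw [← asMat_apply, hf, Matrix.zero_apply, zero_mul]
  rw [this]
  exact map_zero (polyToIndLin K n r)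

/-- `F_d AS(n,r)` consists of the endomorphisms whose matrix has entries of degree `≤ d`. -/
lemma mem_filtAS_iff {d : ℕ} {f : AS K n r} :
    f ∈ (filtAS K n r).F d ↔ ∀ b a, asMat K n r f b a ∈ degLT K (Fin r) (d + 1) := by
  rw [mem_filtAS]
  constructor
  · intro h b a
    have h1 : polyToInd (Pi.single a 1 : PolyTensor K n r) ∈ indFilt K n r 0 := by
      refine polyToInd_mem_indFilt.2 (mem_polyLT.2 fun c => ?_)
      rw [Pi.single_apply]
      split_ifs
      · exact mem_degLT_of_isHomogeneous (MvPolynomial.isHomogeneous_one _ _)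
      · exact Submodule.zero_mem _
    have h2 := h 0 _ h1
    rw [← polyToInd_asEnd, polyToInd_mem_indFilt] at h2
    rw [asMat_apply]
    exact mem_polyLT.1 h2 b
  · intro h e m hm
    obtain ⟨m, rfl⟩ := polyToInd_surjective m
    rw [polyToInd_mem_indFilt, mem_polyLT] at hm
    rw [← polyToInd_asEnd, polyToInd_mem_indFilt, mem_polyLT]
    intro b
    rw [end_apply_eq_sum]
    refine Submodule.sum_mem _ fun a _ => ?_
    rw [← asMat_apply]
    exact degLT_mono (by omega) (mul_mem_degLT (h b a) (hm a))

lemma mem_prevStep_filtAS_iff {d : ℕ} {f : AS K n r} :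
    f ∈ prevStep (filtAS K n r).F d ↔ ∀ b a, asMat K n r f b a ∈ degLT K (Fin r) d := by
  cases d with
  | zero =>
    rw [degLT_zero]
    change f ∈ (⊥ : Submodule K (AS K n r)) ↔ _
    rw [Submodule.mem_bot]
    constructor
    · rintro rfl b a
      rw [map_zero]
      exact Submodule.zero_mem _
    · intro h
      refine asMat_injective ?_
      rw [map_zero]
      ext1 b a
      exact (Submodule.mem_bot K).1 (h b a)
  | succ d => exact mem_filtAS_iff

lemma filtAS_exhaustive (f : AS K n r) : ∃ d, f ∈ (filtAS K n r).F d := by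
  choose d hd using fun (p : Idx n r × Idx n r) => exists_mem_degLT (asMat K n r f p.1 p.2)
  exact ⟨Finset.univ.sup d, mem_filtAS_iff.2 fun b a => degLT_mono
    (Nat.succ_le_succ (Finset.le_sup (Finset.mem_univ (b, a)))) (hd (b, a))⟩

/-! ### The symbol isomorphism -/

variable (K n r) in
/-- The homogeneous part of degree `d` of the matrix of an endomorphism. -/
noncomputable def topMat (d : ℕ) : AS K n r →ₗ[K] PolyMat K n r :=
  (MvPolynomial.homogeneousComponent d).mapMatrix ∘ₗ (asMat K n r).toLinearMap

lemma topMat_apply (d : ℕ) (f : AS K n r) (b a : Idx n r) :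
    topMat K n r d f b a = MvPolynomial.homogeneousComponent d (asMat K n r f b a) := rfl

lemma topMat_one : topMat K n r 0 1 = 1 := by
  ext1 b a
  rw [topMat_apply, map_one, Matrix.one_apply]
  split_ifs
  · exact MvPolynomial.homogeneousComponent_eq_self (MvPolynomial.isHomogeneous_one _ _)
  · exact map_zero _

lemma topMat_mul (d e : ℕ) (f g : AS K n r) (hf : f ∈ (filtAS K n r).F d)
    (hg : g ∈ (filtAS K n r).F e) :
    topMat K n r (d + e) (f * g) = topMat K n r d f * topMat K n r e g := by
  ext1 b a
  rw [topMat_apply, map_mul, Matrix.mul_apply, Matrix.mul_apply, map_sum]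
  exact Finset.sum_congr rfl fun c _ =>
    homogeneousComponent_mul (mem_filtAS_iff.1 hf b c) (mem_filtAS_iff.1 hg c a)

lemma topMat_prevStep (d : ℕ) (f : AS K n r) (hf : f ∈ prevStep (filtAS K n r).F d) :
    topMat K n r d f = 0 := by
  ext1 b a
  exact homogeneousComponent_of_mem_degLT (mem_prevStep_filtAS_iff.1 hf b a)

variable (K n r) in
/-- The homomorphism from `gr AS(n,r)` to matrices over `P_r` which sends the class in degree `d` of
an endomorphism to the homogeneous part of degree `d` of its matrix. -/
noncomputable def symbolMat : (filtAS K n r).Gr →ₐ[K] PolyMat K n r :=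
  (filtAS K n r).grLift (topMat K n r) topMat_one topMat_mul topMat_prevStep

lemma symbolMat_symb (d : ℕ) (f : AS K n r) (hf : f ∈ (filtAS K n r).F d) :
    symbolMat K n r ((filtAS K n r).symb d f hf) = topMat K n r d f :=
  AlgFiltration.grLift_symb ..

lemma symbolMat_injective : Function.Injective (symbolMat K n r) := by
  refine AlgFiltration.grLift_injective _ _ _ _ _ ?_ ?_
  · intro s f h d hd
    ext1 b a
    have h1 := congrArg (fun M : PolyMat K n r => MvPolynomial.homogeneousComponent d (M b a)) h
    simp only [Matrix.sum_apply, map_sum, topMat_apply, Matrix.zero_apply, map_zero] at h1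
    rw [Finset.sum_eq_single d] at h1
    · rwa [MvPolynomial.homogeneousComponent_eq_self
        (MvPolynomial.homogeneousComponent_isHomogeneous _ _)] at h1
    · intro e _ hed
      rw [MvPolynomial.homogeneousComponent_of_mem
        (MvPolynomial.homogeneousComponent_isHomogeneous _ _), if_neg (Ne.symm hed)]
    · exact fun h => absurd hd h
  · intro d f hf h
    refine mem_prevStep_filtAS_iff.2 fun b a => ?_
    refine mem_degLT_of_homogeneousComponent (mem_filtAS_iff.1 hf b a) ?_
    exact congrFun (congrFun h b) a

lemma polyToInd_sAct (i : Fin (r - 1)) (m : PolyTensor K n r) :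
    polyToInd (sAct K n r i m) = MulOpposite.op (AH.s K i) • polyToInd m := by
  conv_rhs => rw [← polyToInd_indToPoly (MulOpposite.op (AH.s K i) • polyToInd m)]
  rw [indToPoly_smul, MulOpposite.unop_op, rightAct_s, MulOpposite.unop_op, indToPoly_polyToInd]

lemma asEnd_sAct (f : AS K n r) (i : Fin (r - 1)) (m : PolyTensor K n r) :
    asEnd K n r f (sAct K n r i m) = sAct K n r i (asEnd K n r f m) := by
  rw [asEnd_apply, polyToInd_sAct, map_smul, indToPoly_smul, MulOpposite.unop_op, rightAct_s,
    MulOpposite.unop_op, asEnd_apply]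

/-- Up to terms of lower degree, the right action of `s_i` is the permutation action, so top-degree
parts are invariant under simple transpositions. -/
lemma topMat_swap (d : ℕ) (f : AS K n r) (hf : f ∈ (filtAS K n r).F d) (i : Fin (r - 1))
    (b a : Idx n r) :
    topMat K n r d f (b ∘ Equiv.swap (lo i) (hi i)) (a ∘ Equiv.swap (lo i) (hi i)) =
      MvPolynomial.rename (Equiv.swap (lo i) (hi i)) (topMat K n r d f b a) := by
  have hb : (b ∘ Equiv.swap (lo i) (hi i)) ∘ Equiv.swap (lo i) (hi i) = b :=
    (comp_swap_eq_iff i _ _).2 rfl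
  rw [topMat_apply, topMat_apply, asMat_apply, ← sAct_single_one, asEnd_sAct, sAct_apply, hb,
    map_add, ← asMat_apply, ← asMat_apply, homogeneousComponent_divDiff i (mem_filtAS_iff.1 hf _ _),
    add_zero, MvPolynomial.rename_homogeneousComponent]

/-- A matrix invariant under simple transpositions is invariant under the symmetric group. -/
lemma perm_invariant_of_swap (M : PolyMat K n r)
    (hM : ∀ (i : Fin (r - 1)) (b a : Idx n r),
      M (b ∘ Equiv.swap (lo i) (hi i)) (a ∘ Equiv.swap (lo i) (hi i)) =
        MvPolynomial.rename (Equiv.swap (lo i) (hi i)) (M b a))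
    (w : Equiv.Perm (Fin r)) (b a : Idx n r) :
    M (b ∘ w) (a ∘ w) = MvPolynomial.rename w.symm (M b a) := by
  have hw : w ∈ Submonoid.closure
      (Set.range fun i : Fin (r - 1) => Equiv.swap (lo i) (hi i)) := by
    cases r with
    | zero => exact Subsingleton.elim w 1 ▸ Submonoid.one_mem _
    | succ m =>
      have h : (fun i : Fin m => Equiv.swap i.castSucc i.succ) =
          fun i : Fin (m + 1 - 1) => Equiv.swap (lo i) (hi i) := rfl
      rw [← h, Equiv.Perm.mclosure_swap_castSucc_succ]
      exact Submonoid.mem_top w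
  induction hw using Submonoid.closure_induction generalizing b a with
  | mem w hw =>
    obtain ⟨i, rfl⟩ := hw
    exact hM i b a
  | one =>
    have : ⇑(1 : Equiv.Perm (Fin r)).symm = id := rfl
    rw [this, MvPolynomial.rename_id_apply]
    rfl
  | mul v w _ _ hv hw =>
    have e : ⇑(v * w).symm = w.symm ∘ v.symm := rfl
    rw [e, ← MvPolynomial.rename_rename, ← hv, ← hw]
    rfl

/-- An endomorphism of `V^{⊗ r} ⊗ P_r` commutes with the symmetric group if and only if its matrix
is invariant. -/
lemma mem_AS0_iff {φ : Module.End (MvPolynomial (Fin r) K) (PolyTensor K n r)} :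
    φ ∈ AS0 K n r ↔ ∀ (w : Equiv.Perm (Fin r)) (b a : Idx n r),
      φ (Pi.single (a ∘ w) 1) (b ∘ w) = MvPolynomial.rename w.symm (φ (Pi.single a 1) b) := by
  have e : ∀ (w : Equiv.Perm (Fin r)) (b : Idx n r), (b ∘ w) ∘ w.symm = b := by
    intro w b
    ext t
    simp
  have e' : ∀ (w : Equiv.Perm (Fin r)) (b : Idx n r), (b ∘ w.symm) ∘ w = b := by
    intro w b
    ext t
    simp
  constructor
  · intro h w b a
    have h1 : φ (permAct w (Pi.single a 1)) = permAct w (φ (Pi.single a 1)) := h w _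
    rw [permAct_single, map_one] at h1
    rw [h1, permAct, e]
  · intro h w m
    ext1 b
    have hs : ∀ a, φ (Pi.single a 1) b =
        MvPolynomial.rename w.symm (φ (Pi.single (a ∘ w.symm) 1) (b ∘ w.symm)) := by
      intro a
      rw [← h w, e', e']
    have h1 : permAct w (φ m) b =
        ∑ a, φ (Pi.single (a ∘ w) 1) b * MvPolynomial.rename w.symm (m a) := by
      rw [permAct, end_apply_eq_sum, map_sum]
      refine Finset.sum_congr rfl fun a _ => ?_
      rw [map_mul, hs, e]
    rw [h1, end_apply_eq_sum, ← Equiv.sum_comp (w.arrowCongr (Equiv.refl (Fin n))).symm]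
    refine Finset.sum_congr rfl fun a _ => ?_
    have : (w.arrowCongr (Equiv.refl (Fin n))).symm a = a ∘ w := by
      ext t
      simp [Equiv.arrowCongr]
    rw [this, permAct, e]

variable (K n r) in
/-- A matrix over `P_r` as an endomorphism of `V^{⊗ r} ⊗ P_r`. -/
noncomputable def matEnd :
    PolyMat K n r ≃ₐ[K] Module.End (MvPolynomial (Fin r) K) (PolyTensor K n r) :=
  Matrix.toLinAlgEquiv'.restrictScalars K

lemma matEnd_apply (M : PolyMat K n r) (m : PolyTensor K n r) (b : Idx n r) :
    matEnd K n r M m b = ∑ a, M b a * m a := rfl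

lemma matEnd_single (M : PolyMat K n r) (a b : Idx n r) :
    matEnd K n r M (Pi.single a 1) b = M b a := by
  rw [matEnd_apply, Finset.sum_eq_single a]
  · rw [Pi.single_eq_same, mul_one]
  · intro c _ hc
    rw [Pi.single_eq_of_ne hc, mul_zero]
  · exact fun h => absurd (Finset.mem_univ a) h

lemma matEnd_mem_AS0 {M : PolyMat K n r} : matEnd K n r M ∈ AS0 K n r ↔
    ∀ (w : Equiv.Perm (Fin r)) (b a : Idx n r),
      M (b ∘ w) (a ∘ w) = MvPolynomial.rename w.symm (M b a) := by
  rw [mem_AS0_iff]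
  simp only [matEnd_single]

lemma matEnd_symbolMat_mem (y : (filtAS K n r).Gr) :
    matEnd K n r (symbolMat K n r y) ∈ AS0 K n r := by
  obtain ⟨p, rfl⟩ := AlgFiltration.grMk_surjective _ y
  have h : symbolMat K n r ((filtAS K n r).grMk p) =
      ∑ d ∈ (p : Polynomial (AS K n r)).support,
        topMat K n r d ((p : Polynomial (AS K n r)).coeff d) := rfl
  rw [h, map_sum]
  exact Subalgebra.sum_mem _ fun d _ => matEnd_mem_AS0.2
    (perm_invariant_of_swap _ fun i b a => topMat_swap d _ (p.2 d) i b a)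

variable (K n r) in
/-- The symbol homomorphism `gr AS(n,r) → AS_0(n,r)`. -/
noncomputable def symbolHom : (filtAS K n r).Gr →ₐ[K] AS0 K n r :=
  ((matEnd K n r).toAlgHom.comp (symbolMat K n r)).codRestrict _ matEnd_symbolMat_mem

lemma coe_symbolHom (y : (filtAS K n r).Gr) :
    (symbolHom K n r y).1 = matEnd K n r (symbolMat K n r y) := rfl

lemma symbolHom_injective : Function.Injective (symbolHom K n r) := by
  intro y z h
  refine symbolMat_injective ((matEnd K n r).injective ?_)
  rw [← coe_symbolHom, ← coe_symbolHom, h]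

lemma isSymbolIso_of_eq_symbolHom (β : (filtAS K n r).Gr ≃ₐ[K] AS0 K n r)
    (hβ : ∀ y, β y = symbolHom K n r y) : IsSymbolIso β := by
  intro d f hf e m hm
  rw [hβ, coe_symbolHom, symbolMat_symb]
  constructor
  · intro b
    rw [matEnd_apply]
    exact MvPolynomial.IsHomogeneous.sum _ _ _ fun a _ =>
      (MvPolynomial.homogeneousComponent_isHomogeneous d _).mul (hm a)
  · rw [← polyToInd_asEnd]
    have hsub : polyToInd (asEnd K n r f m) - polyToInd (matEnd K n r (topMat K n r d f) m) =
        polyToInd (asEnd K n r f m - matEnd K n r (topMat K n r d f) m) :=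
      (map_sub (polyToIndLin K n r) _ _).symm
    rw [hsub, polyToInd_mem_prevStep, mem_polyLT]
    intro b
    rw [Pi.sub_apply, end_apply_eq_sum, matEnd_apply, ← Finset.sum_sub_distrib]
    refine Submodule.sum_mem _ fun a _ => ?_
    rw [← sub_mul, ← asMat_apply]
    exact mul_mem_degLT (sub_homogeneousComponent_mem_degLT (mem_filtAS_iff.1 hf b a))
      (mem_degLT_of_isHomogeneous (hm a))

end Symbols

/-! ### Generators of the algebra of invariant matrices -/

section Invariants

variable {K : Type*} [Field K] {n r : ℕ}

variable (K n r) in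
/-- The pure tensor `y_1 ⊗ ⋯ ⊗ y_r` in `gl_n[x]^{⊗ r} = End(V)^{⊗ r} ⊗ P_r`, in coordinates. It is
multiplicative in the tuple `y`. -/
noncomputable def pureTensor : (Fin r → Current K n) →* PolyMat K n r where
  toFun y := Matrix.of fun b a =>
    ∏ p, Polynomial.aeval (MvPolynomial.X p : MvPolynomial (Fin r) K) (y p (b p) (a p))
  map_one' := by
    ext1 b a
    rw [Matrix.one_apply, Matrix.of_apply]
    split_ifs with h
    · subst h
      simp
    · obtain ⟨p, hp⟩ := Function.ne_iff.1 h
      exact Finset.prod_eq_zero (Finset.mem_univ p) (by simp [Matrix.one_apply_ne hp])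
  map_mul' y z := by
    ext1 b a
    rw [Matrix.mul_apply]
    simp only [Matrix.of_apply, Pi.mul_apply, Matrix.mul_apply, map_sum, map_mul,
      ← Finset.prod_mul_distrib]
    rw [Finset.prod_univ_sum, Fintype.piFinset_univ]

lemma pureTensor_apply (y : Fin r → Current K n) (b a : Idx n r) : pureTensor K n r y b a =
    ∏ p, Polynomial.aeval (MvPolynomial.X p : MvPolynomial (Fin r) K) (y p (b p) (a p)) := rfl

variable (K n r) in
/-- The action of a permutation on `End(V)^{⊗ r} ⊗ P_r`, permuting the tensor factors and the
variables. -/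
noncomputable def permConj (w : Equiv.Perm (Fin r)) : PolyMat K n r →ₗ[K] PolyMat K n r where
  toFun M := Matrix.of fun b a => MvPolynomial.rename w (M (b ∘ w) (a ∘ w))
  map_add' M N := by
    ext1 b a
    simp
  map_smul' c M := by
    ext1 b a
    simp

lemma permConj_apply (w : Equiv.Perm (Fin r)) (M : PolyMat K n r) (b a : Idx n r) :
    permConj K n r w M b a = MvPolynomial.rename w (M (b ∘ w) (a ∘ w)) := rfl

lemma permConj_mul (w : Equiv.Perm (Fin r)) (M N : PolyMat K n r) :
    permConj K n r w (M * N) = permConj K n r w M * permConj K n r w N := by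
  ext1 b a
  rw [permConj_apply, Matrix.mul_apply, Matrix.mul_apply, map_sum,
    ← Equiv.sum_comp (w.arrowCongr (Equiv.refl (Fin n))).symm]
  refine Finset.sum_congr rfl fun c _ => ?_
  have : (w.arrowCongr (Equiv.refl (Fin n))).symm c = c ∘ w := by
    ext t
    simp [Equiv.arrowCongr]
  rw [this, map_mul]
  rfl

lemma permConj_permConj (v w : Equiv.Perm (Fin r)) (M : PolyMat K n r) :
    permConj K n r w (permConj K n r v M) = permConj K n r (w * v) M := by
  ext1 b a
  rw [permConj_apply, permConj_apply, MvPolynomial.rename_rename]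
  rfl

lemma permConj_pureTensor (w : Equiv.Perm (Fin r)) (y : Fin r → Current K n) :
    permConj K n r w (pureTensor K n r y) = pureTensor K n r (y ∘ w.symm) := by
  ext1 b a
  rw [permConj_apply, pureTensor_apply, pureTensor_apply, map_prod,
    ← Equiv.prod_comp w fun p => Polynomial.aeval (MvPolynomial.X p : MvPolynomial (Fin r) K)
      ((y ∘ w.symm) p (b p) (a p))]
  refine Finset.prod_congr rfl fun p _ => ?_
  have h : ∀ f : Polynomial K, MvPolynomial.rename w (Polynomial.aeval
      (MvPolynomial.X p : MvPolynomial (Fin r) K) f) =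
        Polynomial.aeval (MvPolynomial.X (w p) : MvPolynomial (Fin r) K) f := by
    intro f
    rw [← Polynomial.aeval_algHom_apply, MvPolynomial.rename_X]
  rw [h]
  simp

variable (K n r) in
/-- The sum of the images of a matrix under all permutations. -/
noncomputable def symmetrize : PolyMat K n r →ₗ[K] PolyMat K n r := ∑ w, permConj K n r w

lemma symmetrize_apply (M : PolyMat K n r) :
    symmetrize K n r M = ∑ w, permConj K n r w M := by
  rw [symmetrize, LinearMap.sum_apply]

lemma symmetrize_permConj (v : Equiv.Perm (Fin r)) (M : PolyMat K n r) :
    symmetrize K n r (permConj K n r v M) = symmetrize K n r M := by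
  rw [symmetrize_apply, symmetrize_apply]
  simp only [permConj_permConj]
  exact Equiv.sum_comp (Equiv.mulRight v) fun w => permConj K n r w M

lemma symmetrize_of_invariant {M : PolyMat K n r} (hM : ∀ w, permConj K n r w M = M) :
    symmetrize K n r M = (r.factorial : K) • M := by
  rw [symmetrize_apply, Finset.sum_congr rfl fun w _ => hM w, Finset.sum_const, Finset.card_univ,
    Fintype.card_perm, Fintype.card_fin, Nat.cast_smul_eq_nsmul]

lemma symmetrize_mul {N : PolyMat K n r} (hN : ∀ w, permConj K n r w N = N) (M : PolyMat K n r) :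
    symmetrize K n r (M * N) = symmetrize K n r M * N := by
  rw [symmetrize_apply, symmetrize_apply, Finset.sum_mul]
  exact Finset.sum_congr rfl fun w _ => by rw [permConj_mul, hN]

lemma pureTensor_mulSingle_apply (p : Fin r) (y : Current K n) (b a : Idx n r) :
    pureTensor K n r (Pi.mulSingle p y) b a =
      Polynomial.aeval (MvPolynomial.X p : MvPolynomial (Fin r) K) (y (b p) (a p)) *
        ∏ t ∈ Finset.univ.erase p, if b t = a t then 1 else 0 := by
  rw [pureTensor_apply, ← Finset.mul_prod_erase _ _ (Finset.mem_univ p), Pi.mulSingle_eq_same]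
  congr 1
  refine Finset.prod_congr rfl fun t ht => ?_
  rw [Pi.mulSingle_eq_of_ne (Finset.ne_of_mem_erase ht), Matrix.one_apply]
  split_ifs <;> simp

variable (r) in
/-- The element `∑ p, 1 ⊗ ⋯ ⊗ y ⊗ ⋯ ⊗ 1`, with `y` in position `p`, by which `y` acts on
`V^{⊗ r} ⊗ P_r`. -/
noncomputable def diagMat : Current K n →ₗ[K] PolyMat K n r where
  toFun y := ∑ p, pureTensor K n r (Pi.mulSingle p y)
  map_add' y z := by
    ext1 b a
    simp only [Matrix.sum_apply, Matrix.add_apply, pureTensor_mulSingle_apply, map_add, add_mul,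
      Finset.sum_add_distrib]
  map_smul' c y := by
    ext1 b a
    simp only [Matrix.sum_apply, Matrix.smul_apply, pureTensor_mulSingle_apply, map_smul,
      smul_mul_assoc, Finset.smul_sum, RingHom.id_apply]

lemma diagMat_apply (y : Current K n) :
    diagMat r y = ∑ p, pureTensor K n r (Pi.mulSingle p y) := rfl

lemma permConj_diagMat (w : Equiv.Perm (Fin r)) (y : Current K n) :
    permConj K n r w (diagMat r y) = diagMat r y := by
  rw [diagMat_apply, map_sum,
    ← Equiv.sum_comp w fun p => pureTensor K n r (Pi.mulSingle p y)]
  refine Finset.sum_congr rfl fun p _ => ?_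
  rw [permConj_pureTensor]
  congr 1
  ext1 t
  simp only [Function.comp_apply, Pi.mulSingle_apply, Equiv.symm_apply_eq]

/-- The inductive step multiplies by `diagMat r y`: this puts the new factor `y` in every position.
If the position is already occupied, the number of nontrivial factors does not grow; the terms with
`y` in a free position are permutations of each other, so they have the same symmetrization, and in
characteristic `0` their number can be cancelled. -/
lemma symmetrize_pureTensor_mem [CharZero K] (B : Subalgebra K (PolyMat K n r))
    (hB : ∀ y, diagMat r y ∈ B) (s : Finset (Fin r)) (y : Fin r → Current K n)
    (hy : ∀ p ∉ s, y p = 1) : symmetrize K n r (pureTensor K n r y) ∈ B := by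
  induction s using Finset.induction_on generalizing y with
  | empty =>
    have : y = 1 := funext fun p => hy p (Finset.notMem_empty p)
    rw [this, map_one, symmetrize_of_invariant fun w => by
      simpa using permConj_pureTensor w (1 : Fin r → Current K n)]
    exact B.smul_mem B.one_mem _
  | insert q s hq ih =>
    have hy' : ∀ p ∉ s, Function.update y q 1 p = 1 := by
      intro p hp
      rcases eq_or_ne p q with rfl | h
      · rw [Function.update_self]
      · rw [Function.update_of_ne h, hy p (by simp [h, hp])]
    have hsplit : symmetrize K n r (pureTensor K n r (Function.update y q 1)) * diagMat r (y q) =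
        ∑ p, symmetrize K n r
          (pureTensor K n r (Function.update y q 1 * Pi.mulSingle p (y q))) := by
      rw [← symmetrize_mul fun w => permConj_diagMat w (y q), diagMat_apply, Finset.mul_sum,
        map_sum]
      simp only [map_mul]
    have hocc : ∀ p ∈ s, symmetrize K n r
        (pureTensor K n r (Function.update y q 1 * Pi.mulSingle p (y q))) ∈ B := by
      intro p hp
      refine ih _ fun t ht => ?_
      rw [Pi.mul_apply, hy' t ht, one_mul, Pi.mulSingle_eq_of_ne]
      rintro rfl
      exact ht hp
    have hfree : ∀ p ∈ sᶜ, symmetrize K n r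
        (pureTensor K n r (Function.update y q 1 * Pi.mulSingle p (y q))) =
          symmetrize K n r (pureTensor K n r y) := by
      intro p hp
      rw [Finset.mem_compl] at hp
      rw [← symmetrize_permConj (Equiv.swap p q) (pureTensor K n r y), permConj_pureTensor]
      congr 2
      ext1 t
      rw [Pi.mul_apply, Function.comp_apply, Equiv.symm_swap]
      by_cases htp : t = p
      · rw [htp, hy' p hp, one_mul, Pi.mulSingle_eq_same, Equiv.swap_apply_left]
      · rw [Pi.mulSingle_eq_of_ne htp, mul_one]
        by_cases htq : t = q
        · rw [htq, Function.update_self, Equiv.swap_apply_right,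
            hy p (by rw [Finset.mem_insert]; rintro (h | h); exacts [htp (htq.trans h.symm), hp h])]
        · rw [Function.update_of_ne htq, Equiv.swap_apply_of_ne_of_ne htp htq]
    rw [← Finset.sum_add_sum_compl s, Finset.sum_congr rfl hfree, Finset.sum_const] at hsplit
    have hcard : ((sᶜ.card : ℕ) : K) ≠ 0 := by
      rw [Nat.cast_ne_zero]
      exact Finset.card_ne_zero_of_mem (Finset.mem_compl.2 hq)
    have hmem : ((sᶜ.card : ℕ) : K) • symmetrize K n r (pureTensor K n r y) ∈ B := by
      rw [Nat.cast_smul_eq_nsmul, eq_sub_of_add_eq' hsplit.symm]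
      exact B.sub_mem (B.mul_mem (ih _ hy') (hB _)) (B.sum_mem hocc)
    have := B.smul_mem hmem ((sᶜ.card : ℕ) : K)⁻¹
    rwa [smul_smul, inv_mul_cancel₀ hcard, one_smul] at this

lemma single_monomial_eq_pureTensor (b a : Idx n r) (u : Fin r →₀ ℕ) (c : K) :
    (Matrix.single b a (MvPolynomial.monomial u c) : PolyMat K n r) =
      c • pureTensor K n r fun p => Matrix.single (b p) (a p) (Polynomial.X ^ u p) := by
  ext1 b' a'
  rw [Matrix.smul_apply, pureTensor_apply]
  by_cases h : b = b' ∧ a = a'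
  · obtain ⟨rfl, rfl⟩ := h
    rw [Matrix.single_apply_same, MvPolynomial.monomial_eq, MvPolynomial.smul_eq_C_mul,
      Finsupp.prod_fintype _ _ fun p => pow_zero _]
    simp
  · rw [Matrix.single_apply, if_neg h]
    have : ∃ p, ¬ (b p = b' p ∧ a p = a' p) := by
      by_contra hne
      push Not at hne
      exact h ⟨funext fun p => (hne p).1, funext fun p => (hne p).2⟩
    obtain ⟨p, hp⟩ := this
    rw [Finset.prod_eq_zero (Finset.mem_univ p), smul_zero]
    rw [Matrix.single_apply, if_neg hp, map_zero]

lemma span_range_pureTensor : Submodule.span K (Set.range (pureTensor K n r)) = ⊤ := by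
  rw [eq_top_iff]
  rintro M -
  rw [Matrix.matrix_eq_sum_single M]
  refine Submodule.sum_mem _ fun b _ => Submodule.sum_mem _ fun a _ => ?_
  induction M b a using MvPolynomial.induction_on' with
  | monomial u c =>
    rw [single_monomial_eq_pureTensor]
    exact Submodule.smul_mem _ _ (Submodule.subset_span ⟨_, rfl⟩)
  | add f g hf hg =>
    rw [Matrix.single_add]
    exact Submodule.add_mem _ hf hg

/-- In characteristic `0`, the invariants in `gl_n[x]^{⊗ r}` are generated by the elements
`∑ p, 1 ⊗ ⋯ ⊗ y ⊗ ⋯ ⊗ 1`. -/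
lemma mem_of_invariant [CharZero K] (B : Subalgebra K (PolyMat K n r))
    (hB : ∀ y, diagMat r y ∈ B) (M : PolyMat K n r) (hM : ∀ w, permConj K n r w M = M) :
    M ∈ B := by
  have hsym : ∀ M : PolyMat K n r, symmetrize K n r M ∈ B := by
    intro M
    have h : Submodule.span K (Set.range (pureTensor K n r)) ≤
        (Subalgebra.toSubmodule B).comap (symmetrize K n r) := by
      rw [Submodule.span_le]
      rintro _ ⟨y, rfl⟩
      exact symmetrize_pureTensor_mem B hB Finset.univ y
        fun p hp => absurd (Finset.mem_univ p) hp
    rw [span_range_pureTensor] at h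
    exact h Submodule.mem_top
  have h := B.smul_mem (hsym M) (r.factorial : K)⁻¹
  rwa [symmetrize_of_invariant hM, smul_smul,
    inv_mul_cancel₀ (Nat.cast_ne_zero.2 r.factorial_ne_zero), one_smul] at h

end Invariants

/-! ### Symbols of the generators of the Yangian -/

section Surjectivity

variable {K : Type*} [Field K] {n r : ℕ}

/-- Modulo lower degree, a coefficient of a product of matrix series with constant term `1` is the
sum of the coefficients of the factors: a term with coefficients of positive order from `k` factors
has degree lower by `k - 1`. -/
lemma list_prod_sub_sum_mem (L : List (Matrix (Fin n) (Fin n) (PowerSeries (FreeEnd K n r))))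
    (h0 : ∀ S ∈ L, ∀ k l, PowerSeries.coeff 0 (S k l) = if k = l then 1 else 0)
    (h : ∀ S ∈ L, ∀ k l d e, ∀ m ∈ freeFilt K n r e,
      PowerSeries.coeff d (S k l) m ∈ freeFilt K n r (d - 1 + e))
    (i j : Fin n) (d e : ℕ) (m : FreeTensor K n r) (hm : m ∈ freeFilt K n r e) :
    PowerSeries.coeff (d + 1) (L.prod i j) m -
      (L.map fun (S : Matrix (Fin n) (Fin n) (PowerSeries (FreeEnd K n r))) =>
         PowerSeries.coeff (d + 1) (S i j) m).sum ∈
        prevStep (freeFilt K n r) (d + e) := by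
  induction L with
  | nil =>
    have : PowerSeries.coeff (d + 1)
        ((1 : Matrix (Fin n) (Fin n) (PowerSeries (FreeEnd K n r))) i j) = 0 := by
      rw [Matrix.one_apply]
      split_ifs
      · rw [PowerSeries.coeff_one, if_neg (Nat.succ_ne_zero d)]
      · exact map_zero _
    rw [List.prod_nil, this, List.map_nil, List.sum_nil, LinearMap.zero_apply, sub_zero]
    exact Submodule.zero_mem _
  | cons S L ih =>
    have hL0 : ∀ S ∈ L, ∀ k l, PowerSeries.coeff 0 (S k l) = if k = l then 1 else 0 :=
      fun S hS => h0 S (List.mem_cons_of_mem _ hS)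
    have hL : ∀ S ∈ L, ∀ k l d e, ∀ m ∈ freeFilt K n r e,
        PowerSeries.coeff d (S k l) m ∈ freeFilt K n r (d - 1 + e) :=
      fun S hS => h S (List.mem_cons_of_mem _ hS)
    have ih := ih hL0 hL
    have hrest : PowerSeries.coeff (d + 1) ((S * L.prod) i j) m -
        (PowerSeries.coeff (d + 1) (S i j) m + PowerSeries.coeff (d + 1) (L.prod i j) m) ∈
          prevStep (freeFilt K n r) (d + e) := by
      have hS0 : ∀ f : Fin n → FreeEnd K n r,
          ∑ t, PowerSeries.coeff 0 (S i t) * f t = f i := by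
        intro f
        simp only [h0 S List.mem_cons_self, ite_mul, one_mul, zero_mul, Finset.sum_ite_eq,
          Finset.mem_univ, if_true]
      have hP0 : ∀ f : Fin n → FreeEnd K n r,
          ∑ t, f t * PowerSeries.coeff 0 (L.prod t j) = f j := by
        intro f
        simp only [coeff_zero_prod L hL0, mul_ite, mul_one, mul_zero, Finset.sum_ite_eq',
          Finset.mem_univ, if_true]
      rw [Matrix.mul_apply, map_sum]
      simp only [PowerSeries.coeff_mul, Finset.Nat.sum_antidiagonal_succ, Finset.sum_add_distrib]
      rw [hS0 fun t => PowerSeries.coeff (d + 1) (L.prod t j)]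
      cases d with
      | zero =>
        simp only [Finset.Nat.antidiagonal_zero, Finset.sum_singleton]
        rw [hP0 fun t => PowerSeries.coeff (0 + 1) (S i t), LinearMap.add_apply]
        convert Submodule.zero_mem (prevStep (freeFilt K n r) (0 + e)) using 1
        abel
      | succ d =>
        simp only [Finset.Nat.sum_antidiagonal_succ', Finset.sum_add_distrib]
        rw [hP0 fun t => PowerSeries.coeff (d + 1 + 1) (S i t)]
        have hR : (∑ t, ∑ p ∈ Finset.HasAntidiagonal.antidiagonal d,
            PowerSeries.coeff (p.1 + 1) (S i t) * PowerSeries.coeff (p.2 + 1) (L.prod t j)) m ∈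
              freeFilt K n r (d + e) := by
          rw [LinearMap.sum_apply]
          refine Submodule.sum_mem _ fun t _ => ?_
          rw [LinearMap.sum_apply]
          refine Submodule.sum_mem _ fun p hp => ?_
          rw [Module.End.mul_apply]
          have := h S List.mem_cons_self i t (p.1 + 1) _ _
            (list_prod_raises L hL t j (p.2 + 1) e m hm)
          rw [← Finset.HasAntidiagonal.mem_antidiagonal.1 hp]
          rwa [Nat.add_sub_cancel, Nat.add_sub_cancel, ← add_assoc] at this
        rw [Nat.add_right_comm]
        change _ ∈ freeFilt K n r (d + e)
        convert hR using 1
        simp only [LinearMap.add_apply]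
        abel
    have e1 : PowerSeries.coeff (d + 1) ((S * L.prod) i j) m -
        (PowerSeries.coeff (d + 1) (S i j) m +
          (L.map fun (S : Matrix (Fin n) (Fin n) (PowerSeries (FreeEnd K n r))) =>
         PowerSeries.coeff (d + 1) (S i j) m).sum) =
        (PowerSeries.coeff (d + 1) ((S * L.prod) i j) m -
        (PowerSeries.coeff (d + 1) (S i j) m + PowerSeries.coeff (d + 1) (L.prod i j) m)) +
        (PowerSeries.coeff (d + 1) (L.prod i j) m -
          (L.map fun (S : Matrix (Fin n) (Fin n) (PowerSeries (FreeEnd K n r))) =>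
         PowerSeries.coeff (d + 1) (S i j) m).sum) := by abel
    rw [List.prod_cons, List.map_cons, List.sum_cons, e1]
    exact Submodule.add_mem _ hrest ih

lemma mkQ_mem_prevStep {d : ℕ} {m : FreeTensor K n r} (hm : m ∈ prevStep (freeFilt K n r) d) :
    (relSub K n r).mkQ m ∈ prevStep (indFilt K n r) d := by
  cases d with
  | zero =>
    have : m = 0 := (Submodule.mem_bot K).1 hm
    rw [this, map_zero]
    exact Submodule.zero_mem _
  | succ d => exact ⟨m, hm, rfl⟩

lemma diagMat_currentE_apply (i j : Fin n) (d : ℕ) (b a : Idx n r) :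
    diagMat r (currentE K i j d) b a = ∑ p, if b p = i then
      MvPolynomial.X p ^ d * (Pi.single a 1 : PolyTensor K n r) (Function.update b p j) else 0 := by
  rw [diagMat_apply, Matrix.sum_apply]
  refine Finset.sum_congr rfl fun p _ => ?_
  rw [pureTensor_apply]
  by_cases h : Function.update b p j = a
  · subst h
    rw [Pi.single_eq_same, mul_one, Finset.prod_eq_single p]
    · rw [Pi.mulSingle_eq_same, Function.update_self, currentE, Matrix.single_apply]
      simp only [and_true, eq_comm (a := i)]
      split_ifs <;> simp
    · intro t _ ht
      rw [Pi.mulSingle_eq_of_ne ht, Function.update_of_ne ht, Matrix.one_apply_eq, map_one]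
    · exact fun h => absurd (Finset.mem_univ p) h
  · rw [Pi.single_eq_of_ne h, mul_zero, ite_self]
    obtain ⟨t, ht⟩ := Function.ne_iff.1 h
    refine Finset.prod_eq_zero (Finset.mem_univ t) ?_
    by_cases htp : t = p
    · subst htp
      rw [Function.update_self] at ht
      rw [Pi.mulSingle_eq_same, currentE, Matrix.single_apply, if_neg (fun h => ht h.2),
        map_zero]
    · rw [Function.update_of_ne htp] at ht
      rw [Pi.mulSingle_eq_of_ne htp, Matrix.one_apply_ne ht, map_zero]

/-- The symbol of the image of `T_{i,j}^{(d+1)}` is the action of `e_{i,j;d}`. -/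
lemma topMat_drinfeld_T (i j : Fin n) (d : ℕ) :
    topMat K n r d (drinfeld K n r (Yangian.T K i j (d + 1))) = diagMat r (currentE K i j d) := by
  ext1 b a
  rw [diagMat_currentE_apply, topMat_apply, asMat_apply, asEnd_apply]
  set m₀ : PolyTensor K n r := Pi.single a 1 with hm₀
  set q : PolyTensor K n r := fun b => ∑ p, if b p = i then
      MvPolynomial.X p ^ d * m₀ (Function.update b p j) else 0 with hq
  have hmem : (fun c => AH.poly (m₀ c)) ∈ freeFilt K n r 0 := by
    refine (mem_freeFilt _ _).2 fun c => Submodule.subset_span ⟨[], m₀ c, ?_, by simp [AH.perm]⟩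
    rw [hm₀, Pi.single_apply]
    split_ifs <;> simp
  have herr := list_prod_sub_sum_mem
    (List.ofFn fun p => evalMatrix (eOp K n r p) (mulOp K n r (AH.x K p)))
    (by
      intro S hS k l
      rw [List.mem_ofFn] at hS
      obtain ⟨p, rfl⟩ := hS
      rw [coeff_evalMatrix]
      simp)
    (by
      intro S hS k l d e m hm
      rw [List.mem_ofFn] at hS
      obtain ⟨p, rfl⟩ := hS
      exact evalMatrix_raises p k l d e m hm) i j d 0 _ hmem
  have hsum : ((List.ofFn fun p => evalMatrix (eOp K n r p) (mulOp K n r (AH.x K p))).map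
      fun (S : Matrix (Fin n) (Fin n) (PowerSeries (FreeEnd K n r))) =>
        PowerSeries.coeff (d + 1) (S i j) fun c => AH.poly (m₀ c)).sum =
        fun c => AH.poly (q c) := by
    rw [List.map_ofFn, List.sum_ofFn]
    ext1 c
    rw [Finset.sum_apply, hq, map_sum]
    refine Finset.sum_congr rfl fun p _ => ?_
    rw [Function.comp_apply, coeff_evalMatrix, if_neg (by simp), zero_add,
      if_neg (Nat.succ_ne_zero d),
      Nat.add_sub_cancel, ← map_pow, Module.End.mul_apply, eOp_apply, mulOp_apply]
    split_ifs
    · rw [map_mul, map_pow, AH.poly_X]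
    · rw [map_zero]
  rw [hsum] at herr
  have hind := mkQ_mem_prevStep herr
  have hT : drinfeld K n r (Yangian.T K i j (d + 1)) (polyToInd m₀) =
      (relSub K n r).mkQ (PowerSeries.coeff (d + 1) (tMatrix K n r i j)
        fun c => AH.poly (m₀ c)) := by
    rw [polyToInd, drinfeld_mk, drinfeldTilde_T]
  rw [map_sub] at hind
  change (relSub K n r).mkQ (PowerSeries.coeff (d + 1) (tMatrix K n r i j)
    fun c => AH.poly (m₀ c)) - polyToInd q ∈ _ at hind
  rw [← hT, add_zero] at hind
  obtain ⟨g, hg⟩ := polyToInd_surjective (drinfeld K n r (Yangian.T K i j (d + 1)) (polyToInd m₀))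
  have hsub : polyToInd g - polyToInd q = polyToInd (g - q) :=
    (map_sub (polyToIndLin K n r) _ _).symm
  rw [← hg, hsub, polyToInd_mem_prevStep, mem_polyLT] at hind
  have h1 := homogeneousComponent_of_mem_degLT (hind b)
  rw [Pi.sub_apply, map_sub, sub_eq_zero] at h1
  rw [← hg, indToPoly_polyToInd, h1]
  refine MvPolynomial.homogeneousComponent_eq_self ?_
  refine MvPolynomial.IsHomogeneous.sum _ _ _ fun p _ => ?_
  split_ifs
  · rw [hm₀, Pi.single_apply]
    split_ifs
    · rw [mul_one]
      exact MvPolynomial.isHomogeneous_X_pow p d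
    · rw [mul_zero]
      exact MvPolynomial.isHomogeneous_zero _ _ _
  · exact MvPolynomial.isHomogeneous_zero _ _ _

/-! ### Surjectivity -/

attribute [local instance] LieRing.ofAssociativeRing

lemma symbolMat_grDrinfeld_ι (y : Current K n) :
    symbolMat K n r (grDrinfeld K n r (UniversalEnvelopingAlgebra.ι K y)) = diagMat r y := by
  have hy : y ∈ Submodule.span K {A : Current K n | ∃ i j d, A = currentE K i j d} := by
    rw [current_span]
    exact Submodule.mem_top
  induction hy using Submodule.span_induction with
  | mem y hy =>
    obtain ⟨i, j, d, rfl⟩ := hy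
    rw [grDrinfeld, AlgHom.comp_apply, currentToGr_E, AlgFiltration.grMap_symb, symbolMat_symb,
      topMat_drinfeld_T]
  | zero => rw [map_zero, map_zero, map_zero, map_zero]
  | add y z _ _ hy hz => rw [map_add, map_add, map_add, map_add, hy, hz]
  | smul c y _ hy => rw [map_smul, map_smul, map_smul, map_smul, hy]

lemma symbolHom_grDrinfeld_surjective [CharZero K] :
    Function.Surjective fun y : UCurrent K n => symbolHom K n r (grDrinfeld K n r y) := by
  intro φ
  have hmem : (matEnd K n r).symm φ.1 ∈ ((symbolMat K n r).comp (grDrinfeld K n r)).range := by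
    refine mem_of_invariant _ (fun y => ?_) _ fun w => ?_
    · exact (AlgHom.mem_range _).2 ⟨_, symbolMat_grDrinfeld_ι y⟩
    have h := φ.2
    rw [← (matEnd K n r).apply_symm_apply φ.1, matEnd_mem_AS0] at h
    ext1 b a
    rw [permConj_apply, h w, MvPolynomial.rename_rename]
    simp
  obtain ⟨y, hy⟩ := hmem
  refine ⟨y, Subtype.ext ?_⟩
  rw [coe_symbolHom]
  exact (congrArg (matEnd K n r) hy).trans ((matEnd K n r).apply_symm_apply φ.1)

end Surjectivity

end DrinfeldSchur

theorem corollary9p3 (K : Type*) [Field K] [CharZero K] (n r : ℕ) :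
    (∃ β : (DrinfeldSchur.filtAS K n r).Gr ≃ₐ[K] DrinfeldSchur.AS0 K n r,
      DrinfeldSchur.IsSymbolIso β ∧
      Function.Surjective fun y : DrinfeldSchur.UCurrent K n =>
        β (DrinfeldSchur.grDrinfeld K n r y)) ∧
    Function.Surjective (DrinfeldSchur.drinfeld K n r) := by
  have hgen := DrinfeldSchur.symbolHom_grDrinfeld_surjective (K := K) (n := n) (r := r)
  have hbij : Function.Bijective (DrinfeldSchur.symbolHom K n r) :=
    ⟨DrinfeldSchur.symbolHom_injective, Function.Surjective.of_comp hgen⟩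
  refine ⟨⟨AlgEquiv.ofBijective (DrinfeldSchur.symbolHom K n r) hbij,
    DrinfeldSchur.isSymbolIso_of_eq_symbolHom _ fun _ => rfl, hgen⟩, ?_⟩
  refine DrinfeldSchur.AlgFiltration.surjective_of_grMap _ _ _ DrinfeldSchur.drinfeld_filtered
    DrinfeldSchur.filtAS_exhaustive fun z => ?_
  obtain ⟨y, hy⟩ := hgen (DrinfeldSchur.symbolHom K n r z)
  exact ⟨DrinfeldSchur.currentToGr K n y, DrinfeldSchur.symbolHom_injective hy⟩
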